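/- Let $f:\mathbb R\to\mathbb R$ be an even, smooth, compactly supported function, with Fourier transform $\hat f(t)=\frac1{\sqrt{2\pi}}\int_{\mathbb R}f(x)e^{-itx}\,dx$. For each $N$ let $f_N$ be the $2\pi$-periodic function on $\mathbb R$ with $f_N(\theta)=f(N\theta)$ for $\theta\in[-\pi,\pi)$. For each $N$ let $(\theta_1,\dots,\theta_N)\in[0,2\pi)^N$ be distributed as the CUE, that is, with joint density $\frac{1}{(2\pi)^N N!}\prod_{j<k}|e^{i\theta_j}-e^{i\theta_k}|^2$ with respect to Lebesgue measure, and let $$B_N(f)=\sum_{1\le i,j\le N}f_N(\tau_i-\theta_j),$$ where $\{\tau_i\}_{i=1}^N$ is one of the following: (i) an $N$-point CUE configuration independent of $\{\theta_j\}$; (ii) $N$ i.i.d. points, uniformly distributed on the unit circle (angles uniform on $[0,2\pi)$), independent of $\{\theta_j\}$; (iii) the deterministic points $\tau_i=\frac{2\pi i}{N}$, $i=1,\dots,N$. Then, in each case, $B_N(f)$ is integrable and $\mathbb E B_N(f)=\frac{N}{2\pi}\int_{\mathbb R}f(x)\,dx$ for every $N$ with $\operatorname{supp} f\subset[-\pi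 N,\pi N]$ (hence for all sufficiently large $N$), and as $N\to\infty$ the random variables $(B_N(f)-\mathbb E B_N(f))/\sqrt N$ converge in distribution to a centered real Gaussian random variable with variance $\sigma^2(f)$ (the point mass at $0$ if $\sigma^2(f)=0$), where $$\sigma^2(f)=\begin{cases}\frac1{2\pi}\int_{\mathbb R}|\hat f(t)|^2\min(|t|,1)^2\,dt&\text{in case (i)},\\[2pt]\frac1{2\pi}\int_{\mathbb R}|\hat f(t)|^2\min(|t|,1)\,dt&\text{in case (ii)},\\[2pt]\frac1{2\pi}\sum_{l\in\mathbb Z\setminus\{0\}}|\hat f(l)|^2&\text{in case (iii)},\end{cases}$$ the integrals and the series being convergent. -/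

import Mathlib

open MeasureTheory ProbabilityTheory Filter Topology

noncomputable section

/-- The normalization constant `Z_{β,N} = (2π)^N Γ(1 + βN/2) / Γ(1 + β/2)^N`
of the circular beta ensemble. -/
def circularBetaZ (β : ℝ) (N : ℕ) : ℝ :=
  (2 * Real.pi) ^ N * (Real.Gamma (1 + β * N / 2) / Real.Gamma (1 + β / 2) ^ N)

/-- The joint probability density of the `N` angles of the circular beta ensemble,
`(1 / Z_{β,N}) ∏_{j<k} |e^{iθ_j} - e^{iθ_k}|^β`. -/
def circularBetaDensity (β : ℝ) (N : ℕ) (θ : Fin N → ℝ) : ℝ :=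
  (1 / circularBetaZ β N) *
    ∏ j : Fin N, ∏ k ∈ Finset.Ioi j,
      ‖Complex.exp (Complex.I * (θ j : ℂ)) - Complex.exp (Complex.I * (θ k : ℂ))‖ ^ β

/-- The law of the angles `(θ_1, …, θ_N) ∈ [0, 2π)^N` of the circular beta ensemble. -/
def circularBetaEnsemble (β : ℝ) (N : ℕ) : Measure (Fin N → ℝ) :=
  (volume.restrict (Set.univ.pi fun _ => Set.Ico 0 (2 * Real.pi))).withDensity
    fun θ => ENNReal.ofReal (circularBetaDensity β N θ)

/-- The law of the angles of the circular unitary ensemble: the case `β = 2`. -/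
def circularUnitaryEnsemble (N : ℕ) : Measure (Fin N → ℝ) :=
  circularBetaEnsemble 2 N

/-- The law of the angle of a uniformly distributed point on the unit circle. -/
def uniformAngle : Measure ℝ :=
  ENNReal.ofReal (1 / (2 * Real.pi)) • volume.restrict (Set.Ico 0 (2 * Real.pi))

/-- The Fourier transform `f̂(t) = (2π)^{-1/2} ∫ f(x) e^{-itx} dx`. -/
def fourierHat (f : ℝ → ℝ) (t : ℝ) : ℂ :=
  (1 / (Real.sqrt (2 * Real.pi) : ℂ)) *
    ∫ x : ℝ, (f x : ℂ) * Complex.exp (-Complex.I * (t : ℂ) * (x : ℂ))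

/-- The function equal to `f(L θ)` for `θ ∈ [-π, π)`, extended `2π`-periodically
to the real line. -/
def periodicScale (f : ℝ → ℝ) (L : ℝ) (θ : ℝ) : ℝ :=
  f (L * toIcoMod Real.two_pi_pos (-Real.pi) θ)

/-- The bipartite statistic `B_N(f) = ∑_{i,j} f_L(τ_i - θ_j)` with `L = N`. -/
def localBipartite (f : ℝ → ℝ) {N : ℕ} (τ θ : Fin N → ℝ) : ℝ :=
  ∑ i : Fin N, ∑ j : Fin N, periodicScale f N (τ i - θ j)

/-- The mean and the fluctuations of a sequence of random variables `B_N`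
attached to a compactly supported function `f`. Every `B_N` is integrable; its mean is
`(N / 2π) ∫ f` as soon as the support of `f` lies in `[-πN, πN]`, so that `f(N ·)` fits on the
circle (in particular for all large `N`); and `(B_N - 𝔼 B_N) / √N` converges in distribution to
the centered real Gaussian law of variance `σ2`. -/
def HasLocalGaussianLimit (f : ℝ → ℝ) {Ω : ℕ → Type*} [∀ N, MeasurableSpace (Ω N)]
    (P : ∀ N, Measure (Ω N)) [∀ N, IsProbabilityMeasure (P N)]
    (B : ∀ N, Ω N → ℝ) (σ2 : ℝ) : Prop :=
  (∀ N, Integrable (B N) (P N)) ∧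
  (∀ N : ℕ, Function.support f ⊆ Set.Icc (-(Real.pi * N)) (Real.pi * N) →
    ∫ ω, B N ω ∂(P N) = N / (2 * Real.pi) * ∫ x, f x) ∧
  TendstoInDistribution
    (fun N ω => (B N ω - ∫ ω', B N ω' ∂(P N)) / Real.sqrt N) atTop
    (id : ℝ → ℝ) P (gaussianReal 0 σ2.toNNReal)

end

/-! Condition on `τ`. The centred statistic equals `∑_j h_τ(θ_j)`, where `h_τ(x)` is `∑_i f_N(τ_i -
x)` minus its mean. This is a linear statistic of the CUE. Its conditional variance is `V_N(τ) =
∑_{k≥1} 2 w_k |∑_j e^{ikτ_j}|²` with `w_k = |f̂(k/N)|² min(k,N) / (2πN²)`. Two facts are needed: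
given `τ`, the characteristic function at `t/√N` is close to `exp(-t² V_N(τ)/(2N))`; and `V_N(τ)/N`
has a deterministic limit `σ²`. The second is only used as convergence of `E exp(-u V_N/N)` to
`exp(-uσ²)` with `u = t²/2`.

Conditional normality has to be uniform in the test function, because `h_τ` is random and changes
with `N`. By Heine's identity the characteristic function of `∑_j g(θ_j)` is `det(1 + E)`, where `E`
is the Toeplitz matrix of `e^{isg} - 1` and `s = t/√N`. Its logarithm is `tr E - tr E²/2` up to
`2‖E‖ ‖E‖_F²` (`norm_det_one_add_mul_exp_sub_one_le`). The operator norm is at most `|t|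
(∫g⁴/N)^{1/4}` (`l2_opNorm_toeplitz_le`) and the Frobenius norm stays bounded, so the error involves
`g` only through its fourth moment. The two traces produce the variance with weights `min(k,N)`.
This is `HasLinearGaussianLimit`. For random `τ` the fourth moment of `h_τ` is bounded on average,
since multiplicative statistics of the CUE and of independent points are dominated by Poisson ones
(`HasPoissonBound`); for the equally spaced points `h_τ` is uniformly bounded.

For the limit of `V_N` with random `τ`, `exp(-u V_N/N)` is the Gaussian average of `exp(is ∑_j
g_ω(τ_j))`, where `g_ω` is a random trigonometric polynomial with independent Gaussian coefficients
(Hubbard–Stratonovich linearization; `s² = 2u/N`). With the order of integration exchanged, the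
linear central limit theorem, now for the points `τ`, replaces the inner average by `exp(-u ∑ a_i
ω_i²)`. Since `∑ a_i² = O(1/N)`, this weighted chi-square concentrates at `∑ a_i`, which is a
Riemann sum for `σ²`. The two random cases differ only in the variance weights of the `τ` process:
`min(k,N)` for the CUE, `N` for independent points. For equally spaced points the power sums vanish
off the multiples of `N`, so `V_N/N` is already constant in `N ≥ 1`. -/

/-! ### Andréief's and Heine's identities for the CUE. -/

/-- The `m`-th Fourier coefficient with respect to the uniform measure on `[0, 2π)`. -/
noncomputable def angleCoeff (φ : ℝ → ℂ) (m : ℤ) : ℂ :=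
  ∫ x, φ x * Complex.exp (-(m * x * Complex.I)) ∂uniformAngle

/-- The `N × N` Toeplitz matrix with symbol `φ`. -/
noncomputable def toeplitz (N : ℕ) (φ : ℝ → ℂ) : Matrix (Fin N) (Fin N) ℂ :=
  Matrix.of fun j k => angleCoeff φ ((j : ℤ) - (k : ℤ))

instance isProbabilityMeasure_uniformAngle : IsProbabilityMeasure uniformAngle := by
  constructor
  have h : (0 : ℝ) < 2 * Real.pi := Real.two_pi_pos
  simp only [uniformAngle, Measure.smul_apply, Measure.restrict_apply MeasurableSet.univ,
    Set.univ_inter, Real.volume_Ico, smul_eq_mul, sub_zero]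
  rw [← ENNReal.ofReal_mul (by positivity), one_div_mul_cancel h.ne', ENNReal.ofReal_one]

lemma integral_Ico_eq_uniformAngle (φ : ℝ → ℂ) :
    ∫ x, φ x ∂(volume.restrict (Set.Ico 0 (2 * Real.pi))) =
      (2 * Real.pi : ℝ) * ∫ x, φ x ∂uniformAngle := by
  have h : (0 : ℝ) < 2 * Real.pi := Real.two_pi_pos
  rw [uniformAngle, integral_smul_measure, ENNReal.toReal_ofReal (by positivity),
    Complex.real_smul, ← mul_assoc, ← Complex.ofReal_mul, mul_one_div_cancel h.ne']
  simp

lemma integrable_Ico_iff_uniformAngle (φ : ℝ → ℂ) :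
    Integrable φ (volume.restrict (Set.Ico 0 (2 * Real.pi))) ↔ Integrable φ uniformAngle := by
  have h : (0 : ℝ) < 2 * Real.pi := Real.two_pi_pos
  rw [uniformAngle, integrable_smul_measure]
  · simpa using h
  · exact ENNReal.ofReal_ne_top

lemma circularBetaZ_two (N : ℕ) :
    circularBetaZ 2 N = (2 * Real.pi) ^ N * (Nat.factorial N : ℝ) := by
  have h2 : Real.Gamma 2 = 1 := by
    rw [show (2 : ℝ) = (1 : ℕ) + 1 by norm_num, Real.Gamma_nat_eq_factorial]
    simp
  have h : (1 : ℝ) + 2 * N / 2 = N + 1 := by ring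
  rw [circularBetaZ, h, Real.Gamma_nat_eq_factorial]
  norm_num [h2]

/-- The product of squared differences is `|det|²` of the Vandermonde matrix in `e^{iθ_j}`.
Expanding the determinant and its conjugate by Leibniz gives a sum of products over single angles,
which Fubini can separate. -/
lemma circularBetaDensity_two (N : ℕ) (θ : Fin N → ℝ) :
    ((circularBetaDensity 2 N θ : ℝ) : ℂ) =
      (1 / ((2 * Real.pi : ℝ) ^ N * (Nat.factorial N : ℂ))) *
      ∑ σ : Equiv.Perm (Fin N), ∑ π : Equiv.Perm (Fin N),
        ((Equiv.Perm.sign σ : ℤ) : ℂ) * ((Equiv.Perm.sign π : ℤ) : ℂ) *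
        ∏ j, Complex.exp (-((((π j : ℕ) : ℤ) - ((σ j : ℕ) : ℤ) : ℤ) * θ j * Complex.I)) := by
  set v : Fin N → ℂ := fun j => Complex.exp (Complex.I * (θ j : ℂ)) with hv
  have hdet : (Matrix.vandermonde v).det =
      ∑ σ : Equiv.Perm (Fin N), ((Equiv.Perm.sign σ : ℤ) : ℂ) *
        ∏ j, Complex.exp (((σ j : ℕ) : ℂ) * θ j * Complex.I) := by
    rw [← Matrix.det_transpose, Matrix.det_apply']
    refine Finset.sum_congr rfl fun σ _ => ?_
    congr 1
    refine Finset.prod_congr rfl fun j _ => ?_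
    rw [Matrix.transpose_apply, Matrix.vandermonde_apply, hv, ← Complex.exp_nat_mul]
    congr 1; ring
  have hconj : (starRingEnd ℂ) (Matrix.vandermonde v).det =
      ∑ σ : Equiv.Perm (Fin N), ((Equiv.Perm.sign σ : ℤ) : ℂ) *
        ∏ j, Complex.exp (-(((σ j : ℕ) : ℂ) * θ j * Complex.I)) := by
    rw [hdet, map_sum]
    refine Finset.sum_congr rfl fun σ _ => ?_
    rw [map_mul, map_prod]
    congr 1
    · simp
    · refine Finset.prod_congr rfl fun j _ => ?_
      rw [← Complex.exp_conj]
      simp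
  have hprod : ((∏ j : Fin N, ∏ k ∈ Finset.Ioi j,
      ‖Complex.exp (Complex.I * (θ j : ℂ)) - Complex.exp (Complex.I * (θ k : ℂ))‖ ^ (2 : ℝ) : ℝ) : ℂ)
      = (Matrix.vandermonde v).det * (starRingEnd ℂ) (Matrix.vandermonde v).det := by
    rw [Complex.mul_conj, Matrix.det_vandermonde, map_prod]
    congr 1
    refine Finset.prod_congr rfl fun j _ => ?_
    rw [map_prod]
    refine Finset.prod_congr rfl fun k _ => ?_
    rw [Complex.normSq_eq_norm_sq, norm_sub_rev, hv]
    norm_cast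
  rw [circularBetaDensity, Complex.ofReal_mul, hprod, hconj, hdet, circularBetaZ_two,
    Finset.sum_mul_sum]
  push_cast
  congr 1
  refine Finset.sum_congr rfl fun σ _ => Finset.sum_congr rfl fun π _ => ?_
  rw [mul_mul_mul_comm, ← Finset.prod_mul_distrib]
  congr 1
  refine Finset.prod_congr rfl fun j _ => ?_
  rw [← Complex.exp_add]
  congr 1; ring

lemma circularBetaDensity_two_nonneg (N : ℕ) (θ : Fin N → ℝ) : 0 ≤ circularBetaDensity 2 N θ := by
  rw [circularBetaDensity, circularBetaZ_two]
  exact mul_nonneg (by positivity)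
    (Finset.prod_nonneg fun j _ => Finset.prod_nonneg fun k _ => by positivity)

lemma measurable_circularBetaDensity_two (N : ℕ) : Measurable (circularBetaDensity 2 N) := by
  unfold circularBetaDensity
  refine Measurable.const_mul ?_ _
  refine Finset.measurable_fun_prod _ fun j _ => Finset.measurable_fun_prod _ fun k _ => ?_
  exact Measurable.pow_const (by fun_prop) _

/-- Integrals against the circular unitary ensemble as integrals against the density. -/
lemma integral_circularUnitaryEnsemble (N : ℕ) (F : (Fin N → ℝ) → ℂ) :
    ∫ θ, F θ ∂(circularUnitaryEnsemble N) =
      ∫ θ, (circularBetaDensity 2 N θ : ℂ) * F θ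
        ∂(Measure.pi fun _ : Fin N => volume.restrict (Set.Ico 0 (2 * Real.pi))) := by
  rw [circularUnitaryEnsemble, circularBetaEnsemble, integral_withDensity_eq_integral_toReal_smul
    (measurable_circularBetaDensity_two N).ennreal_ofReal (by simp), volume_pi,
    Measure.restrict_pi_pi]
  refine integral_congr_ae (.of_forall fun θ => ?_)
  simp [ENNReal.toReal_ofReal (circularBetaDensity_two_nonneg N θ)]

/-- Andréief's identity for products of functions of the individual angles of the circular
unitary ensemble. -/
lemma integral_prod_circularUnitaryEnsemble (N : ℕ) (φ : Fin N → ℝ → ℂ)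
    (hφ : ∀ j, Integrable (φ j) uniformAngle) :
    ∫ θ, ∏ j, φ j (θ j) ∂(circularUnitaryEnsemble N) =
      (1 / (Nat.factorial N : ℂ)) * ∑ σ : Equiv.Perm (Fin N), ∑ π : Equiv.Perm (Fin N),
        ((Equiv.Perm.sign σ : ℤ) : ℂ) * ((Equiv.Perm.sign π : ℤ) : ℂ) *
        ∏ j, angleCoeff (φ j) (((π j : ℕ) : ℤ) - ((σ j : ℕ) : ℤ)) := by
  have hpi : (2 * Real.pi : ℝ) ≠ 0 := Real.two_pi_pos.ne'
  have hint : ∀ (m : ℤ) (j : Fin N), Integrable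
      (fun x : ℝ => φ j x * Complex.exp (-(m * x * Complex.I)))
      (volume.restrict (Set.Ico 0 (2 * Real.pi))) := by
    intro m j
    refine Integrable.mul_bdd (c := 1) ((integrable_Ico_iff_uniformAngle _).2 (hφ j))
      (by fun_prop) (.of_forall fun x => ?_)
    rw [show (-(m * x * Complex.I) : ℂ) = ((-(m * x) : ℝ) : ℂ) * Complex.I by push_cast; ring,
      Complex.norm_exp_ofReal_mul_I]
  have hF : ∀ θ : Fin N → ℝ, (circularBetaDensity 2 N θ : ℂ) * ∏ j, φ j (θ j) =
      (1 / ((2 * Real.pi : ℝ) ^ N * (Nat.factorial N : ℂ))) *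
      ∑ σ : Equiv.Perm (Fin N), ∑ π : Equiv.Perm (Fin N),
        (((Equiv.Perm.sign σ : ℤ) : ℂ) * ((Equiv.Perm.sign π : ℤ) : ℂ)) *
        ∏ j, (fun (j : Fin N) (x : ℝ) => φ j x *
          Complex.exp (-((((π j : ℕ) : ℤ) - ((σ j : ℕ) : ℤ) : ℤ) * x * Complex.I))) j (θ j) := by
    intro θ
    rw [circularBetaDensity_two, mul_assoc, Finset.sum_mul]
    congr 1
    refine Finset.sum_congr rfl fun σ _ => ?_
    rw [Finset.sum_mul]
    refine Finset.sum_congr rfl fun π _ => ?_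
    rw [mul_assoc, Finset.prod_mul_distrib, mul_comm (∏ j, φ j (θ j))]
  have hI : ∀ σ π : Equiv.Perm (Fin N), Integrable (fun θ : Fin N → ℝ =>
      (((Equiv.Perm.sign σ : ℤ) : ℂ) * ((Equiv.Perm.sign π : ℤ) : ℂ)) *
        ∏ j, (fun (j : Fin N) (x : ℝ) => φ j x *
          Complex.exp (-((((π j : ℕ) : ℤ) - ((σ j : ℕ) : ℤ) : ℤ) * x * Complex.I))) j (θ j))
      (Measure.pi fun _ : Fin N => volume.restrict (Set.Ico 0 (2 * Real.pi))) :=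
    fun σ π => (Integrable.fintype_prod fun j => hint _ j).const_mul _
  rw [integral_circularUnitaryEnsemble]
  simp_rw [hF]
  rw [integral_const_mul, integral_finsetSum _ fun σ _ => integrable_finsetSum _ fun π _ => hI σ π,
    one_div, mul_inv, mul_comm (((2 * Real.pi : ℝ) : ℂ) ^ N)⁻¹, mul_assoc, one_div, Finset.mul_sum]
  congr 1
  refine Finset.sum_congr rfl fun σ _ => ?_
  rw [integral_finsetSum _ fun π _ => hI σ π, Finset.mul_sum]
  refine Finset.sum_congr rfl fun π _ => ?_
  rw [integral_const_mul, integral_fintype_prod_eq_prod (fun (j : Fin N) (x : ℝ) => φ j x *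
      Complex.exp (-((((π j : ℕ) : ℤ) - ((σ j : ℕ) : ℤ) : ℤ) * x * Complex.I)))]
  simp_rw [integral_Ico_eq_uniformAngle]
  rw [Finset.prod_mul_distrib]
  simp only [Finset.prod_const, Finset.card_univ, Fintype.card_fin, angleCoeff]
  have : ((2 * Real.pi : ℝ) : ℂ) ^ N ≠ 0 := pow_ne_zero _ (by exact_mod_cast hpi)
  rw [mul_left_comm, inv_mul_cancel_left₀ this]

/-- **Heine's identity**: the expectation of a multiplicative statistic of the circular unitary
ensemble is a Toeplitz determinant. -/
theorem integral_prod_eq_det_toeplitz (N : ℕ) (φ : ℝ → ℂ) (hφ : Integrable φ uniformAngle) :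
    ∫ θ, ∏ j, φ (θ j) ∂(circularUnitaryEnsemble N) = (toeplitz N φ).det := by
  rw [integral_prod_circularUnitaryEnsemble N (fun _ => φ) fun _ => hφ]
  have h : ∀ σ : Equiv.Perm (Fin N), ∑ π : Equiv.Perm (Fin N),
        ((Equiv.Perm.sign σ : ℤ) : ℂ) * ((Equiv.Perm.sign π : ℤ) : ℂ) *
        ∏ j, angleCoeff φ (((π j : ℕ) : ℤ) - ((σ j : ℕ) : ℤ)) = (toeplitz N φ).det := by
    intro σ
    rw [Matrix.det_apply']
    -- Substituting `π = ρσ` makes the inner sum independent of `σ`: one determinant for each of the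
    -- `N!` permutations, which cancels the prefactor.
    refine Fintype.sum_equiv (Equiv.mulRight σ⁻¹) _ _ fun π => ?_
    simp only [Equiv.coe_mulRight, Equiv.Perm.sign_mul, Equiv.Perm.sign_inv, toeplitz,
      Matrix.of_apply, Equiv.Perm.coe_mul, Function.comp_apply]
    congr 1
    · push_cast; ring
    · refine Fintype.prod_equiv σ _ _ fun j => ?_
      simp
  simp_rw [h]
  rw [Finset.sum_const, Finset.card_univ, Fintype.card_perm, Fintype.card_fin, nsmul_eq_mul,
    ← mul_assoc, one_div, inv_mul_cancel₀ (by exact_mod_cast Nat.factorial_ne_zero N), one_mul]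

lemma angleCoeff_one (m : ℤ) : angleCoeff (fun _ => 1) m = if m = 0 then 1 else 0 := by
  have h2 : ((2 * Real.pi : ℝ) : ℂ) ≠ 0 := by exact_mod_cast Real.two_pi_pos.ne'
  split_ifs with hm
  · simp [angleCoeff, hm]
  · have h1 := integral_Ico_eq_uniformAngle fun x => (1 : ℂ) * Complex.exp (-(m * x * Complex.I))
    rw [integral_Ico_eq_integral_Ioc, ← intervalIntegral.integral_of_le Real.two_pi_pos.le] at h1
    have h3 : ∫ x : ℝ in (0 : ℝ)..(2 * Real.pi), (1 : ℂ) * Complex.exp (-(m * x * Complex.I)) = 0 := by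
      have h4 : (-(m * Complex.I) : ℂ) ≠ 0 :=
        neg_ne_zero.2 (mul_ne_zero (by exact_mod_cast hm) Complex.I_ne_zero)
      have := integral_exp_mul_complex (a := 0) (b := 2 * Real.pi) h4
      simp_rw [one_mul]
      rw [show (fun x : ℝ => Complex.exp (-(m * x * Complex.I))) =
        fun x : ℝ => Complex.exp (-(m * Complex.I) * x) by ext x; congr 1; ring, this]
      have h5 : Complex.exp (-(m * Complex.I) * ((2 * Real.pi : ℝ) : ℂ)) = 1 := by
        rw [Complex.exp_eq_one_iff]
        exact ⟨-m, by push_cast; ring⟩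
      rw [h5]; simp
    rw [h3] at h1
    exact (mul_eq_zero.1 h1.symm).resolve_left h2

/-- Every angle of the circular unitary ensemble is uniformly distributed. -/
lemma integral_eval_circularUnitaryEnsemble (N : ℕ) (i : Fin N) (φ : ℝ → ℂ)
    (hφ : Integrable φ uniformAngle) :
    ∫ θ, φ (θ i) ∂(circularUnitaryEnsemble N) = ∫ x, φ x ∂uniformAngle := by
  have h := integral_prod_circularUnitaryEnsemble N (fun j => if j = i then φ else fun _ => 1)
    fun j => by split_ifs <;> [exact hφ; exact integrable_const _]
  have h1 : ∀ θ : Fin N → ℝ, ∏ j, (if j = i then φ else fun _ => 1) (θ j) = φ (θ i) := by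
    intro θ
    rw [Finset.prod_eq_single i] <;> simp +contextual
  simp_rw [h1] at h
  rw [h]
  have h2 : ∀ σ : Equiv.Perm (Fin N), ∑ π : Equiv.Perm (Fin N),
        ((Equiv.Perm.sign σ : ℤ) : ℂ) * ((Equiv.Perm.sign π : ℤ) : ℂ) *
        ∏ j, angleCoeff (if j = i then φ else fun _ => 1) (((π j : ℕ) : ℤ) - ((σ j : ℕ) : ℤ)) =
        ∫ x, φ x ∂uniformAngle := by
    intro σ
    -- At each index `j ≠ i` the symbol is `1`, which forces `π j = σ j`; permutations that agree
    -- off one point are equal.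
    rw [Finset.sum_eq_single σ]
    · rw [← Int.cast_mul, ← Units.val_mul, Int.units_mul_self]
      rw [Finset.prod_eq_single i]
      · simp [angleCoeff]
      · intro j _ hj
        simp [hj, angleCoeff_one]
      · simp
    · intro π _ hπ
      have : ∃ j, j ≠ i ∧ π j ≠ σ j := by
        by_contra! hcon
        apply hπ
        have hσ : ∀ j, j ≠ i → (σ⁻¹ * π) j = j := fun j hj => by
          simp [hcon j hj]
        have hi : (σ⁻¹ * π) i = i := by
          by_contra hne
          exact hne ((σ⁻¹ * π).injective (hσ _ hne))
        have : σ⁻¹ * π = 1 := by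
          ext j
          by_cases hj : j = i
          · rw [hj, hi]; rfl
          · rw [hσ j hj]; rfl
        exact (inv_mul_eq_one.1 this).symm
      obtain ⟨j, hj, hne⟩ := this
      rw [Finset.prod_eq_zero (Finset.mem_univ j), mul_zero]
      rw [if_neg hj, angleCoeff_one, if_neg]
      intro h'
      exact hne (Fin.ext (by exact_mod_cast sub_eq_zero.1 h'))
    · exact fun h' => absurd (Finset.mem_univ _) h'
  simp_rw [h2]
  rw [Finset.sum_const, Finset.card_univ, Fintype.card_perm, Fintype.card_fin, nsmul_eq_mul,
    ← mul_assoc, one_div, inv_mul_cancel₀ (by exact_mod_cast Nat.factorial_ne_zero N), one_mul]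

/-! ### Determinants of small perturbations of the identity. -/

section MatrixDeterminant

open Matrix
open scoped Matrix.Norms.L2Operator

variable {n : Type*} [Fintype n]

/-- The squared Frobenius norm. -/
noncomputable def frobeniusSq (A : Matrix n n ℂ) : ℝ := ∑ i, ∑ j, ‖A i j‖ ^ 2

lemma frobeniusSq_nonneg (A : Matrix n n ℂ) : 0 ≤ frobeniusSq A :=
  Finset.sum_nonneg fun _ _ => Finset.sum_nonneg fun _ _ => by positivity

lemma norm_trace_mul_le (A B : Matrix n n ℂ) :
    ‖(A * B).trace‖ ≤ √(frobeniusSq A) * √(frobeniusSq B) := by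
  have h1 : (A * B).trace = ∑ p : n × n, A p.1 p.2 * B p.2 p.1 := by
    rw [Fintype.sum_prod_type]
    simp [Matrix.trace, Matrix.mul_apply]
  have hA : frobeniusSq A = ∑ p : n × n, ‖A p.1 p.2‖ ^ 2 := by
    rw [Fintype.sum_prod_type]; rfl
  have hB : frobeniusSq B = ∑ p : n × n, ‖B p.2 p.1‖ ^ 2 := by
    rw [Fintype.sum_prod_type_right]; rfl
  rw [h1, hA, hB]
  refine (norm_sum_le _ _).trans ?_
  simp_rw [norm_mul]
  exact Real.sum_mul_le_sqrt_mul_sqrt _ _ _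

variable [DecidableEq n]

/-- The Frobenius norm is the `ℓ²` sum of the column norms, and `A` acts on each column of `B` with
operator norm at most `‖A‖`. -/
lemma frobeniusSq_mul_le (A B : Matrix n n ℂ) :
    frobeniusSq (A * B) ≤ ‖A‖ ^ 2 * frobeniusSq B := by
  have h : ∀ M : Matrix n n ℂ, frobeniusSq M =
      ∑ j, ‖(WithLp.toLp 2 fun i => M i j : EuclideanSpace ℂ n)‖ ^ 2 := by
    intro M
    simp_rw [EuclideanSpace.norm_sq_eq]
    exact Finset.sum_comm
  rw [h, h, Finset.mul_sum]
  refine Finset.sum_le_sum fun j _ => ?_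
  rw [← mul_pow]
  refine pow_le_pow_left₀ (norm_nonneg _) ?_ 2
  exact Matrix.l2_opNorm_mulVec A (WithLp.toLp 2 fun i => B i j)

/-- Test the form with `u = A v`, then cancel one factor `‖A v‖`. -/
lemma l2_opNorm_le_of_inner (A : Matrix n n ℂ) {a : ℝ} (ha : 0 ≤ a)
    (h : ∀ u v : n → ℂ, ‖star u ⬝ᵥ (A *ᵥ v)‖ ≤
      a * √(∑ i, ‖u i‖ ^ 2) * √(∑ i, ‖v i‖ ^ 2)) : ‖A‖ ≤ a := by
  rw [Matrix.l2_opNorm_def]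
  refine ContinuousLinearMap.opNorm_le_bound _ ha fun v => ?_
  set w : EuclideanSpace ℂ n := (toEuclideanLin (𝕜 := ℂ) (m := n) (n := n) A) v with hw
  change ‖w‖ ≤ a * ‖v‖
  have h1 := h w.ofLp v.ofLp
  rw [← EuclideanSpace.norm_eq, ← EuclideanSpace.norm_eq] at h1
  have h2 : star w.ofLp ⬝ᵥ (A *ᵥ v.ofLp) = ((‖w‖ ^ 2 : ℝ) : ℂ) := by
    have h3 : A *ᵥ v.ofLp = w.ofLp := rfl
    rw [h3, EuclideanSpace.norm_sq_eq, dotProduct]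
    push_cast
    refine Finset.sum_congr rfl fun i _ => ?_
    rw [Pi.star_apply, RCLike.star_def, Complex.conj_mul']
  rw [h2, Complex.norm_real, Real.norm_of_nonneg (by positivity)] at h1
  by_cases h0 : ‖w‖ = 0
  · rw [h0]; positivity
  · have : 0 < ‖w‖ := lt_of_le_of_ne (norm_nonneg _) (Ne.symm h0)
    nlinarith

/-- Jacobi's formula. Factoring out `1 + zE` moves the base point to the identity, where `det(1 +
xR) = 1 + x tr R + x² q(x)` with a polynomial `q`. -/
lemma hasDerivAt_det_one_add_smul (E : Matrix n n ℂ) (z : ℝ) (hz : IsUnit (1 + (z : ℂ) • E)) :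
    HasDerivAt (fun x : ℝ => (1 + (x : ℂ) • E).det)
      ((1 + (z : ℂ) • E).det * ((1 + (z : ℂ) • E)⁻¹ * E).trace) z := by
  set A := 1 + (z : ℂ) • E with hA
  set R := A⁻¹ * E with hR
  have hdet : IsUnit A.det := (Matrix.isUnit_iff_isUnit_det A).1 hz
  have h1 : ∀ x : ℝ, (1 + (x : ℂ) • E).det = A.det * (1 + ((x - z : ℝ) : ℂ) • R).det := by
    intro x
    rw [← Matrix.det_mul, mul_add, mul_one, Matrix.mul_smul, hR, ← mul_assoc,
      Matrix.mul_nonsing_inv A hdet, one_mul, hA]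
    congr 1
    rw [add_assoc, ← add_smul]
    congr 2
    push_cast; ring
  simp_rw [h1]
  refine HasDerivAt.const_mul _ ?_
  set q : Polynomial ℂ := (1 + (Polynomial.X : Polynomial ℂ) • R.map Polynomial.C).det.divX.divX
  have h2 : ∀ x : ℝ, (1 + ((x - z : ℝ) : ℂ) • R).det =
      1 + R.trace * ((x - z : ℝ) : ℂ) + q.eval (((x - z : ℝ) : ℂ)) * (((x - z : ℝ) : ℂ)) ^ 2 :=
    fun x => Matrix.det_one_add_smul _ _
  simp_rw [h2]
  have h3 : HasDerivAt (fun x : ℝ => ((x - z : ℝ) : ℂ)) 1 z := by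
    have := ((hasDerivAt_id z).sub_const z).ofReal_comp
    simpa using this
  have h4 : HasDerivAt (fun x : ℝ => q.eval (((x - z : ℝ) : ℂ))) (q.derivative.eval 0 * 1) z := by
    have := (q.hasDerivAt (((z - z : ℝ) : ℂ))).comp z h3
    rw [sub_self, Complex.ofReal_zero] at this
    exact this
  have := ((h3.const_mul R.trace).const_add 1).add (h4.mul (h3.pow 2))
  convert! this using 1
  simp

/-- The determinant of a perturbation of the identity which is small in operator norm is governed
by the first two traces. -/
theorem norm_det_one_add_mul_exp_sub_one_le (E : Matrix n n ℂ) {a : ℝ} (ha : ‖E‖ ≤ a)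
    (ha' : a ≤ 1 / 2) :
    ‖(1 + E).det * Complex.exp (-E.trace + (E * E).trace / 2) - 1‖ ≤
      Real.exp (2 * a * frobeniusSq E) - 1 := by
  have ha0 : 0 ≤ a := (norm_nonneg _).trans ha
  set c := 2 * a * frobeniusSq E with hc
  have hc0 : 0 ≤ c := mul_nonneg (by positivity) (frobeniusSq_nonneg E)
  have hunit : ∀ z : ℝ, z ∈ Set.Icc (0 : ℝ) 1 → IsUnit (1 + (z : ℂ) • E) := by
    intro z hz
    have h1 : ‖-((z : ℂ) • E)‖ < 1 := by
      rw [norm_neg, norm_smul, Complex.norm_real, Real.norm_of_nonneg hz.1]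
      nlinarith [hz.2, hz.1, norm_nonneg E]
    simpa using isUnit_one_sub_of_norm_lt_one h1
  -- Interpolate along `zE`, with the first two terms of the logarithm removed. Then `G' = G r`,
  -- where `r` is the third-order remainder of the resolvent trace.
  set G : ℝ → ℂ := fun z => (1 + (z : ℂ) • E).det *
    Complex.exp (-(z * E.trace) + z ^ 2 * (E * E).trace / 2) with hG
  set r : ℝ → ℂ := fun z => ((1 + (z : ℂ) • E)⁻¹ * E).trace - E.trace + z * (E * E).trace with hr
  have hderiv : ∀ z ∈ Set.Icc (0 : ℝ) 1, HasDerivAt G (G z * r z) z := by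
    intro z hz
    have h1 := hasDerivAt_det_one_add_smul E z (hunit z hz)
    have h0 : HasDerivAt (fun x : ℝ => (x : ℂ)) 1 z := by
      simpa using (hasDerivAt_id z).ofReal_comp
    have h2 : HasDerivAt (fun x : ℝ => Complex.exp (-((x : ℂ) * E.trace) +
        (x : ℂ) ^ 2 * (E * E).trace / 2)) _ z :=
      HasDerivAt.cexp (((h0.mul_const E.trace).neg).add
        (((h0.pow 2).mul_const (E * E).trace).div_const 2))
    have h3 := h1.mul h2
    convert! h3 using 1
    simp only [hG, hr]
    push_cast
    ring
  have hrbound : ∀ z ∈ Set.Icc (0 : ℝ) 1, ‖r z‖ ≤ c := by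
    intro z hz
    set A := 1 + (z : ℂ) • E with hA
    have hdet : IsUnit A.det := (Matrix.isUnit_iff_isUnit_det A).1 (hunit z hz)
    set R := A⁻¹ * E with hR
    have hcomm : A * E = E * A := by
      rw [hA]; simp [add_mul, mul_add]
    -- The resolvent identity: applied once it gives `‖R‖ ≤ 2a` (this needs `a ≤ 1/2`); applied
    -- twice it gives `r = z² tr(E R E)`.
    have hR1 : R = E - (z : ℂ) • (E * R) := by
      have : A * R = E := by rw [hR, ← mul_assoc, Matrix.mul_nonsing_inv A hdet, one_mul]
      rw [hA, add_mul, one_mul, Matrix.smul_mul] at this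
      exact eq_sub_of_add_eq this
    have hRE : E * R = R * E := by
      have h1 : A⁻¹ * E = E * A⁻¹ := by
        calc A⁻¹ * E = A⁻¹ * E * (A * A⁻¹) := by rw [Matrix.mul_nonsing_inv A hdet, mul_one]
          _ = A⁻¹ * (E * A) * A⁻¹ := by simp only [mul_assoc]
          _ = (A⁻¹ * A) * E * A⁻¹ := by rw [← hcomm]; simp only [mul_assoc]
          _ = E * A⁻¹ := by rw [Matrix.nonsing_inv_mul A hdet, one_mul]
      rw [hR, h1, mul_assoc, ← h1]
    have hRn : ‖R‖ ≤ 2 * a := by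
      have h1 : ‖R‖ ≤ ‖E‖ + 1 * (‖E‖ * ‖R‖) := by
        calc ‖R‖ = ‖E - (z : ℂ) • (E * R)‖ := congrArg _ hR1
          _ ≤ ‖E‖ + ‖(z : ℂ) • (E * R)‖ := norm_sub_le _ _
          _ ≤ _ := by
            rw [norm_smul, Complex.norm_real, Real.norm_of_nonneg hz.1]
            gcongr
            · exact hz.2
            · exact norm_mul_le _ _
      nlinarith [norm_nonneg R, norm_nonneg E]
    have h2 : r z = (z : ℂ) ^ 2 * (E * (R * E)).trace := by
      have h3 : R.trace = E.trace - z * (E * R).trace := by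
        conv_lhs => rw [hR1]
        rw [trace_sub, trace_smul, smul_eq_mul]
      have h4 : (E * R).trace = (E * E).trace - z * (E * (R * E)).trace := by
        conv_lhs => rw [hR1]
        rw [mul_sub, trace_sub, Matrix.mul_smul, trace_smul, smul_eq_mul, hRE]
      simp only [hr]
      rw [h3, h4]
      ring
    rw [h2, norm_mul, norm_pow, Complex.norm_real, Real.norm_of_nonneg hz.1]
    have h5 := norm_trace_mul_le E (R * E)
    have h6 : √(frobeniusSq (R * E)) ≤ ‖R‖ * √(frobeniusSq E) := by
      rw [← Real.sqrt_sq (norm_nonneg R), ← Real.sqrt_mul (by positivity)]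
      exact Real.sqrt_le_sqrt (frobeniusSq_mul_le R E)
    have h7 : √(frobeniusSq E) * √(frobeniusSq E) = frobeniusSq E :=
      Real.mul_self_sqrt (frobeniusSq_nonneg E)
    have h8 : z ^ 2 ≤ 1 := pow_le_one₀ hz.1 hz.2
    calc z ^ 2 * ‖(E * (R * E)).trace‖ ≤ 1 * (√(frobeniusSq E) * (‖R‖ * √(frobeniusSq E))) := by
          gcongr
          exact h5.trans (by gcongr)
      _ = ‖R‖ * frobeniusSq E := by rw [one_mul, mul_left_comm, h7]
      _ ≤ _ := by
        rw [hc]; exact mul_le_mul_of_nonneg_right hRn (frobeniusSq_nonneg E)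
  -- Grönwall for `G - 1`, which starts at `0` and satisfies `‖G'‖ ≤ c ‖G - 1‖ + c`; at time `1` the
  -- bound is `e^c - 1`.
  have hgron := norm_le_gronwallBound_of_norm_deriv_right_le (f := fun z => G z - 1)
    (f' := fun z => G z * r z) (δ := 0) (K := c) (ε := c) (a := 0) (b := 1)
    (fun z hz => ((hderiv z hz).continuousAt.sub continuousAt_const).continuousWithinAt)
    (fun z hz => ((hderiv z ⟨hz.1, hz.2.le⟩).sub_const 1).hasDerivWithinAt)
    (by simp [hG])
    (fun z hz => by
      rw [norm_mul]
      have h1 := hrbound z ⟨hz.1, hz.2.le⟩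
      have h2 : ‖G z‖ ≤ ‖G z - 1‖ + 1 := by
        calc ‖G z‖ = ‖(G z - 1) + 1‖ := by rw [sub_add_cancel]
          _ ≤ _ := (norm_add_le _ _).trans (by simp)
      calc ‖G z‖ * ‖r z‖ ≤ (‖G z - 1‖ + 1) * c := by gcongr
        _ = _ := by ring) 1 ⟨zero_le_one, le_rfl⟩
  have hG1 : G 1 = (1 + E).det * Complex.exp (-E.trace + (E * E).trace / 2) := by
    simp [hG]
  rw [← hG1]
  refine hgron.trans ?_
  by_cases h0 : c = 0
  · rw [h0, gronwallBound_K0]; simp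
  · rw [gronwallBound_of_K_ne_0 h0, div_self h0]; simp

end MatrixDeterminant

instance isProbabilityMeasure_circularUnitaryEnsemble (N : ℕ) :
    IsProbabilityMeasure (circularUnitaryEnsemble N) := by
  have h := integral_prod_eq_det_toeplitz N (fun _ => 1) (integrable_const _)
  have h1 : toeplitz N (fun _ => 1) = 1 := by
    ext i j
    rw [toeplitz, Matrix.of_apply, angleCoeff_one, Matrix.one_apply]
    congr 1
    rw [sub_eq_zero, Fin.ext_iff, Nat.cast_inj]
  rw [h1] at h
  simp only [Finset.prod_const_one, integral_const, Matrix.det_one, Complex.real_smul, mul_one,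
    Measure.real] at h
  constructor
  have h2 : (circularUnitaryEnsemble N Set.univ).toReal = 1 := by exact_mod_cast h
  rwa [ENNReal.toReal_eq_one_iff] at h2

/-! ### Bounded measurable functions. -/

/-- A function that is measurable and bounded. -/
def BoundedMeasurable {α E : Type*} [MeasurableSpace α] [NormedAddCommGroup E] [MeasurableSpace E]
    (φ : α → E) : Prop :=
  Measurable φ ∧ ∃ C, ∀ x, ‖φ x‖ ≤ C

section BoundedMeasurable

variable {α : Type*} [MeasurableSpace α]

lemma BoundedMeasurable.integrable {E : Type*} [NormedAddCommGroup E] [MeasurableSpace E]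
    [BorelSpace E] [SecondCountableTopology E]
    {φ : α → E} (h : BoundedMeasurable φ) {μ : Measure α} [IsFiniteMeasure μ] :
    Integrable φ μ := by
  obtain ⟨C, hC⟩ := h.2
  exact Integrable.of_bound h.1.aestronglyMeasurable C (.of_forall hC)

lemma BoundedMeasurable.mul {R : Type*} [NormedRing R] [MeasurableSpace R] [MeasurableMul₂ R]
    {φ ψ : α → R} (h : BoundedMeasurable φ)
    (h' : BoundedMeasurable ψ) : BoundedMeasurable fun x => φ x * ψ x := by
  obtain ⟨C, hC⟩ := h.2
  obtain ⟨C', hC'⟩ := h'.2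
  refine ⟨h.1.mul h'.1, C * C', fun x => (norm_mul_le _ _).trans ?_⟩
  exact mul_le_mul (hC x) (hC' x) (norm_nonneg _) ((norm_nonneg _).trans (hC x))

lemma BoundedMeasurable.add {E : Type*} [NormedAddCommGroup E] [MeasurableSpace E]
    [MeasurableAdd₂ E] {φ ψ : α → E} (h : BoundedMeasurable φ)
    (h' : BoundedMeasurable ψ) : BoundedMeasurable fun x => φ x + ψ x := by
  obtain ⟨C, hC⟩ := h.2
  obtain ⟨C', hC'⟩ := h'.2
  exact ⟨h.1.add h'.1, C + C', fun x => (norm_add_le _ _).trans (add_le_add (hC x) (hC' x))⟩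

lemma BoundedMeasurable.sub {E : Type*} [NormedAddCommGroup E] [MeasurableSpace E]
    [MeasurableSub₂ E] {φ ψ : α → E} (h : BoundedMeasurable φ)
    (h' : BoundedMeasurable ψ) : BoundedMeasurable fun x => φ x - ψ x := by
  obtain ⟨C, hC⟩ := h.2
  obtain ⟨C', hC'⟩ := h'.2
  exact ⟨h.1.sub h'.1, C + C', fun x => (norm_sub_le _ _).trans (add_le_add (hC x) (hC' x))⟩

lemma boundedMeasurable_const {E : Type*} [NormedAddCommGroup E] [MeasurableSpace E] (c : E) :
    BoundedMeasurable fun _ : α => c :=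
  ⟨measurable_const, ‖c‖, fun _ => le_rfl⟩

lemma BoundedMeasurable.norm {E : Type*} [NormedAddCommGroup E] [MeasurableSpace E] [BorelSpace E]
    {φ : α → E} (h : BoundedMeasurable φ) : BoundedMeasurable fun x => ‖φ x‖ := by
  obtain ⟨C, hC⟩ := h.2
  exact ⟨h.1.norm, C, fun x => by simpa using hC x⟩

lemma BoundedMeasurable.pow {R : Type*} [NormedRing R] [MeasurableSpace R] [MeasurableMul₂ R]
    {φ : α → R} (h : BoundedMeasurable φ) (n : ℕ) :
    BoundedMeasurable fun x => φ x ^ n := by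
  induction n with
  | zero => simpa using boundedMeasurable_const (1 : R)
  | succ k ih => simpa [pow_succ] using ih.mul h

lemma BoundedMeasurable.ofReal {φ : α → ℝ} (h : BoundedMeasurable φ) :
    BoundedMeasurable fun x => (φ x : ℂ) := by
  obtain ⟨C, hC⟩ := h.2
  exact ⟨Complex.measurable_ofReal.comp h.1, C, fun x => by simpa using hC x⟩

lemma BoundedMeasurable.finsetSum {ι E : Type*} [NormedAddCommGroup E] [MeasurableSpace E]
    [MeasurableAdd₂ E] (s : Finset ι) {φ : ι → α → E} (h : ∀ i, BoundedMeasurable (φ i)) :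
    BoundedMeasurable fun x => ∑ i ∈ s, φ i x := by
  choose C hC using fun i => (h i).2
  exact ⟨Finset.measurable_fun_sum s fun i _ => (h i).1, ∑ i ∈ s, C i, fun x =>
    (norm_sum_le _ _).trans (Finset.sum_le_sum fun i _ => hC i x)⟩

lemma BoundedMeasurable.cexp_I_mul {φ : α → ℝ} (h : Measurable φ) :
    BoundedMeasurable fun x => Complex.exp (Complex.I * φ x) :=
  ⟨by fun_prop, 1, fun x => by rw [Complex.norm_exp_I_mul_ofReal]⟩

/-- The Cauchy–Schwarz inequality for bounded functions. -/
lemma BoundedMeasurable.integral_mul_sq_le {μ : Measure α} [IsFiniteMeasure μ] {f g : α → ℝ}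
    (hf : BoundedMeasurable f) (hg : BoundedMeasurable g) :
    (∫ x, f x * g x ∂μ) ^ 2 ≤ (∫ x, f x ^ 2 ∂μ) * ∫ x, g x ^ 2 ∂μ := by
  -- The quadratic `t ↦ ∫ (f + t g)²` is nonnegative, so its discriminant is not positive.
  have h : ∀ t : ℝ, 0 ≤ (∫ x, g x ^ 2 ∂μ) * (t * t) + (2 * ∫ x, f x * g x ∂μ) * t +
      ∫ x, f x ^ 2 ∂μ := by
    intro t
    have h1 : (∫ x, g x ^ 2 ∂μ) * (t * t) + (2 * ∫ x, f x * g x ∂μ) * t + ∫ x, f x ^ 2 ∂μ =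
        ∫ x, (f x + t * g x) ^ 2 ∂μ := by
      rw [← integral_mul_const, ← integral_const_mul, ← integral_mul_const, ← integral_add,
        ← integral_add]
      · congr 1; ext x; ring
      · exact (((hg.pow 2).integrable).mul_const _).add
          ((((hf.mul hg).integrable).const_mul _).mul_const _)
      · exact (hf.pow 2).integrable
      · exact ((hg.pow 2).integrable).mul_const _
      · exact (((hf.mul hg).integrable).const_mul _).mul_const _
    rw [h1]
    exact integral_nonneg fun x => sq_nonneg _
  have := discrim_le_zero h
  rw [discrim] at this
  nlinarith

end BoundedMeasurable

/-! ### Fourier coefficients on the circle and Toeplitz matrices. -/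

lemma norm_exp_int_mul_I (m : ℤ) (x : ℝ) : ‖Complex.exp (m * x * Complex.I)‖ = 1 := by
  rw [show (m * x * Complex.I : ℂ) = ((m * x : ℝ) : ℂ) * Complex.I by push_cast; ring,
    Complex.norm_exp_ofReal_mul_I]

lemma norm_exp_neg_int_mul_I (m : ℤ) (x : ℝ) : ‖Complex.exp (-(m * x * Complex.I))‖ = 1 := by
  rw [show (-(m * x * Complex.I) : ℂ) = ((-(m * x) : ℝ) : ℂ) * Complex.I by push_cast; ring,
    Complex.norm_exp_ofReal_mul_I]

lemma boundedMeasurable_exp_neg (m : ℤ) :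
    BoundedMeasurable fun x : ℝ => Complex.exp (-(m * x * Complex.I)) :=
  ⟨by fun_prop, 1, fun x => (norm_exp_neg_int_mul_I m x).le⟩

lemma angleCoeff_add {φ ψ : ℝ → ℂ} (hφ : BoundedMeasurable φ) (hψ : BoundedMeasurable ψ) (m : ℤ) :
    angleCoeff (fun x => φ x + ψ x) m = angleCoeff φ m + angleCoeff ψ m := by
  simp only [angleCoeff, add_mul]
  exact integral_add (hφ.mul (boundedMeasurable_exp_neg m)).integrable
    (hψ.mul (boundedMeasurable_exp_neg m)).integrable

lemma angleCoeff_const_mul (c : ℂ) (φ : ℝ → ℂ) (m : ℤ) :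
    angleCoeff (fun x => c * φ x) m = c * angleCoeff φ m := by
  simp only [angleCoeff, mul_assoc, integral_const_mul]

lemma angleCoeff_zero (φ : ℝ → ℂ) : angleCoeff φ 0 = ∫ x, φ x ∂uniformAngle := by
  simp [angleCoeff]

lemma angleCoeff_neg_of_real (g : ℝ → ℝ) (m : ℤ) :
    angleCoeff (fun x => (g x : ℂ)) (-m) = (starRingEnd ℂ) (angleCoeff (fun x => (g x : ℂ)) m) := by
  rw [angleCoeff, angleCoeff, ← integral_conj]
  congr 1; ext x
  rw [map_mul, Complex.conj_ofReal, ← Complex.exp_conj]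
  simp

lemma integral_exp_uniformAngle (m : ℤ) :
    ∫ x : ℝ, Complex.exp (m * x * Complex.I) ∂uniformAngle = if m = 0 then 1 else 0 := by
  have h := angleCoeff_one (-m)
  simp only [neg_eq_zero] at h
  rw [← h, angleCoeff]
  congr 1; ext x; simp

/-- **Parseval's identity** on the circle. -/
lemma hasSum_sq_angleCoeff {φ : ℝ → ℂ} (hφ : BoundedMeasurable φ) :
    HasSum (fun m : ℤ => ‖angleCoeff φ m‖ ^ 2) (∫ x, ‖φ x‖ ^ 2 ∂uniformAngle) := by
  have h2 : (0 : ℝ) < 2 * Real.pi := Real.two_pi_pos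
  obtain ⟨C, hC⟩ := hφ.2
  have hL2 : MemLp φ 2 (volume.restrict (Set.Ioc 0 (2 * Real.pi))) :=
    MemLp.of_bound hφ.1.aestronglyMeasurable C (.of_forall hC)
  have h := hasSum_sq_fourierCoeffOn h2 hL2
  have hc : ∀ ψ : ℝ → ℂ, ∫ x, ψ x ∂uniformAngle =
      (1 / (2 * Real.pi)) • ∫ x in (0 : ℝ)..(2 * Real.pi), ψ x := by
    intro ψ
    rw [uniformAngle, integral_smul_measure, ENNReal.toReal_ofReal (by positivity),
      intervalIntegral.integral_of_le h2.le, integral_Ico_eq_integral_Ioc]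
  have hr : ∀ ψ : ℝ → ℝ, ∫ x, ψ x ∂uniformAngle =
      (1 / (2 * Real.pi)) • ∫ x in (0 : ℝ)..(2 * Real.pi), ψ x := by
    intro ψ
    rw [uniformAngle, integral_smul_measure, ENNReal.toReal_ofReal (by positivity),
      intervalIntegral.integral_of_le h2.le, integral_Ico_eq_integral_Ioc]
  convert! h using 1
  · ext m
    rw [fourierCoeffOn_eq_integral, angleCoeff, hc, sub_zero]
    congr 4
    ext x
    rw [fourier_coe_apply, smul_eq_mul, mul_comm]
    congr 2
    have : (Real.pi : ℂ) ≠ 0 := by exact_mod_cast Real.pi_ne_zero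
    push_cast
    field_simp
  · rw [hr, sub_zero, one_div]

lemma toeplitz_add (N : ℕ) {φ ψ : ℝ → ℂ} (hφ : BoundedMeasurable φ) (hψ : BoundedMeasurable ψ) :
    toeplitz N (fun x => φ x + ψ x) = toeplitz N φ + toeplitz N ψ := by
  ext i j
  simp [toeplitz, angleCoeff_add hφ hψ]

lemma toeplitz_const_mul (N : ℕ) (c : ℂ) (φ : ℝ → ℂ) :
    toeplitz N (fun x => c * φ x) = c • toeplitz N φ := by
  ext i j
  simp [toeplitz, angleCoeff_const_mul]

lemma toeplitz_one (N : ℕ) : toeplitz N (fun _ => 1) = 1 := by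
  ext i j
  rw [toeplitz, Matrix.of_apply, angleCoeff_one, Matrix.one_apply]
  congr 1
  rw [sub_eq_zero, Fin.ext_iff, Nat.cast_inj]

lemma trace_toeplitz (N : ℕ) (φ : ℝ → ℂ) :
    (toeplitz N φ).trace = N * ∫ x, φ x ∂uniformAngle := by
  simp [Matrix.trace, toeplitz, angleCoeff_zero]

/-- The entries of one row are Fourier coefficients at distinct frequencies, so Bessel's inequality
applies to each of the `N` rows. -/
lemma frobeniusSq_toeplitz_le (N : ℕ) {φ : ℝ → ℂ} (hφ : BoundedMeasurable φ) :
    frobeniusSq (toeplitz N φ) ≤ N * ∫ x, ‖φ x‖ ^ 2 ∂uniformAngle := by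
  have h : ∀ i : Fin N, ∑ j : Fin N, ‖toeplitz N φ i j‖ ^ 2 ≤ ∫ x, ‖φ x‖ ^ 2 ∂uniformAngle := by
    intro i
    have hinj : Function.Injective fun j : Fin N => ((i : ℕ) : ℤ) - ((j : ℕ) : ℤ) := by
      intro a b hab
      simp only [sub_right_inj, Nat.cast_inj] at hab
      exact Fin.ext hab
    have := sum_le_hasSum (Finset.univ.map ⟨_, hinj⟩) (fun m _ => by positivity)
      (hasSum_sq_angleCoeff hφ)
    rwa [Finset.sum_map] at this
  calc frobeniusSq (toeplitz N φ) ≤ ∑ _i : Fin N, ∫ x, ‖φ x‖ ^ 2 ∂uniformAngle :=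
        Finset.sum_le_sum fun i _ => h i
    _ = _ := by simp

/-! ### Toeplitz forms as integrals of trigonometric polynomials. -/

section Polynomials

variable {N : ℕ}

/-- The trigonometric polynomial with coefficients `u`. -/
noncomputable def trigPoly (u : Fin N → ℂ) (x : ℝ) : ℂ :=
  ∑ j : Fin N, u j * Complex.exp (((j : ℕ) : ℤ) * x * Complex.I)

lemma boundedMeasurable_trigPoly (u : Fin N → ℂ) : BoundedMeasurable (trigPoly u) := by
  refine BoundedMeasurable.finsetSum _ fun j => (boundedMeasurable_const (u j)).mul ?_
  exact ⟨by fun_prop, 1, fun x => (norm_exp_int_mul_I _ x).le⟩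

/-- A Toeplitz matrix is the compression of multiplication by its symbol to polynomials of degree
below `N`. Both the operator norm bound and positivity are read off from this. -/
lemma dotProduct_toeplitz_mulVec {φ : ℝ → ℂ} (hφ : BoundedMeasurable φ) (u v : Fin N → ℂ) :
    star u ⬝ᵥ Matrix.mulVec (toeplitz N φ) v =
      ∫ x, φ x * ((starRingEnd ℂ) (trigPoly u x) * trigPoly v x) ∂uniformAngle := by
  have h1 : ∀ x : ℝ, φ x * ((starRingEnd ℂ) (trigPoly u x) * trigPoly v x) =
      ∑ j : Fin N, ∑ k : Fin N, (starRingEnd ℂ) (u j) * v k *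
        (φ x * Complex.exp (-(((((j : ℕ) : ℤ) - ((k : ℕ) : ℤ) : ℤ)) * x * Complex.I))) := by
    intro x
    rw [trigPoly, trigPoly, map_sum, Finset.sum_mul_sum, Finset.mul_sum]
    refine Finset.sum_congr rfl fun j _ => ?_
    rw [Finset.mul_sum]
    refine Finset.sum_congr rfl fun k _ => ?_
    rw [map_mul, ← Complex.exp_conj]
    have : Complex.exp (-(((((j : ℕ) : ℤ) - ((k : ℕ) : ℤ) : ℤ)) * x * Complex.I)) =
        Complex.exp ((starRingEnd ℂ) (((j : ℕ) : ℤ) * x * Complex.I)) *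
          Complex.exp (((k : ℕ) : ℤ) * x * Complex.I) := by
      rw [← Complex.exp_add]
      congr 1
      simp
      ring
    rw [this]; ring
  have hI : ∀ j k : Fin N, Integrable (fun x : ℝ => (starRingEnd ℂ) (u j) * v k *
        (φ x * Complex.exp (-(((((j : ℕ) : ℤ) - ((k : ℕ) : ℤ) : ℤ)) * x * Complex.I))))
        uniformAngle :=
    fun j k => ((hφ.mul (boundedMeasurable_exp_neg _)).integrable).const_mul _
  simp_rw [h1]
  rw [integral_finsetSum _ fun j _ => integrable_finsetSum _ fun k _ => hI j k]
  simp only [dotProduct, Matrix.mulVec, Pi.star_apply, RCLike.star_def, Finset.mul_sum]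
  refine Finset.sum_congr rfl fun j _ => ?_
  rw [integral_finsetSum _ fun k _ => hI j k]
  refine Finset.sum_congr rfl fun k _ => ?_
  rw [integral_const_mul, toeplitz, Matrix.of_apply, angleCoeff]
  ring

lemma integral_norm_sq_trigPoly (u : Fin N → ℂ) :
    ∫ x, ‖trigPoly u x‖ ^ 2 ∂uniformAngle = ∑ i, ‖u i‖ ^ 2 := by
  have h := dotProduct_toeplitz_mulVec (boundedMeasurable_const 1) u u
  simp_rw [toeplitz_one, Matrix.one_mulVec, one_mul, Complex.conj_mul', dotProduct,
    Pi.star_apply, RCLike.star_def, Complex.conj_mul'] at h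
  norm_cast at h
  exact h.symm

lemma norm_sq_trigPoly_le (u : Fin N → ℂ) (x : ℝ) :
    ‖trigPoly u x‖ ^ 2 ≤ N * ∑ i, ‖u i‖ ^ 2 := by
  have h : ‖trigPoly u x‖ ≤ ∑ i : Fin N, 1 * ‖u i‖ := by
    refine (norm_sum_le _ _).trans (Finset.sum_le_sum fun j _ => ?_)
    rw [norm_mul, norm_exp_int_mul_I]; simp
  calc ‖trigPoly u x‖ ^ 2 ≤ (∑ i : Fin N, 1 * ‖u i‖) ^ 2 := by gcongr
    _ ≤ (∑ i : Fin N, (1 : ℝ) ^ 2) * ∑ i, ‖u i‖ ^ 2 := Finset.sum_mul_sq_le_sq_mul_sq _ _ _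
    _ = _ := by simp

open scoped Matrix.Norms.L2Operator in
/-- The operator norm of a Toeplitz matrix in terms of the fourth moment of its symbol. -/
lemma l2_opNorm_toeplitz_le {φ : ℝ → ℂ} (hφ : BoundedMeasurable φ) {a : ℝ} (ha : 0 ≤ a)
    (h : N * ∫ x, ‖φ x‖ ^ 4 ∂uniformAngle ≤ a ^ 4) : ‖toeplitz N φ‖ ≤ a := by
  refine l2_opNorm_le_of_inner _ ha fun u v => ?_
  set U := ∑ i, ‖u i‖ ^ 2 with hU
  set V := ∑ i, ‖v i‖ ^ 2 with hV
  have hU0 : 0 ≤ U := Finset.sum_nonneg fun _ _ => by positivity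
  have hV0 : 0 ≤ V := Finset.sum_nonneg fun _ _ => by positivity
  have bu := (boundedMeasurable_trigPoly u).norm
  have bv := (boundedMeasurable_trigPoly v).norm
  have bφ := hφ.norm
  -- Cauchy–Schwarz splits off one factor `|v|` (the polynomial) and leaves `∫ |φ|⁴ |v|²`. There
  -- `|v|²` is replaced by its sup bound `N V`, which accounts for the factor `N` in the hypothesis.
  have h1 : ∫ x, (‖φ x‖ * ‖trigPoly v x‖) ^ 2 ∂uniformAngle ≤ a ^ 2 * V := by
    have h2 := ((bφ.pow 2).mul bv).integral_mul_sq_le bv (μ := uniformAngle)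
    have h3 : ∫ x, (‖φ x‖ ^ 2 * ‖trigPoly v x‖) ^ 2 ∂uniformAngle ≤ a ^ 4 * V := by
      calc ∫ x, (‖φ x‖ ^ 2 * ‖trigPoly v x‖) ^ 2 ∂uniformAngle
          ≤ ∫ x, ‖φ x‖ ^ 4 * (N * V) ∂uniformAngle := by
            refine integral_mono ((((bφ.pow 2).mul bv).pow 2).integrable)
              ((bφ.pow 4).integrable.mul_const _) fun x => ?_
            rw [mul_pow, ← pow_mul]
            exact mul_le_mul_of_nonneg_left (norm_sq_trigPoly_le v x) (by positivity)
        _ = (N * ∫ x, ‖φ x‖ ^ 4 ∂uniformAngle) * V := by rw [integral_mul_const]; ring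
        _ ≤ _ := by gcongr
    rw [integral_norm_sq_trigPoly] at h2
    have h4 : ∫ x, (‖φ x‖ * ‖trigPoly v x‖) ^ 2 ∂uniformAngle =
        ∫ x, ‖φ x‖ ^ 2 * ‖trigPoly v x‖ * ‖trigPoly v x‖ ∂uniformAngle := by
      congr 1; ext x; ring
    rw [h4]
    refine abs_le_of_sq_le_sq' (h2.trans ?_) (by positivity) |>.2
    calc _ ≤ a ^ 4 * V * V := by gcongr
      _ = (a ^ 2 * V) ^ 2 := by ring
  have h5 : ‖star u ⬝ᵥ Matrix.mulVec (toeplitz N φ) v‖ ≤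
      ∫ x, ‖trigPoly u x‖ * (‖φ x‖ * ‖trigPoly v x‖) ∂uniformAngle := by
    rw [dotProduct_toeplitz_mulVec hφ]
    refine (norm_integral_le_integral_norm _).trans (le_of_eq ?_)
    congr 1; ext x
    rw [norm_mul, norm_mul, RCLike.norm_conj]; ring
  have h6 := bu.integral_mul_sq_le (bφ.mul bv) (μ := uniformAngle)
  rw [integral_norm_sq_trigPoly] at h6
  refine h5.trans (abs_le_of_sq_le_sq' (h6.trans ?_) (by positivity) |>.2)
  calc _ ≤ U * (a ^ 2 * V) := by gcongr
    _ = _ := by rw [mul_pow, mul_pow, Real.sq_sqrt hU0, Real.sq_sqrt hV0]; ring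

end Polynomials

/-! ### Taylor bounds for `e^{iy}` valid for all real `y`. -/

section ExponentialTaylor

lemma norm_exp_I_mul_sub_one_sub_le (y : ℝ) :
    ‖Complex.exp (Complex.I * y) - 1 - Complex.I * y‖ ≤ 3 * y ^ 2 := by
  have hn : ‖Complex.I * (y : ℂ)‖ = |y| := by simp
  rcases le_total (|y|) 1 with h | h
  · have := Complex.norm_exp_sub_one_sub_id_le (x := Complex.I * y) (by rw [hn]; exact h)
    rw [hn, sq_abs] at this
    nlinarith [sq_nonneg y]
  · have h1 : ‖Complex.exp (Complex.I * y) - 1 - Complex.I * y‖ ≤ |y| + |y| := by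
      refine (norm_sub_le _ _).trans (add_le_add ?_ hn.le)
      exact Real.norm_exp_I_mul_ofReal_sub_one_le
    rw [← sq_abs]
    nlinarith

/-- For `|y| ≤ 1` this is the exponential series; for `|y| ≥ 1` each term is bounded separately by a
power of `|y|` not exceeding the third. -/
lemma norm_exp_I_mul_sub_quadratic_le (y : ℝ) :
    ‖Complex.exp (Complex.I * y) - 1 - Complex.I * y + (y : ℂ) ^ 2 / 2‖ ≤ 4 * |y| ^ 3 := by
  have hn : ‖Complex.I * (y : ℂ)‖ = |y| := by simp
  rcases le_total (|y|) 1 with h | h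
  · have h1 := Complex.norm_exp_sub_sum_le_norm_mul_exp (Complex.I * y) 3
    simp only [Finset.sum_range_succ, Finset.range_zero, Finset.sum_empty, hn] at h1
    have h2 : Complex.exp (Complex.I * y) - (0 + (Complex.I * (y : ℂ)) ^ 0 / (Nat.factorial 0 : ℂ) +
        (Complex.I * (y : ℂ)) ^ 1 / (Nat.factorial 1 : ℂ) +
        (Complex.I * (y : ℂ)) ^ 2 / (Nat.factorial 2 : ℂ)) =
        Complex.exp (Complex.I * y) - 1 - Complex.I * y + (y : ℂ) ^ 2 / 2 := by
      simp [Nat.factorial, mul_pow]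
      ring
    rw [h2] at h1
    have h3 : Real.exp |y| ≤ 3 := by
      have := Real.exp_le_exp.2 h
      linarith [Real.exp_one_lt_d9]
    have h4 : 0 ≤ |y| ^ 3 := by positivity
    nlinarith
  · have h1 : ‖Complex.exp (Complex.I * y) - 1 - Complex.I * y + (y : ℂ) ^ 2 / 2‖ ≤
        |y| + |y| + |y| ^ 2 / 2 := by
      refine (norm_add_le _ _).trans (add_le_add ((norm_sub_le _ _).trans (add_le_add ?_ hn.le)) ?_)
      · exact Real.norm_exp_I_mul_ofReal_sub_one_le
      · simp
    have h2 : |y| ^ 2 ≤ |y| ^ 3 := pow_le_pow_right₀ h (by norm_num)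
    have h3 : |y| ≤ |y| ^ 3 := by simpa using pow_le_pow_right₀ h (show 1 ≤ 3 by norm_num)
    linarith

end ExponentialTaylor

/-! ### The CUE variance in Fourier space. -/

section ToeplitzVariance

/-- In Parseval's identity the zero mode vanishes and, `g` being real, the modes `±k` contribute
equally. -/
lemma hasSum_sq_angleCoeff_of_real {g : ℝ → ℝ} (hg : BoundedMeasurable g)
    (h0 : ∫ x, g x ∂uniformAngle = 0) :
    HasSum (fun k : ℕ => 2 * ‖angleCoeff (fun x => (g x : ℂ)) ((k : ℤ) + 1)‖ ^ 2)
      (∫ x, g x ^ 2 ∂uniformAngle) := by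
  have h := (hasSum_sq_angleCoeff hg.ofReal).nat_add_neg
  have hz : angleCoeff (fun x => (g x : ℂ)) 0 = 0 := by
    rw [angleCoeff_zero, integral_complex_ofReal, h0, Complex.ofReal_zero]
  rw [← hasSum_nat_add_iff' 1] at h
  simp only [hz, Finset.sum_range_one, Nat.cast_zero, norm_zero, ne_eq, OfNat.ofNat_ne_zero,
    not_false_eq_true, zero_pow, add_zero, sub_zero, Complex.norm_real, Real.norm_eq_abs,
    sq_abs, angleCoeff_neg_of_real, RCLike.norm_conj, Nat.cast_add, Nat.cast_one] at h
  simpa only [two_mul] using h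

/-- Each of the differences `±k` with `1 ≤ k ≤ N` is taken by `N - k` index pairs. -/
lemma sum_sum_sub_eq (N : ℕ) (h : ℤ → ℝ) (heven : ∀ m, h (-m) = h m) (h0 : h 0 = 0) :
    ∑ i : Fin N, ∑ j : Fin N, h ((i : ℤ) - (j : ℤ)) =
      ∑ k ∈ Finset.range N, 2 * h (k + 1) * (N - (k + 1)) := by
  have h1 : ∀ N : ℕ, ∑ i : Fin N, ∑ j : Fin N, h ((i : ℤ) - (j : ℤ)) =
      ∑ i ∈ Finset.range N, ∑ j ∈ Finset.range N, h ((i : ℤ) - (j : ℤ)) := by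
    intro N
    rw [Finset.sum_range]
    refine Finset.sum_congr rfl fun i _ => ?_
    rw [Finset.sum_range]
  rw [h1]
  induction N with
  | zero => simp
  | succ N ih =>
    have h2 : ∑ j ∈ Finset.range N, h ((N : ℤ) - (j : ℤ)) = ∑ k ∈ Finset.range N, h (k + 1) := by
      rw [← Finset.sum_range_reflect]
      refine Finset.sum_congr rfl fun j hj => ?_
      congr 1
      have := Finset.mem_range.1 hj
      omega
    have h3 : ∑ i ∈ Finset.range N, h ((i : ℤ) - (N : ℤ)) = ∑ k ∈ Finset.range N, h (k + 1) := by
      rw [← h2]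
      refine Finset.sum_congr rfl fun j _ => ?_
      rw [← heven, neg_sub]
    simp only [Finset.sum_range_succ, Finset.sum_add_distrib, ih, h2, h3, sub_self, h0]
    push_cast
    have h4 : ∑ k ∈ Finset.range N, 2 * h (k + 1) * ((N : ℝ) + 1 - (k + 1)) =
        ∑ k ∈ Finset.range N, 2 * h (k + 1) * ((N : ℝ) - (k + 1)) +
          2 * ∑ k ∈ Finset.range N, h (k + 1) := by
      rw [Finset.mul_sum, ← Finset.sum_add_distrib]
      exact Finset.sum_congr rfl fun k _ => by ring
    rw [h4]
    ring

lemma trace_toeplitz_sq_of_real (N : ℕ) (g : ℝ → ℝ) :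
    (toeplitz N (fun x => (g x : ℂ)) * toeplitz N (fun x => (g x : ℂ))).trace =
      ((∑ i : Fin N, ∑ j : Fin N,
        ‖angleCoeff (fun x => (g x : ℂ)) ((i : ℤ) - (j : ℤ))‖ ^ 2 : ℝ) : ℂ) := by
  rw [Matrix.trace]
  push_cast
  refine Finset.sum_congr rfl fun i _ => ?_
  rw [Matrix.diag_apply, Matrix.mul_apply]
  refine Finset.sum_congr rfl fun j _ => ?_
  rw [toeplitz, Matrix.of_apply, Matrix.of_apply, ← neg_sub (i : ℤ) (j : ℤ),
    angleCoeff_neg_of_real, Complex.mul_conj']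

/-- The variance of a linear statistic of the circular unitary ensemble in Fourier space. -/
lemma hasSum_variance_toeplitz (N : ℕ) {g : ℝ → ℝ} (hg : BoundedMeasurable g)
    (h0 : ∫ x, g x ∂uniformAngle = 0) :
    HasSum (fun k : ℕ => 2 * ‖angleCoeff (fun x => (g x : ℂ)) ((k : ℤ) + 1)‖ ^ 2 *
        min ((k : ℝ) + 1) N)
      (N * ∫ x, g x ^ 2 ∂uniformAngle - ∑ i : Fin N, ∑ j : Fin N,
        ‖angleCoeff (fun x => (g x : ℂ)) ((i : ℤ) - (j : ℤ))‖ ^ 2) := by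
  set h : ℤ → ℝ := fun m => ‖angleCoeff (fun x => (g x : ℂ)) m‖ ^ 2 with hh
  have hz : h 0 = 0 := by
    rw [hh]; simp [angleCoeff_zero, integral_complex_ofReal, h0]
  have heven : ∀ m, h (-m) = h m := by
    intro m; simp only [hh, angleCoeff_neg_of_real, RCLike.norm_conj]
  have h1 := (hasSum_sq_angleCoeff_of_real hg h0).mul_left (N : ℝ)
  have h2 : HasSum (fun k : ℕ => if k < N then 2 * h (k + 1) * ((N : ℝ) - (k + 1)) else 0)
      (∑ i : Fin N, ∑ j : Fin N, h ((i : ℤ) - (j : ℤ))) := by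
    rw [sum_sum_sub_eq N h heven hz]
    have : ∑ k ∈ Finset.range N, 2 * h (k + 1) * ((N : ℝ) - (k + 1)) =
        ∑ k ∈ Finset.range N, if k < N then 2 * h (k + 1) * ((N : ℝ) - (k + 1)) else 0 :=
      Finset.sum_congr rfl fun k hk => by rw [if_pos (Finset.mem_range.1 hk)]
    rw [this]
    refine hasSum_sum_of_ne_finset_zero fun k hk => if_neg ?_
    simpa using hk
  -- The weight at frequency `k` is `N - (N - k)⁺ = min(k, N)`.
  refine (h1.sub h2).congr_fun ?_ |> fun h => h
  intro k
  simp only [hh]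
  split_ifs with hk
  · rw [min_eq_left (by exact_mod_cast hk)]; ring
  · rw [min_eq_right (by push Not at hk; exact_mod_cast Nat.le_succ_of_le hk)]; ring

end ToeplitzVariance

/-! ### The linear central limit theorem for the CUE, uniform in the test function. -/

/-- The variance `∑_{k ≠ 0} |ĝ(k)|² q(|k|)` of a linear statistic with mean zero. -/
noncomputable def fluctuationVariance (q : ℕ → ℝ) (g : ℝ → ℝ) : ℝ :=
  ∑' k : ℕ, 2 * ‖angleCoeff (fun x => (g x : ℂ)) ((k : ℤ) + 1)‖ ^ 2 * q (k + 1)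

/-- A central limit theorem for linear statistics `∑ g(θ_j)`, uniform in the test function `g`
up to its fourth moment. -/
def HasLinearGaussianLimit (Q : ∀ N, Measure (Fin N → ℝ)) (q : ℕ → ℕ → ℝ) : Prop :=
  ∀ t : ℝ, ∃ ε : ℕ → ℝ, Tendsto ε atTop (𝓝 0) ∧ ∀ N : ℕ, 1 ≤ N → ∀ g : ℝ → ℝ,
    BoundedMeasurable g → ∫ x, g x ∂uniformAngle = 0 →
    ‖∫ θ, Complex.exp (Complex.I * ((t / √N * ∑ j, g (θ j) : ℝ) : ℂ)) ∂(Q N) -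
      ((Real.exp (-(t ^ 2 / (2 * N) * fluctuationVariance (q N) g)) : ℝ) : ℂ)‖ ≤
      ε N * (1 + ∫ x, g x ^ 4 ∂uniformAngle)

lemma tendsto_inv_sqrt_sqrt_natCast : Tendsto (fun N : ℕ => (√√(N : ℝ))⁻¹) atTop (𝓝 0) :=
  tendsto_inv_atTop_zero.comp
    (Real.tendsto_sqrt_atTop.comp (Real.tendsto_sqrt_atTop.comp tendsto_natCast_atTop_atTop))

lemma exists_fourth_root {y : ℝ} (hy : 0 ≤ y) : ∃ x, 0 ≤ x ∧ x ^ 4 = y :=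
  ⟨√√y, Real.sqrt_nonneg _, by
    rw [show (4 : ℕ) = 2 * 2 by rfl, pow_mul, Real.sq_sqrt (Real.sqrt_nonneg _), Real.sq_sqrt hy]⟩

lemma cube_le_one_add_fourth {x : ℝ} (hx : 0 ≤ x) : x ^ 3 ≤ 1 + x ^ 4 := by
  rcases le_total x 1 with h | h
  · have := pow_le_one₀ (n := 3) hx h
    have : 0 ≤ x ^ 4 := by positivity
    linarith
  · have := pow_le_pow_right₀ h (show 3 ≤ 4 by norm_num)
    linarith

/-- Moment bounds for a bounded function in terms of its fourth moment. -/
lemma BoundedMeasurable.integral_sq_le {μ : Measure ℝ} [IsProbabilityMeasure μ] {g : ℝ → ℝ}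
    (hg : BoundedMeasurable g) {x : ℝ} (hx : x ^ 4 = ∫ y, g y ^ 4 ∂μ) :
    ∫ y, g y ^ 2 ∂μ ≤ x ^ 2 := by
  have h := (hg.pow 2).integral_mul_sq_le (boundedMeasurable_const 1) (μ := μ)
  simp only [mul_one, ← pow_mul, one_pow, integral_const, probReal_univ, smul_eq_mul] at h
  refine abs_le_of_sq_le_sq' (h.trans ?_) (by positivity) |>.2
  rw [← hx]; ring_nf; rfl

lemma BoundedMeasurable.integral_abs_cube_le {μ : Measure ℝ} [IsProbabilityMeasure μ] {g : ℝ → ℝ}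
    (hg : BoundedMeasurable g) {x : ℝ} (hx0 : 0 ≤ x) (hx : x ^ 4 = ∫ y, g y ^ 4 ∂μ) :
    ∫ y, |g y| ^ 3 ∂μ ≤ x ^ 3 := by
  have h := hg.norm.integral_mul_sq_le (hg.pow 2) (μ := μ)
  have h1 : ∀ y, ‖g y‖ * g y ^ 2 = |g y| ^ 3 := fun y => by
    rw [← sq_abs, Real.norm_eq_abs]; ring
  simp only [h1] at h
  simp only [Real.norm_eq_abs, sq_abs, ← pow_mul] at h
  have h2 := hg.integral_sq_le hx
  refine abs_le_of_sq_le_sq' (h.trans ?_) (by positivity) |>.2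
  calc (∫ y, g y ^ 2 ∂μ) * ∫ y, g y ^ (2 * 2) ∂μ ≤ x ^ 2 * x ^ 4 := by
        rw [hx]
        refine mul_le_mul_of_nonneg_right h2 (integral_nonneg fun y => ?_)
        exact Even.pow_nonneg (by decide) _
    _ = _ := by ring

/-- Passes from a multiplicative estimate `D ≈ e^z` with `z ≈ w` to an additive one. If `δ + c ≤ 1`,
the two errors combine to `e^{δ+c} - 1 ≤ 2(δ+c)`; otherwise the trivial bound `2` suffices. -/
lemma norm_sub_exp_le_of_norm_mul_exp_sub_one_le {D z : ℂ} {w c δ : ℝ}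
    (hD : ‖D‖ ≤ 1) (hw : w ≤ 0) (hc : 0 ≤ c) (hz : ‖z - w‖ ≤ δ)
    (h : ‖D * Complex.exp (-z) - 1‖ ≤ Real.exp c - 1) :
    ‖D - (Real.exp w : ℝ)‖ ≤ 2 * (δ + c) := by
  have hδ : 0 ≤ δ := (norm_nonneg _).trans hz
  have hw1 : Real.exp w ≤ 1 := Real.exp_le_one_iff.2 hw
  rcases le_total (δ + c) 1 with h1 | h1
  · have hzre : ‖Complex.exp z‖ ≤ Real.exp δ := by
      rw [Complex.norm_exp]
      refine Real.exp_le_exp.2 ?_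
      have h2 := (Complex.abs_re_le_norm (z - w)).trans hz
      rw [Complex.sub_re, Complex.ofReal_re] at h2
      linarith [(abs_le.1 h2).2]
    have h2 : D - (Real.exp w : ℝ) = Complex.exp z * (D * Complex.exp (-z) - 1) +
        Complex.exp w * (Complex.exp (z - w) - 1) := by
      rw [Complex.ofReal_exp, mul_sub, mul_sub, ← Complex.exp_add, mul_left_comm,
        ← Complex.exp_add]
      simp
    have h3 : ‖Complex.exp (z - w) - 1‖ ≤ Real.exp δ - 1 := by
      have := Complex.norm_exp_sub_sum_le_exp_norm_sub_sum (z - w) 1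
      simp only [Finset.range_one, Finset.sum_singleton, pow_zero, Nat.factorial_zero,
        Nat.cast_one, div_one] at this
      linarith [Real.exp_le_exp.2 hz]
    have h4 : ‖Complex.exp w‖ ≤ 1 := by
      rw [Complex.norm_exp, Complex.ofReal_re]; exact hw1
    have h5 : ‖D - (Real.exp w : ℝ)‖ ≤ Real.exp δ * (Real.exp c - 1) + 1 * (Real.exp δ - 1) := by
      rw [h2]
      refine (norm_add_le _ _).trans ?_
      rw [norm_mul, norm_mul]
      gcongr
    have h6 : Real.exp δ * (Real.exp c - 1) + 1 * (Real.exp δ - 1) = Real.exp (δ + c) - 1 := by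
      rw [Real.exp_add]; ring
    rw [h6] at h5
    have h7 : |Real.exp (δ + c) - 1| ≤ 2 * |δ + c| :=
      Real.abs_exp_sub_one_le (by rw [abs_of_nonneg (by positivity)]; exact h1)
    rw [abs_of_nonneg (show 0 ≤ δ + c by positivity)] at h7
    linarith [le_abs_self (Real.exp (δ + c) - 1)]
  · refine (norm_sub_le _ _).trans ?_
    rw [Complex.norm_real, Real.norm_of_nonneg (Real.exp_pos w).le]
    linarith

lemma norm_integral_exp_le_one {α : Type*} [MeasurableSpace α] (μ : Measure α)
    [IsProbabilityMeasure μ] (φ : α → ℝ) :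
    ‖∫ x, Complex.exp (Complex.I * (φ x : ℂ)) ∂μ‖ ≤ 1 := by
  refine (norm_integral_le_of_norm_le_const (C := 1) (.of_forall fun x => ?_)).trans (by simp)
  rw [Complex.norm_exp_I_mul_ofReal]

open scoped Matrix.Norms.L2Operator in
-- Here `ν = N^{1/4}` and `x` is the `L⁴` norm of `g`, so `a = |t|x/ν` bounds the operator norm of
-- the perturbation. The constant is `18 = 2(7 + 2)`: `7K` from the two traces and `2K` from the
-- determinant expansion.
lemma norm_integral_exp_circularUnitaryEnsemble_sub_le {N : ℕ} {g : ℝ → ℝ}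
    (hg : BoundedMeasurable g) (h0 : ∫ y, g y ∂uniformAngle = 0) {t ν x : ℝ} (hν : 1 ≤ ν)
    (hνN : ν ^ 4 = N) (hx0 : 0 ≤ x) (hx : x ^ 4 = ∫ y, g y ^ 4 ∂uniformAngle) :
    ‖∫ θ, Complex.exp (Complex.I * ((t / ν ^ 2 * ∑ j, g (θ j) : ℝ) : ℂ))
        ∂(circularUnitaryEnsemble N) -
      ((Real.exp (-((t / ν ^ 2) ^ 2 / 2 *
        fluctuationVariance (fun k => min (k : ℝ) N) g)) : ℝ) : ℂ)‖ ≤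
      18 * (|t| ^ 3 * x ^ 3 / ν) := by
  have hν0 : 0 < ν := by linarith
  set s := t / ν ^ 2 with hs
  set K := |t| ^ 3 * x ^ 3 / ν with hK
  have hK0 : 0 ≤ K := by positivity
  have hV := hasSum_variance_toeplitz N hg h0
  have hVeq : fluctuationVariance (fun k => min (k : ℝ) N) g =
      N * ∫ y, g y ^ 2 ∂uniformAngle - ∑ i : Fin N, ∑ j : Fin N,
        ‖angleCoeff (fun y => (g y : ℂ)) ((i : ℤ) - (j : ℤ))‖ ^ 2 := by
    rw [fluctuationVariance, ← hV.tsum_eq]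
    refine tsum_congr fun k => ?_
    push_cast; rfl
  have hVnn : 0 ≤ fluctuationVariance (fun k => min (k : ℝ) N) g :=
    tsum_nonneg fun k => by positivity
  set V := fluctuationVariance (fun k => min (k : ℝ) N) g with hVdef
  set a := |t| * x / ν with ha
  have ha0 : 0 ≤ a := by positivity
  have hw : -(s ^ 2 / 2 * V) ≤ 0 := by
    rw [neg_nonpos]; positivity
  -- The determinant expansion needs `a ≤ 1/2`. Otherwise `K ≥ a³ ≥ 1/8`, and `18K` exceeds the
  -- trivial bound `2`.
  rcases le_or_gt a (1 / 2) with ha2 | ha2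
  · -- the symbol and its truncations
    set φ : ℝ → ℂ := fun y => Complex.exp (Complex.I * ((s * g y : ℝ) : ℂ)) with hφ
    have hgm : Measurable fun y => s * g y := hg.1.const_mul s
    have bφ : BoundedMeasurable φ := BoundedMeasurable.cexp_I_mul hgm
    set ψ : ℝ → ℂ := fun y => φ y - 1 with hψ
    have bψ : BoundedMeasurable ψ := bφ.sub (boundedMeasurable_const 1)
    set ℓ : ℝ → ℂ := fun y => Complex.I * (s : ℂ) * (g y : ℂ) with hℓ
    have bℓ : BoundedMeasurable ℓ := (boundedMeasurable_const _).mul hg.ofReal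
    set E := toeplitz N ψ with hE
    set A := toeplitz N (fun y => (g y : ℂ)) with hA
    have hℓA : toeplitz N ℓ = (Complex.I * (s : ℂ)) • A := toeplitz_const_mul N _ _
    have hD : ∫ θ, Complex.exp (Complex.I * ((s * ∑ j, g (θ j) : ℝ) : ℂ))
        ∂(circularUnitaryEnsemble N) = (1 + E).det := by
      have h1 : (1 : Matrix (Fin N) (Fin N) ℂ) + E = toeplitz N φ := by
        rw [hE, ← toeplitz_one, ← toeplitz_add N (boundedMeasurable_const 1) bψ]
        congr 1; ext y; simp [hψ]
      rw [h1, ← integral_prod_eq_det_toeplitz N φ bφ.integrable]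
      congr 1; ext θ
      rw [hφ, ← Complex.exp_sum]
      congr 1
      push_cast
      rw [Finset.mul_sum, Finset.mul_sum]
    have hψn : ∀ y, ‖ψ y‖ ≤ |s| * |g y| := fun y => by
      have := Real.norm_exp_I_mul_ofReal_sub_one_le (x := s * g y)
      rwa [Real.norm_eq_abs, abs_mul] at this
    have hs4 : N * s ^ 4 = t ^ 4 / ν ^ 4 := by
      rw [← hνN, hs]; field_simp
    have hs2 : N * s ^ 2 = t ^ 2 := by
      rw [← hνN, hs]; field_simp
    have hs3 : N * |s| ^ 3 = |t| ^ 3 / ν ^ 2 := by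
      rw [← hνN, hs, abs_div, abs_of_pos (show 0 < ν ^ 2 by positivity)]; field_simp
    have hEa : ‖E‖ ≤ a := by
      refine l2_opNorm_toeplitz_le bψ ha0 ?_
      calc N * ∫ y, ‖ψ y‖ ^ 4 ∂uniformAngle ≤ N * ∫ y, s ^ 4 * g y ^ 4 ∂uniformAngle := by
            refine mul_le_mul_of_nonneg_left (integral_mono (bψ.norm.pow 4).integrable
              ((hg.pow 4).integrable.const_mul _) fun y => ?_) (by positivity)
            calc ‖ψ y‖ ^ 4 ≤ (|s| * |g y|) ^ 4 := pow_le_pow_left₀ (norm_nonneg _) (hψn y) 4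
              _ = s ^ 4 * g y ^ 4 := by
                rw [mul_pow, Even.pow_abs (by decide), Even.pow_abs (by decide)]
        _ = N * s ^ 4 * x ^ 4 := by rw [integral_const_mul, hx]; ring
        _ = a ^ 4 := by
          rw [hs4, ha, div_pow, mul_pow, Even.pow_abs (by decide)]; ring
    have hM2 := hg.integral_sq_le hx
    have hM3 := hg.integral_abs_cube_le hx0 hx
    have hF : frobeniusSq E ≤ t ^ 2 * x ^ 2 := by
      refine (frobeniusSq_toeplitz_le N bψ).trans ?_
      calc N * ∫ y, ‖ψ y‖ ^ 2 ∂uniformAngle ≤ N * ∫ y, s ^ 2 * g y ^ 2 ∂uniformAngle := by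
            refine mul_le_mul_of_nonneg_left (integral_mono (bψ.norm.pow 2).integrable
              ((hg.pow 2).integrable.const_mul _) fun y => ?_) (by positivity)
            calc ‖ψ y‖ ^ 2 ≤ (|s| * |g y|) ^ 2 := pow_le_pow_left₀ (norm_nonneg _) (hψn y) 2
              _ = s ^ 2 * g y ^ 2 := by rw [mul_pow, sq_abs, sq_abs]
        _ = N * s ^ 2 * ∫ y, g y ^ 2 ∂uniformAngle := by rw [integral_const_mul]; ring
        _ ≤ _ := by rw [hs2]; gcongr
    set c := 2 * a * frobeniusSq E with hc
    have hcK : c ≤ 2 * K := by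
      calc c ≤ 2 * a * (t ^ 2 * x ^ 2) := by rw [hc]; gcongr
        _ = 2 * K := by rw [ha, hK, ← sq_abs t]; ring
    have hdet := norm_det_one_add_mul_exp_sub_one_le E hEa ha2
    set z := E.trace - (E * E).trace / 2 with hz
    have hzw : ‖z - ((-(s ^ 2 / 2 * V) : ℝ) : ℂ)‖ ≤ 7 * K := by
      -- The linear Taylor term integrates to zero because `g` has mean zero; the quadratic one
      -- remains, with a cubic error.
      have hT1 : ‖E.trace + ((N * (s ^ 2 / 2 * ∫ y, g y ^ 2 ∂uniformAngle) : ℝ) : ℂ)‖ ≤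
          4 * K := by
        have h1 : E.trace + ((N * (s ^ 2 / 2 * ∫ y, g y ^ 2 ∂uniformAngle) : ℝ) : ℂ) =
            N * ∫ y, (ψ y - Complex.I * ((s * g y : ℝ) : ℂ) +
              ((s * g y : ℝ) : ℂ) ^ 2 / 2) ∂uniformAngle := by
          have e1 : ∀ y, ψ y - Complex.I * ((s * g y : ℝ) : ℂ) + ((s * g y : ℝ) : ℂ) ^ 2 / 2 =
              ψ y - Complex.I * s * (g y : ℂ) + ((s ^ 2 / 2 * g y ^ 2 : ℝ) : ℂ) := fun y => by
            push_cast; ring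
          simp_rw [e1]
          rw [integral_add, integral_sub, integral_const_mul, integral_complex_ofReal,
            integral_complex_ofReal, h0, integral_const_mul, hE, trace_toeplitz]
          · push_cast; ring
          · exact bψ.integrable
          · exact bℓ.integrable
          · exact (bψ.sub bℓ).integrable
          · exact (((boundedMeasurable_const _).mul (hg.pow 2)).ofReal).integrable
        rw [h1, norm_mul, Complex.norm_natCast]
        calc N * ‖∫ y, (ψ y - Complex.I * ((s * g y : ℝ) : ℂ) +
              ((s * g y : ℝ) : ℂ) ^ 2 / 2) ∂uniformAngle‖
            ≤ N * ∫ y, 4 * |s| ^ 3 * |g y| ^ 3 ∂uniformAngle := by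
              refine mul_le_mul_of_nonneg_left (norm_integral_le_of_norm_le
                ((hg.norm.pow 3).integrable.const_mul _) (.of_forall fun y => ?_)) (by positivity)
              have := norm_exp_I_mul_sub_quadratic_le (s * g y)
              rw [abs_mul, mul_pow, ← mul_assoc] at this
              exact this
          _ = 4 * (N * |s| ^ 3) * ∫ y, |g y| ^ 3 ∂uniformAngle := by
            rw [integral_const_mul]; ring
          _ ≤ 4 * (|t| ^ 3 / ν ^ 2) * x ^ 3 := by rw [hs3]; gcongr
          _ = 4 * (K / ν) := by rw [hK]; field_simp
          _ ≤ _ := by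
            have : K / ν ≤ K := div_le_self hK0 hν
            linarith
      have hT2 : ‖(E * E).trace + (s : ℂ) ^ 2 * (A * A).trace‖ ≤ 6 * K := by
        -- With `L = isA` this is `tr E² - tr L² = tr((E - L)(E + L))`, the cross terms cancelling
        -- by cyclicity. The symbol of `E - L` is second order in `s`, that of `E + L` first order,
        -- and the trace is bounded by Frobenius norms.
        have h1 : (E * E).trace + (s : ℂ) ^ 2 * (A * A).trace =
            (toeplitz N (fun y => ψ y + (-1) * ℓ y) * toeplitz N (fun y => ψ y + ℓ y)).trace := by
          rw [toeplitz_add N bψ bℓ, toeplitz_add N bψ ((boundedMeasurable_const _).mul bℓ),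
            toeplitz_const_mul N (-1) ℓ, hℓA, ← hE]
          simp only [add_mul, mul_add, Matrix.trace_add, Matrix.smul_mul, Matrix.mul_smul,
            Matrix.trace_smul, smul_eq_mul]
          rw [Matrix.trace_mul_comm A E]
          linear_combination ((s : ℂ) ^ 2 * (A * A).trace) * Complex.I_sq
        rw [h1]
        refine (norm_trace_mul_le _ _).trans ?_
        have hF1 : frobeniusSq (toeplitz N (fun y => ψ y + (-1) * ℓ y)) ≤
            (3 * t ^ 2 * x ^ 2 / ν ^ 2) ^ 2 := by
          refine (frobeniusSq_toeplitz_le N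
            (bψ.add ((boundedMeasurable_const _).mul bℓ))).trans ?_
          calc N * ∫ y, ‖ψ y + (-1) * ℓ y‖ ^ 2 ∂uniformAngle
              ≤ N * ∫ y, 9 * s ^ 4 * g y ^ 4 ∂uniformAngle := by
                refine mul_le_mul_of_nonneg_left (integral_mono
                  ((bψ.add ((boundedMeasurable_const _).mul bℓ)).norm.pow 2).integrable
                  ((hg.pow 4).integrable.const_mul _) fun y => ?_) (by positivity)
                have h2 := norm_exp_I_mul_sub_one_sub_le (s * g y)
                have h3 : ψ y + (-1) * ℓ y = Complex.exp (Complex.I * ((s * g y : ℝ) : ℂ)) - 1 -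
                    Complex.I * ((s * g y : ℝ) : ℂ) := by
                  simp only [hψ, hφ, hℓ]; push_cast; ring
                simp only [h3]
                calc _ ≤ (3 * (s * g y) ^ 2) ^ 2 := pow_le_pow_left₀ (norm_nonneg _) h2 2
                  _ = _ := by ring
            _ = 9 * (N * s ^ 4) * x ^ 4 := by rw [integral_const_mul, hx]; ring
            _ = _ := by rw [hs4]; field_simp; ring
        have hF2 : frobeniusSq (toeplitz N (fun y => ψ y + ℓ y)) ≤ (2 * |t| * x) ^ 2 := by
          refine (frobeniusSq_toeplitz_le N (bψ.add bℓ)).trans ?_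
          calc N * ∫ y, ‖ψ y + ℓ y‖ ^ 2 ∂uniformAngle
              ≤ N * ∫ y, 4 * s ^ 2 * g y ^ 2 ∂uniformAngle := by
                refine mul_le_mul_of_nonneg_left (integral_mono
                  ((bψ.add bℓ).norm.pow 2).integrable
                  ((hg.pow 2).integrable.const_mul _) fun y => ?_) (by positivity)
                have h3 : ‖ψ y + ℓ y‖ ≤ |s| * |g y| + |s| * |g y| := by
                  refine (norm_add_le _ _).trans (add_le_add (hψn y) (le_of_eq ?_))
                  simp [hℓ]
                calc _ ≤ (|s| * |g y| + |s| * |g y|) ^ 2 := pow_le_pow_left₀ (norm_nonneg _) h3 2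
                  _ = 4 * |s| ^ 2 * |g y| ^ 2 := by ring
                  _ = _ := by rw [sq_abs, sq_abs]
            _ = 4 * (N * s ^ 2) * ∫ y, g y ^ 2 ∂uniformAngle := by rw [integral_const_mul]; ring
            _ ≤ 4 * t ^ 2 * x ^ 2 := by rw [hs2]; gcongr
            _ = _ := by rw [mul_pow, mul_pow, sq_abs]; ring
        calc _ ≤ (3 * t ^ 2 * x ^ 2 / ν ^ 2) * (2 * |t| * x) :=
              mul_le_mul ((Real.sqrt_le_sqrt hF1).trans (by rw [Real.sqrt_sq (by positivity)]))
                ((Real.sqrt_le_sqrt hF2).trans (by rw [Real.sqrt_sq (by positivity)]))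
                (Real.sqrt_nonneg _) (by positivity)
          _ = 6 * (K / ν) := by rw [hK, ← sq_abs t]; field_simp; ring
          _ ≤ _ := by
            have : K / ν ≤ K := div_le_self hK0 hν
            linarith
      have h3 : z - ((-(s ^ 2 / 2 * V) : ℝ) : ℂ) =
          (E.trace + ((N * (s ^ 2 / 2 * ∫ y, g y ^ 2 ∂uniformAngle) : ℝ) : ℂ)) -
          ((E * E).trace + (s : ℂ) ^ 2 * (A * A).trace) / 2 := by
        rw [hz, hA, trace_toeplitz_sq_of_real, hVeq]
        push_cast
        ring
      rw [h3]
      refine (norm_sub_le _ _).trans ?_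
      rw [norm_div, Complex.norm_ofNat]
      linarith
    have hfin := norm_sub_exp_le_of_norm_mul_exp_sub_one_le (D := (1 + E).det) (z := z)
      (w := -(s ^ 2 / 2 * V)) (c := c) (δ := 7 * K)
      (by rw [← hD]; exact norm_integral_exp_le_one _ _) hw
      (mul_nonneg (by positivity) (frobeniusSq_nonneg E)) hzw
      (by rw [show -z = -E.trace + (E * E).trace / 2 by rw [hz]; ring]; exact hdet)
    rw [hD]
    linarith
  · have h1 : ‖∫ θ, Complex.exp (Complex.I * ((s * ∑ j, g (θ j) : ℝ) : ℂ))
        ∂(circularUnitaryEnsemble N) - ((Real.exp (-(s ^ 2 / 2 * V)) : ℝ) : ℂ)‖ ≤ 1 + 1 := by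
      refine (norm_sub_le _ _).trans (add_le_add (norm_integral_exp_le_one _ _) ?_)
      rw [Complex.norm_real, Real.norm_of_nonneg (Real.exp_pos _).le]
      exact Real.exp_le_one_iff.2 hw
    refine h1.trans ?_
    have h2 : (1 / 2 : ℝ) ^ 3 ≤ a ^ 3 := pow_le_pow_left₀ (by norm_num) ha2.le 3
    have h3 : a ^ 3 = K / ν ^ 2 := by rw [ha, hK]; field_simp
    have h4 : K / ν ^ 2 ≤ K := div_le_self hK0 (one_le_pow₀ hν)
    norm_num at h2
    linarith

/-- The central limit theorem for linear statistics of the circular unitary ensemble. -/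
theorem hasLinearGaussianLimit_circularUnitaryEnsemble :
    HasLinearGaussianLimit circularUnitaryEnsemble fun N k => min (k : ℝ) N := by
  intro t
  refine ⟨fun N => 18 * |t| ^ 3 * (√√(N : ℝ))⁻¹, ?_, fun N hN g hg h0 => ?_⟩
  · simpa using tendsto_inv_sqrt_sqrt_natCast.const_mul (18 * |t| ^ 3)
  · obtain ⟨x, hx0, hx⟩ := exists_fourth_root
      (show 0 ≤ ∫ y, g y ^ 4 ∂uniformAngle from integral_nonneg fun y => by positivity)
    have hN1 : (1 : ℝ) ≤ N := by exact_mod_cast hN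
    have hν2 : √√(N : ℝ) ^ 2 = √N := Real.sq_sqrt (Real.sqrt_nonneg _)
    have hν : 1 ≤ √√(N : ℝ) := by
      rw [Real.one_le_sqrt, Real.one_le_sqrt]; exact hN1
    have hν4 : √√(N : ℝ) ^ 4 = N := by
      rw [show (4 : ℕ) = 2 * 2 by rfl, pow_mul, hν2, Real.sq_sqrt (by positivity)]
    have h := norm_integral_exp_circularUnitaryEnsemble_sub_le hg h0 (t := t) hν hν4 hx0 hx
    rw [hν2] at h
    have h1 : (t / √(N : ℝ)) ^ 2 / 2 = t ^ 2 / (2 * N) := by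
      rw [div_pow, Real.sq_sqrt (by positivity), div_div, mul_comm]
    rw [h1] at h
    refine h.trans ?_
    rw [← hx]
    calc 18 * (|t| ^ 3 * x ^ 3 / √√(N : ℝ)) = 18 * |t| ^ 3 * (√√(N : ℝ))⁻¹ * x ^ 3 := by
          rw [div_eq_mul_inv]; ring
      _ ≤ _ := mul_le_mul_of_nonneg_left (cube_le_one_add_fourth hx0) (by positivity)

/-! ### The linear central limit theorem for independent uniform angles. -/

/-- The law of `N` independent uniformly distributed angles. -/
noncomputable def iidUniformAngles (N : ℕ) : Measure (Fin N → ℝ) :=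
  Measure.pi fun _ => uniformAngle

instance isProbabilityMeasure_iidUniformAngles (N : ℕ) :
    IsProbabilityMeasure (iidUniformAngles N) := by
  unfold iidUniformAngles; infer_instance

lemma norm_pow_sub_pow_le_mul {z w : ℂ} (hz : ‖z‖ ≤ 1) (hw : ‖w‖ ≤ 1) (N : ℕ) :
    ‖z ^ N - w ^ N‖ ≤ N * ‖z - w‖ := by
  induction N with
  | zero => simp
  | succ n ih =>
    have h : z ^ (n + 1) - w ^ (n + 1) = z ^ n * (z - w) + (z ^ n - w ^ n) * w := by ring
    rw [h]
    refine (norm_add_le _ _).trans ?_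
    rw [norm_mul, norm_mul, norm_pow]
    have h1 : ‖z‖ ^ n ≤ 1 := pow_le_one₀ (norm_nonneg _) hz
    push_cast
    nlinarith [norm_nonneg (z - w), norm_nonneg (z ^ n - w ^ n), norm_nonneg w]

lemma abs_exp_neg_sub_one_add_le {y : ℝ} (hy : 0 ≤ y) : |Real.exp (-y) - 1 + y| ≤ y ^ 2 := by
  have h1 : 1 - y ≤ Real.exp (-y) := by linarith [Real.add_one_le_exp (-y)]
  have h2 : Real.exp (-y) ≤ 1 - y + y ^ 2 := by
    rw [Real.exp_neg]
    refine (inv_anti₀ (by positivity) (Real.add_one_le_exp y)).trans ?_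
    rw [inv_le_iff_one_le_mul₀ (by positivity)]
    nlinarith [pow_nonneg hy 3]
  rw [abs_of_nonneg (by linarith)]
  linarith

/-- Parseval; with `c = N` this is the variance of a sum of `N` independent terms. -/
lemma fluctuationVariance_const {g : ℝ → ℝ} (hg : BoundedMeasurable g)
    (h0 : ∫ y, g y ∂uniformAngle = 0) (c : ℝ) :
    fluctuationVariance (fun _ => c) g = c * ∫ y, g y ^ 2 ∂uniformAngle := by
  rw [fluctuationVariance, ← (hasSum_sq_angleCoeff_of_real hg h0).tsum_eq, tsum_mul_right, mul_comm]

/-- The central limit theorem for linear statistics of independent uniform angles. -/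
theorem hasLinearGaussianLimit_iidUniformAngles :
    HasLinearGaussianLimit iidUniformAngles fun N _ => (N : ℝ) := by
  intro t
  refine ⟨fun N => (4 * |t| ^ 3 + t ^ 4) * (√(N : ℝ))⁻¹, ?_, fun N hN g hg h0 => ?_⟩
  · simpa using (tendsto_inv_atTop_zero.comp
      (Real.tendsto_sqrt_atTop.comp tendsto_natCast_atTop_atTop)).const_mul (4 * |t| ^ 3 + t ^ 4)
  obtain ⟨x, hx0, hx⟩ := exists_fourth_root
    (show 0 ≤ ∫ y, g y ^ 4 ∂uniformAngle from integral_nonneg fun y => by positivity)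
  have hN1 : (1 : ℝ) ≤ N := by exact_mod_cast hN
  have hN0 : (0 : ℝ) < N := by linarith
  set r := √(N : ℝ) with hr
  have hr1 : 1 ≤ r := by rw [hr, Real.one_le_sqrt]; exact hN1
  have hr0 : 0 < r := by linarith
  have hr2 : r ^ 2 = N := Real.sq_sqrt hN0.le
  set s := t / r with hs
  have hM2 := hg.integral_sq_le hx
  have hM3 := hg.integral_abs_cube_le hx0 hx
  set M := ∫ y, g y ^ 2 ∂uniformAngle with hM
  have hM0 : 0 ≤ M := integral_nonneg fun y => sq_nonneg _
  have hgm : Measurable fun y => s * g y := hg.1.const_mul s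
  have bφ := BoundedMeasurable.cexp_I_mul hgm
  set z := ∫ y, Complex.exp (Complex.I * ((s * g y : ℝ) : ℂ)) ∂uniformAngle with hz
  have hD : ∫ θ, Complex.exp (Complex.I * ((s * ∑ j, g (θ j) : ℝ) : ℂ)) ∂(iidUniformAngles N) =
      z ^ N := by
    have := integral_fintype_prod_eq_pow (ι := Fin N) (μ := uniformAngle)
      (fun y : ℝ => Complex.exp (Complex.I * ((s * g y : ℝ) : ℂ)))
    rw [Fintype.card_fin] at this
    rw [hz, ← this, iidUniformAngles]
    congr 1; ext θ
    rw [← Complex.exp_sum]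
    congr 1
    push_cast
    rw [Finset.mul_sum, Finset.mul_sum]
  have hw : (Real.exp (-(t ^ 2 / (2 * N) * fluctuationVariance (fun _ => (N : ℝ)) g)) : ℝ) =
      Real.exp (-(s ^ 2 * M / 2)) ^ N := by
    rw [fluctuationVariance_const hg h0, ← hM, ← Real.exp_nat_mul, hs, div_pow, hr2]
    congr 1
    field_simp
  rw [hD, hw, Complex.ofReal_pow]
  set y := s ^ 2 * M / 2 with hy
  have hy0 : 0 ≤ y := by positivity
  -- The one-point characteristic function and `e^{-y}` are both compared with `1 - y`; taking
  -- `N`-th powers costs a factor `N`.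
  have h1 : ‖z - ((Real.exp (-y) : ℝ) : ℂ)‖ ≤ 4 * |s| ^ 3 * x ^ 3 + y ^ 2 := by
    have h2 : z - 1 + (y : ℂ) = ∫ u, (Complex.exp (Complex.I * ((s * g u : ℝ) : ℂ)) - 1 -
        Complex.I * ((s * g u : ℝ) : ℂ) + ((s * g u : ℝ) : ℂ) ^ 2 / 2) ∂uniformAngle := by
      have e1 : ∀ u, Complex.exp (Complex.I * ((s * g u : ℝ) : ℂ)) - 1 -
          Complex.I * ((s * g u : ℝ) : ℂ) + ((s * g u : ℝ) : ℂ) ^ 2 / 2 =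
          Complex.exp (Complex.I * ((s * g u : ℝ) : ℂ)) - 1 - Complex.I * s * (g u : ℂ) +
            ((s ^ 2 / 2 * g u ^ 2 : ℝ) : ℂ) := fun u => by push_cast; ring
      simp_rw [e1]
      have b1 := bφ.sub (boundedMeasurable_const 1)
      have b2 : BoundedMeasurable fun u => Complex.I * s * (g u : ℂ) :=
        (boundedMeasurable_const _).mul hg.ofReal
      rw [integral_add (b1.sub b2).integrable, integral_sub b1.integrable b2.integrable,
        integral_sub bφ.integrable (integrable_const _), integral_const_mul,
        integral_complex_ofReal, integral_complex_ofReal, h0, integral_const_mul]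
      · simp only [integral_const, probReal_univ, one_smul]
        rw [hy, hz]; push_cast; ring
      · exact (((boundedMeasurable_const _).mul (hg.pow 2)).ofReal).integrable
    have h3 : ‖z - 1 + (y : ℂ)‖ ≤ 4 * |s| ^ 3 * x ^ 3 := by
      rw [h2]
      calc _ ≤ ∫ u, 4 * |s| ^ 3 * |g u| ^ 3 ∂uniformAngle := by
            refine norm_integral_le_of_norm_le ((hg.norm.pow 3).integrable.const_mul _)
              (.of_forall fun u => ?_)
            have := norm_exp_I_mul_sub_quadratic_le (s * g u)
            rw [abs_mul, mul_pow, ← mul_assoc] at this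
            exact this
        _ = 4 * |s| ^ 3 * ∫ u, |g u| ^ 3 ∂uniformAngle := by rw [integral_const_mul]
        _ ≤ _ := by gcongr
    have h4 : ‖((Real.exp (-y) - 1 + y : ℝ) : ℂ)‖ ≤ y ^ 2 := by
      rw [Complex.norm_real]; exact abs_exp_neg_sub_one_add_le hy0
    have h5 : z - ((Real.exp (-y) : ℝ) : ℂ) = (z - 1 + (y : ℂ)) -
        ((Real.exp (-y) - 1 + y : ℝ) : ℂ) := by push_cast; ring
    rw [h5]
    exact (norm_sub_le _ _).trans (add_le_add h3 h4)
  have hpow := norm_pow_sub_pow_le_mul (z := z) (w := ((Real.exp (-y) : ℝ) : ℂ))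
    (norm_integral_exp_le_one _ _) (by
      rw [Complex.norm_real, Real.norm_of_nonneg (Real.exp_pos _).le]
      exact Real.exp_le_one_iff.2 (by linarith)) N
  refine hpow.trans ((mul_le_mul_of_nonneg_left h1 hN0.le).trans ?_)
  have hyx : y ^ 2 ≤ s ^ 4 * x ^ 4 := by
    have : y ≤ s ^ 2 * x ^ 2 := by
      rw [hy]
      have : s ^ 2 * M ≤ s ^ 2 * x ^ 2 := by gcongr
      have : 0 ≤ s ^ 2 * x ^ 2 := by positivity
      linarith
    calc y ^ 2 ≤ (s ^ 2 * x ^ 2) ^ 2 := by gcongr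
      _ = _ := by ring
  have hs3 : N * |s| ^ 3 = |t| ^ 3 * r⁻¹ := by
    rw [← hr2, hs, abs_div, abs_of_pos hr0]; field_simp
  have hs4 : N * s ^ 4 ≤ t ^ 4 * r⁻¹ := by
    have h6 : N * s ^ 4 = t ^ 4 * (r ^ 2)⁻¹ := by rw [← hr2, hs]; field_simp
    rw [h6]
    have : (r ^ 2)⁻¹ ≤ r⁻¹ := inv_anti₀ hr0 (by nlinarith)
    gcongr
  calc N * (4 * |s| ^ 3 * x ^ 3 + y ^ 2) ≤ N * (4 * |s| ^ 3 * x ^ 3 + s ^ 4 * x ^ 4) := by gcongr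
    _ = 4 * (N * |s| ^ 3) * x ^ 3 + (N * s ^ 4) * x ^ 4 := by ring
    _ ≤ 4 * (|t| ^ 3 * r⁻¹) * (1 + x ^ 4) + (t ^ 4 * r⁻¹) * (1 + x ^ 4) := by
        rw [hs3]
        gcongr
        · exact cube_le_one_add_fourth hx0
        · linarith
    _ = _ := by rw [hx]; ring

/-! ### Poisson domination and fourth moments. -/

/-- Multiplicative statistics are bounded by those of a Poisson process of intensity `N`. -/
def HasPoissonBound (Q : ∀ N, Measure (Fin N → ℝ)) : Prop :=
  ∀ (N : ℕ) (φ : ℝ → ℝ), BoundedMeasurable φ → (∀ x, 0 ≤ φ x) →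
    ∫ θ, ∏ j, φ (θ j) ∂(Q N) ≤ Real.exp (N * (∫ x, φ x ∂uniformAngle - 1))

lemma hasPoissonBound_iidUniformAngles : HasPoissonBound iidUniformAngles := by
  intro N φ hφ h0
  have := integral_fintype_prod_eq_pow (ι := Fin N) (μ := uniformAngle) φ
  rw [iidUniformAngles, this, Fintype.card_fin, Real.exp_nat_mul]
  refine pow_le_pow_left₀ (integral_nonneg h0) ?_ N
  linarith [Real.add_one_le_exp (∫ x, φ x ∂uniformAngle - 1)]

open scoped ComplexOrder in
-- The quadratic form at `u` is the integral of `φ` against the squared modulus of the trigonometric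
-- polynomial with coefficients `u`.
lemma posSemidef_toeplitz (N : ℕ) {φ : ℝ → ℝ} (hφ : BoundedMeasurable φ) (h0 : ∀ x, 0 ≤ φ x) :
    (toeplitz N fun x => (φ x : ℂ)).PosSemidef := by
  refine Matrix.PosSemidef.of_dotProduct_mulVec_nonneg ?_ fun u => ?_
  · ext i j
    rw [Matrix.conjTranspose_apply, toeplitz, Matrix.of_apply, Matrix.of_apply,
      ← neg_sub, angleCoeff_neg_of_real]
    simp
  · rw [dotProduct_toeplitz_mulVec hφ.ofReal]
    have : ∀ x, (φ x : ℂ) * ((starRingEnd ℂ) (trigPoly u x) * trigPoly u x) =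
        ((φ x * ‖trigPoly u x‖ ^ 2 : ℝ) : ℂ) := fun x => by
      rw [Complex.conj_mul']; push_cast; rfl
    simp_rw [this]
    rw [integral_complex_ofReal]
    exact_mod_cast integral_nonneg fun x => mul_nonneg (h0 x) (sq_nonneg _)

open scoped ComplexOrder in
-- By Heine's identity the left side is a product of nonnegative Toeplitz eigenvalues. Bounding each
-- by `λ ≤ e^{λ-1}` leaves only the trace in the exponent.
lemma hasPoissonBound_circularUnitaryEnsemble : HasPoissonBound circularUnitaryEnsemble := by
  intro N φ hφ h0
  have h := integral_prod_eq_det_toeplitz N (fun x => (φ x : ℂ)) hφ.ofReal.integrable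
  have hP := posSemidef_toeplitz N hφ h0
  have htr := trace_toeplitz N fun x => (φ x : ℂ)
  rw [hP.isHermitian.trace_eq_sum_eigenvalues, integral_complex_ofReal] at htr
  rw [hP.isHermitian.det_eq_prod_eigenvalues] at h
  have h1 : ∀ θ : Fin N → ℝ, ∏ j, ((φ (θ j) : ℝ) : ℂ) = ((∏ j, φ (θ j) : ℝ) : ℂ) :=
    fun θ => by push_cast; rfl
  simp_rw [h1] at h
  rw [integral_complex_ofReal] at h
  have h2 : ∫ θ, ∏ j, φ (θ j) ∂(circularUnitaryEnsemble N) = ∏ i, hP.isHermitian.eigenvalues i := by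
    exact Complex.ofReal_injective (h.trans (by push_cast; rfl))
  have h3 : ∑ i, hP.isHermitian.eigenvalues i = N * ∫ x, φ x ∂uniformAngle := by
    exact Complex.ofReal_injective (Eq.trans (by push_cast; rfl) (htr.trans (by push_cast; rfl)))
  rw [h2]
  calc ∏ i, hP.isHermitian.eigenvalues i ≤ ∏ i, Real.exp (hP.isHermitian.eigenvalues i - 1) :=
        Finset.prod_le_prod (fun i _ => hP.eigenvalues_nonneg i) fun i _ => by
          linarith [Real.add_one_le_exp (hP.isHermitian.eigenvalues i - 1)]
    _ = _ := by
      rw [← Real.exp_sum, Finset.sum_sub_distrib, h3]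
      simp [mul_sub]

lemma pow_four_le_exp {y : ℝ} (hy : 0 ≤ y) : y ^ 4 ≤ 24 * Real.exp y := by
  have h := Real.pow_div_factorial_le_exp y hy 4
  rw [div_le_iff₀ (by positivity)] at h
  norm_num [Nat.factorial] at h
  linarith

/-- A fourth moment bound for nonnegative linear statistics. -/
lemma HasPoissonBound.integral_sum_pow_four_le {Q : ∀ N, Measure (Fin N → ℝ)}
    [∀ N, IsProbabilityMeasure (Q N)]
    (hQ : HasPoissonBound Q) (N : ℕ) {φ : ℝ → ℝ} (hφ : BoundedMeasurable φ) (h0 : ∀ x, 0 ≤ φ x) :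
    ∫ θ, (∑ j, φ (θ j)) ^ 4 ∂(Q N) ≤
      24 * Real.exp (N * ∫ x, (Real.exp (φ x) - 1) ∂uniformAngle) := by
  obtain ⟨C, hC⟩ := hφ.2
  have he : BoundedMeasurable fun x => Real.exp (φ x) :=
    ⟨hφ.1.exp, Real.exp C, fun x => by
      rw [Real.norm_of_nonneg (Real.exp_pos _).le]
      exact Real.exp_le_exp.2 ((le_abs_self _).trans (hC x))⟩
  have h := hQ N _ he fun x => (Real.exp_pos _).le
  have hev : ∀ j : Fin N, BoundedMeasurable fun θ : Fin N → ℝ => φ (θ j) := fun j =>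
    ⟨hφ.1.comp (measurable_pi_apply j), C, fun θ => hC _⟩
  have hS : BoundedMeasurable fun θ : Fin N → ℝ => ∑ j, φ (θ j) :=
    BoundedMeasurable.finsetSum _ hev
  have hE : BoundedMeasurable fun θ : Fin N → ℝ => Real.exp (∑ j, φ (θ j)) := by
    obtain ⟨C', hC'⟩ := hS.2
    exact ⟨hS.1.exp, Real.exp C', fun x => by
      rw [Real.norm_of_nonneg (Real.exp_pos _).le]
      exact Real.exp_le_exp.2 ((le_abs_self _).trans (hC' x))⟩
  calc ∫ θ, (∑ j, φ (θ j)) ^ 4 ∂(Q N) ≤ ∫ θ, 24 * Real.exp (∑ j, φ (θ j)) ∂(Q N) :=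
        integral_mono (hS.pow 4).integrable (hE.integrable.const_mul _) fun θ =>
          pow_four_le_exp (Finset.sum_nonneg fun j _ => h0 _)
    _ = 24 * ∫ θ, ∏ j, Real.exp (φ (θ j)) ∂(Q N) := by
        rw [integral_const_mul]; simp_rw [Real.exp_sum]
    _ ≤ _ := by
        refine mul_le_mul_of_nonneg_left (h.trans (le_of_eq ?_)) (by norm_num)
        rw [integral_sub he.integrable (integrable_const _)]
        simp

/-! ### Independent standard Gaussian variables. -/

section StandardGaussianVector

variable {ι : Type*} [Fintype ι]

/-- The law of a family of independent standard Gaussian variables. -/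
noncomputable def stdGaussianPi (ι : Type*) [Fintype ι] : Measure (ι → ℝ) :=
  Measure.pi fun _ => gaussianReal 0 1

instance : IsProbabilityMeasure (stdGaussianPi ι) := by
  unfold stdGaussianPi; infer_instance

lemma integral_exp_I_mul_stdGaussianPi (y : ι → ℝ) :
    ∫ ω, Complex.exp (Complex.I * ((∑ i, ω i * y i : ℝ) : ℂ)) ∂(stdGaussianPi ι) =
      ((Real.exp (-(∑ i, y i ^ 2) / 2) : ℝ) : ℂ) := by
  have h : ∀ ω : ι → ℝ, Complex.exp (Complex.I * ((∑ i, ω i * y i : ℝ) : ℂ)) =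
      ∏ i, (fun (i : ι) (x : ℝ) => Complex.exp ((y i : ℂ) * x * Complex.I)) i (ω i) := by
    intro ω
    rw [← Complex.exp_sum]
    congr 1
    push_cast
    rw [Finset.mul_sum]
    exact Finset.sum_congr rfl fun i _ => by ring
  simp_rw [h]
  rw [stdGaussianPi, integral_fintype_prod_eq_prod
    (fun (i : ι) (x : ℝ) => Complex.exp ((y i : ℂ) * x * Complex.I))]
  simp_rw [← charFun_apply_real, charFun_gaussianReal]
  rw [← Complex.exp_sum, Complex.ofReal_exp]
  congr 1
  push_cast
  rw [neg_div, Finset.sum_div, ← Finset.sum_neg_distrib]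
  exact Finset.sum_congr rfl fun i _ => by simp

lemma integrable_exp_stdGaussianPi (y : ι → ℝ) :
    Integrable (fun ω => Real.exp (∑ i, ω i * y i)) (stdGaussianPi ι) := by
  simp_rw [Real.exp_sum]
  exact Integrable.fintype_prod (f := fun (i : ι) (x : ℝ) => Real.exp (x * y i)) fun i => by
    simpa [mul_comm] using integrable_exp_mul_gaussianReal (μ := 0) (v := 1) (y i)

lemma integral_exp_stdGaussianPi (y : ι → ℝ) :
    ∫ ω, Real.exp (∑ i, ω i * y i) ∂(stdGaussianPi ι) = Real.exp ((∑ i, y i ^ 2) / 2) := by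
  simp_rw [Real.exp_sum]
  rw [stdGaussianPi, integral_fintype_prod_eq_prod (fun (i : ι) (x : ℝ) => Real.exp (x * y i)),
    Finset.sum_div, Real.exp_sum]
  refine Finset.prod_congr rfl fun i _ => ?_
  have h := mgf_gaussianReal (p := gaussianReal 0 1) (X := id) (μ := 0) (v := 1)
    Measure.map_id (y i)
  simp only [mgf, id_eq, zero_mul, NNReal.coe_one, one_mul, zero_add] at h
  rw [← h]
  congr 1; ext x; rw [mul_comm]

lemma memLp_sq_gaussianReal : MemLp (fun x : ℝ => x ^ 2) 2 (gaussianReal 0 1) := by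
  have h := memLp_id_gaussianReal (μ := 0) (v := 1) 4
  have h1 : MemLp (fun x : ℝ => ‖x‖ ^ (2 : ENNReal).toReal) (4 / 2) (gaussianReal 0 1) :=
    h.norm_rpow_div 2
  have h2 : (4 / 2 : ENNReal) = 2 := by
    rw [show (4 : ENNReal) = 2 * 2 by norm_num]
    exact ENNReal.mul_div_cancel_right (by norm_num) (by norm_num)
  rw [h2] at h1
  simpa using h1

lemma integral_sq_gaussianReal : ∫ x : ℝ, x ^ 2 ∂(gaussianReal 0 1) = 1 := by
  have h := variance_id_gaussianReal (μ := 0) (v := 1)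
  rw [variance_eq_integral aemeasurable_id] at h
  simpa using h

lemma integrable_eval_sq_stdGaussianPi (i : ι) :
    Integrable (fun ω : ι → ℝ => ω i ^ 2) (stdGaussianPi ι) :=
  ((measurePreserving_eval (fun _ : ι => gaussianReal 0 1) i).integrable_comp
    memLp_sq_gaussianReal.aestronglyMeasurable).2 (memLp_sq_gaussianReal.integrable (by norm_num))

lemma integrable_sum_sq_stdGaussianPi (a : ι → ℝ) :
    Integrable (fun ω => ∑ i, a i * ω i ^ 2) (stdGaussianPi ι) :=
  integrable_finsetSum _ fun i _ => (integrable_eval_sq_stdGaussianPi i).const_mul _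

/-- Weighted sums of squares of Gaussian variables concentrate. -/
lemma integral_abs_sum_sq_sub_le (a : ι → ℝ) :
    ∫ ω, |∑ i, a i * ω i ^ 2 - ∑ i, a i| ∂(stdGaussianPi ι) ≤
      √(Var[fun x : ℝ => x ^ 2; gaussianReal 0 1] * ∑ i, a i ^ 2) := by
  have hmem : ∀ i, MemLp (fun x : ℝ => a i * x ^ 2) 2 (gaussianReal 0 1) := fun i =>
    memLp_sq_gaussianReal.const_mul _
  have hvar := variance_sum_pi (μ := fun _ : ι => gaussianReal 0 1) hmem
  have hfun : (∑ i, fun ω : ι → ℝ => a i * ω i ^ 2) = fun ω => ∑ i, a i * ω i ^ 2 := by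
    ext ω; simp
  rw [hfun] at hvar
  change Var[_; stdGaussianPi ι] = _ at hvar
  have hmean : ∫ ω, ∑ i, a i * ω i ^ 2 ∂(stdGaussianPi ι) = ∑ i, a i := by
    rw [integral_finsetSum]
    · refine Finset.sum_congr rfl fun i _ => ?_
      rw [integral_const_mul, stdGaussianPi,
        integral_comp_eval (X := fun _ : ι => ℝ) (μ := fun _ : ι => gaussianReal 0 1) (i := i)
          (f := fun x : ℝ => x ^ 2) memLp_sq_gaussianReal.aestronglyMeasurable,
        integral_sq_gaussianReal, mul_one]
    · exact fun i _ => (integrable_eval_sq_stdGaussianPi i).const_mul _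
  have hL2 : MemLp (fun ω : ι → ℝ => ∑ i, a i * ω i ^ 2) 2 (stdGaussianPi ι) :=
    memLp_finsetSum _ fun i _ => (hmem i).comp_measurePreserving
      (measurePreserving_eval (fun _ : ι => gaussianReal 0 1) i)
  have hL2' : MemLp (fun ω : ι → ℝ => |∑ i, a i * ω i ^ 2 - ∑ i, a i|) 2 (stdGaussianPi ι) :=
    (hL2.sub (memLp_const _)).abs
  rw [variance_eq_integral hL2.aestronglyMeasurable.aemeasurable, hmean] at hvar
  have h1 := variance_nonneg (fun ω : ι → ℝ => |∑ i, a i * ω i ^ 2 - ∑ i, a i|) (stdGaussianPi ι)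
  rw [variance_eq_sub hL2'] at h1
  refine Real.le_sqrt_of_sq_le ?_
  have h2 : ∑ i, Var[fun x : ℝ => a i * x ^ 2; gaussianReal 0 1] =
      Var[fun x : ℝ => x ^ 2; gaussianReal 0 1] * ∑ i, a i ^ 2 := by
    rw [Finset.mul_sum]
    refine Finset.sum_congr rfl fun i _ => ?_
    rw [variance_const_mul, mul_comm]
  rw [← h2, ← hvar]
  simp only [Pi.pow_apply, sq_abs] at h1
  linarith

/-- A fourth moment bound for Gaussian combinations of functions. -/
lemma integral_integral_gaussian_pow_four_le (ψ : ι → ℝ → ℝ) (hψ : ∀ i, Measurable (ψ i))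
    (W : ℝ) (hW : ∀ x, ∑ i, ψ i x ^ 2 = W) :
    Integrable (fun ω => ∫ x, (∑ i, ω i * ψ i x) ^ 4 ∂uniformAngle) (stdGaussianPi ι) ∧
    ∫ ω, ∫ x, (∑ i, ω i * ψ i x) ^ 4 ∂uniformAngle ∂(stdGaussianPi ι) ≤
      48 * Real.exp (W / 2) := by
  have hexp : ∀ s : ℝ, s ^ 2 = 1 → Integrable
      (fun p : (ι → ℝ) × ℝ => Real.exp (∑ i, p.1 i * (s * ψ i p.2)))
      ((stdGaussianPi ι).prod uniformAngle) ∧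
      ∀ x, ∫ ω : ι → ℝ, Real.exp (∑ i, ω i * (s * ψ i x)) ∂(stdGaussianPi ι) =
        Real.exp (W / 2) := by
    intro s hs
    have h1 : ∀ x, ∫ ω : ι → ℝ, Real.exp (∑ i, ω i * (s * ψ i x)) ∂(stdGaussianPi ι) =
        Real.exp (W / 2) := by
      intro x
      rw [integral_exp_stdGaussianPi]
      simp_rw [mul_pow, hs, one_mul, hW]
    refine ⟨?_, h1⟩
    rw [integrable_prod_iff']
    · refine ⟨.of_forall fun x => integrable_exp_stdGaussianPi fun i => s * ψ i x, ?_⟩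
      simp_rw [Real.norm_of_nonneg (Real.exp_pos _).le]
      have : (fun x => ∫ ω : ι → ℝ, Real.exp (∑ i, ω i * (s * ψ i x)) ∂(stdGaussianPi ι)) =
        fun _ => Real.exp (W / 2) := funext h1
      rw [this]
      exact integrable_const _
    · refine Measurable.aestronglyMeasurable ?_
      refine (Finset.measurable_fun_sum _ fun i _ => ?_).exp
      exact ((measurable_pi_apply i).comp measurable_fst).mul
        (((hψ i).comp measurable_snd).const_mul s)
  obtain ⟨hp, hp'⟩ := hexp 1 (by norm_num)
  obtain ⟨hm, hm'⟩ := hexp (-1) (by norm_num)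
  -- At each fixed `x` the sum is Gaussian of variance `W`, so the two exponentials average to
  -- `e^{W/2}` each; hence `48 = 2 · 24`.
  have hbound : ∀ p : (ι → ℝ) × ℝ, (∑ i, p.1 i * ψ i p.2) ^ 4 ≤
      24 * (Real.exp (∑ i, p.1 i * (1 * ψ i p.2)) + Real.exp (∑ i, p.1 i * (-1 * ψ i p.2))) := by
    intro p
    have e1 : ∑ i, p.1 i * (1 * ψ i p.2) = ∑ i, p.1 i * ψ i p.2 := by simp
    have e2 : ∑ i, p.1 i * (-1 * ψ i p.2) = -∑ i, p.1 i * ψ i p.2 := by simp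
    rw [e1, e2]
    set y := ∑ i, p.1 i * ψ i p.2
    have h1 := pow_four_le_exp (abs_nonneg y)
    rw [Even.pow_abs (by decide)] at h1
    have h2 : Real.exp |y| ≤ Real.exp y + Real.exp (-y) := by
      rcases abs_cases y with h | h <;> rw [h.1] <;>
        linarith [Real.exp_pos y, Real.exp_pos (-y)]
    linarith
  have hmeas : Measurable fun p : (ι → ℝ) × ℝ => (∑ i, p.1 i * ψ i p.2) ^ 4 := by
    refine (Finset.measurable_fun_sum _ fun i _ => ?_).pow_const 4
    exact ((measurable_pi_apply i).comp measurable_fst).mul ((hψ i).comp measurable_snd)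
  have hint : Integrable (fun p : (ι → ℝ) × ℝ => (∑ i, p.1 i * ψ i p.2) ^ 4)
      ((stdGaussianPi ι).prod uniformAngle) := by
    refine ((hp.add hm).const_mul 24).mono' hmeas.aestronglyMeasurable (.of_forall fun p => ?_)
    rw [Real.norm_of_nonneg (Even.pow_nonneg (by decide) _)]
    exact hbound p
  refine ⟨hint.integral_prod_left, ?_⟩
  rw [integral_integral hint]
  calc _ ≤ ∫ p, 24 * (Real.exp (∑ i, p.1 i * (1 * ψ i p.2)) +
        Real.exp (∑ i, p.1 i * (-1 * ψ i p.2))) ∂((stdGaussianPi ι).prod uniformAngle) :=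
        integral_mono hint ((hp.add hm).const_mul 24) hbound
    _ = _ := by
      rw [integral_const_mul, integral_add hp hm, integral_prod_symm _ hp, integral_prod_symm _ hm]
      simp only [hp', hm', integral_const, probReal_univ, one_smul]
      ring

end StandardGaussianVector

/-! ### Random trigonometric polynomials and power sums. -/

section RandomTrigonometricPolynomial

/-- The trigonometric functions `√(2 p_k) cos((k+1)x)` and `√(2 p_k) sin((k+1)x)`. -/
noncomputable def trigBasis (p : ℕ → ℝ) {M : ℕ} (i : Fin M × Bool) (x : ℝ) : ℝ :=
  √(2 * p i.1) * if i.2 then Real.cos (((i.1 : ℕ) + 1) * x) else Real.sin (((i.1 : ℕ) + 1) * x)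

lemma boundedMeasurable_trigBasis (p : ℕ → ℝ) {M : ℕ} (i : Fin M × Bool) :
    BoundedMeasurable (trigBasis p i) := by
  unfold trigBasis
  refine (boundedMeasurable_const _).mul ?_
  split_ifs
  · exact ⟨by fun_prop, 1, fun x => Real.abs_cos_le_one _⟩
  · exact ⟨by fun_prop, 1, fun x => Real.abs_sin_le_one _⟩

/-- Using a cosine and a sine at each frequency makes the variance of the random polynomial the same
at every `x`, as the Gaussian fourth moment bound requires. -/
lemma sum_sq_trigBasis {p : ℕ → ℝ} (hp : ∀ k, 0 ≤ p k) (M : ℕ) (x : ℝ) :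
    ∑ i : Fin M × Bool, trigBasis p i x ^ 2 = ∑ k : Fin M, 2 * p k := by
  rw [Fintype.sum_prod_type]
  refine Finset.sum_congr rfl fun k _ => ?_
  simp only [trigBasis, Fintype.sum_bool, if_true, Bool.false_eq_true, if_false, mul_pow]
  rw [Real.sq_sqrt (mul_nonneg (by norm_num) (hp _)), ← mul_add, Real.cos_sq_add_sin_sq, mul_one]

/-- The power sum `∑_j e^{ikτ_j}`. -/
noncomputable def powerSum {N : ℕ} (k : ℤ) (τ : Fin N → ℝ) : ℂ :=
  ∑ j, Complex.exp (k * τ j * Complex.I)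

lemma norm_powerSum_le {N : ℕ} (k : ℤ) (τ : Fin N → ℝ) : ‖powerSum k τ‖ ≤ N := by
  refine (norm_sum_le _ _).trans ?_
  simp [norm_exp_int_mul_I]

lemma measurable_powerSum {N : ℕ} (k : ℤ) : Measurable (powerSum k : (Fin N → ℝ) → ℂ) := by
  unfold powerSum
  fun_prop

lemma sum_sq_sum_trigBasis {p : ℕ → ℝ} (hp : ∀ k, 0 ≤ p k) (M : ℕ) {N : ℕ} (τ : Fin N → ℝ) :
    ∑ i : Fin M × Bool, (∑ j, trigBasis p i (τ j)) ^ 2 =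
      ∑ k : Fin M, 2 * p k * ‖powerSum ((k : ℤ) + 1) τ‖ ^ 2 := by
  rw [Fintype.sum_prod_type]
  refine Finset.sum_congr rfl fun k _ => ?_
  have h : powerSum ((k : ℤ) + 1) τ = ((∑ j, Real.cos (((k : ℕ) + 1) * τ j) : ℝ) : ℂ) +
      ((∑ j, Real.sin (((k : ℕ) + 1) * τ j) : ℝ) : ℂ) * Complex.I := by
    rw [powerSum]
    push_cast
    rw [Finset.sum_mul, ← Finset.sum_add_distrib]
    refine Finset.sum_congr rfl fun j _ => ?_
    rw [Complex.exp_mul_I]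
  simp only [trigBasis, Fintype.sum_bool, if_true, Bool.false_eq_true, if_false,
    ← Finset.mul_sum, mul_pow]
  rw [Real.sq_sqrt (mul_nonneg (by norm_num) (hp _)), h, Complex.sq_norm,
    Complex.normSq_add_mul_I, mul_add]

lemma angleCoeff_exp (m n : ℤ) :
    angleCoeff (fun x => Complex.exp (n * x * Complex.I)) m = if m = n then 1 else 0 := by
  rw [angleCoeff]
  have h := integral_exp_uniformAngle (n - m)
  simp only [sub_eq_zero, eq_comm (a := n)] at h
  rw [← h]
  congr 1; ext x
  rw [← Complex.exp_add]
  congr 1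
  push_cast; ring

lemma boundedMeasurable_exp (m : ℤ) :
    BoundedMeasurable fun x : ℝ => Complex.exp (m * x * Complex.I) :=
  ⟨by fun_prop, 1, fun x => (norm_exp_int_mul_I m x).le⟩

lemma angleCoeff_trigBasis (p : ℕ → ℝ) {M : ℕ} (i : Fin M × Bool) (m : ℕ) :
    angleCoeff (fun x => (trigBasis p i x : ℂ)) m = if m = (i.1 : ℕ) + 1 then
      (√(2 * p i.1) : ℂ) * (if i.2 then 1 / 2 else -Complex.I / 2) else 0 := by
  obtain ⟨k, b⟩ := i
  have hne : ¬ ((m : ℤ) = -((k : ℤ) + 1)) := by omega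
  have hiff : ((m : ℤ) = (k : ℤ) + 1) ↔ m = (k : ℕ) + 1 := by omega
  have key : ∀ c d : ℂ, angleCoeff (fun x => c * Complex.exp ((((k : ℤ) + 1 : ℤ)) * x * Complex.I) +
      d * Complex.exp (((-((k : ℤ) + 1) : ℤ)) * x * Complex.I)) m =
      if m = (k : ℕ) + 1 then c else 0 := by
    intro c d
    rw [angleCoeff_add ((boundedMeasurable_const _).mul (boundedMeasurable_exp _))
      ((boundedMeasurable_const _).mul (boundedMeasurable_exp _)), angleCoeff_const_mul,
      angleCoeff_const_mul, angleCoeff_exp, angleCoeff_exp, if_neg hne]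
    simp [hiff]
  cases b
  · have e : (fun x : ℝ => (trigBasis p (k, false) x : ℂ)) = fun x : ℝ =>
        ((√(2 * p k) : ℂ) * (-Complex.I / 2)) *
          Complex.exp ((((k : ℤ) + 1 : ℤ)) * x * Complex.I) +
        ((√(2 * p k) : ℂ) * (Complex.I / 2)) *
          Complex.exp (((-((k : ℤ) + 1) : ℤ)) * x * Complex.I) := by
      ext x
      simp only [trigBasis, Bool.false_eq_true, if_false]
      push_cast
      rw [Complex.sin]
      ring_nf
    rw [e, key]
    simp
  · have e : (fun x : ℝ => (trigBasis p (k, true) x : ℂ)) = fun x : ℝ =>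
        ((√(2 * p k) : ℂ) * (1 / 2)) *
          Complex.exp ((((k : ℤ) + 1 : ℤ)) * x * Complex.I) +
        ((√(2 * p k) : ℂ) * (1 / 2)) *
          Complex.exp (((-((k : ℤ) + 1) : ℤ)) * x * Complex.I) := by
      ext x
      simp only [trigBasis, if_true]
      push_cast
      rw [Complex.cos]
      ring_nf
    rw [e, key]
    simp

lemma boundedMeasurable_sum_trigBasis (p : ℕ → ℝ) {M : ℕ} (ω : Fin M × Bool → ℝ) :
    BoundedMeasurable fun x => ∑ i, ω i * trigBasis p i x :=
  BoundedMeasurable.finsetSum _ fun i =>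
    (boundedMeasurable_const _).mul (boundedMeasurable_trigBasis p i)

lemma angleCoeff_finsetSum {ι : Type*} (s : Finset ι) {φ : ι → ℝ → ℂ}
    (hφ : ∀ i, BoundedMeasurable (φ i)) (m : ℤ) :
    angleCoeff (fun x => ∑ i ∈ s, φ i x) m = ∑ i ∈ s, angleCoeff (φ i) m := by
  simp only [angleCoeff, Finset.sum_mul]
  exact integral_finsetSum _ fun i _ => ((hφ i).mul (boundedMeasurable_exp_neg m)).integrable

lemma angleCoeff_sum_trigBasis (p : ℕ → ℝ) {M : ℕ} (ω : Fin M × Bool → ℝ) (m : ℕ) :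
    angleCoeff (fun x => ((∑ i, ω i * trigBasis p i x : ℝ) : ℂ)) m =
      ∑ k : Fin M, if m = (k : ℕ) + 1 then
        (√(2 * p k) / 2 : ℂ) * (ω (k, true) - ω (k, false) * Complex.I) else 0 := by
  push_cast
  rw [angleCoeff_finsetSum _ fun i =>
    (boundedMeasurable_const _).mul (boundedMeasurable_trigBasis p i).ofReal]
  simp_rw [angleCoeff_const_mul, angleCoeff_trigBasis]
  rw [Fintype.sum_prod_type]
  refine Finset.sum_congr rfl fun k _ => ?_
  rw [Fintype.sum_bool]
  by_cases h : m = (k : ℕ) + 1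
  · simp only [h, if_true, Bool.false_eq_true, if_false]; ring
  · simp only [h, if_false]; ring

lemma integral_sum_trigBasis (p : ℕ → ℝ) {M : ℕ} (ω : Fin M × Bool → ℝ) :
    ∫ x, ∑ i, ω i * trigBasis p i x ∂uniformAngle = 0 := by
  have h := angleCoeff_sum_trigBasis p ω 0
  rw [Nat.cast_zero, angleCoeff_zero, integral_complex_ofReal] at h
  simpa using h

lemma fluctuationVariance_sum_trigBasis {p : ℕ → ℝ} (hp : ∀ k, 0 ≤ p k) (q : ℕ → ℝ) {M : ℕ}
    (ω : Fin M × Bool → ℝ) :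
    fluctuationVariance q (fun x => ∑ i, ω i * trigBasis p i x) =
      ∑ i : Fin M × Bool, p i.1 * q (i.1 + 1) * ω i ^ 2 := by
  have hcoef : ∀ m : ℕ, angleCoeff (fun x => ((∑ i, ω i * trigBasis p i x : ℝ) : ℂ)) ((m : ℤ) + 1) =
      ∑ k : Fin M, if m = (k : ℕ) then
        (√(2 * p k) / 2 : ℂ) * (ω (k, true) - ω (k, false) * Complex.I) else 0 := by
    intro m
    have := angleCoeff_sum_trigBasis p ω (m + 1)
    simpa using this
  rw [fluctuationVariance, tsum_eq_sum (s := Finset.range M), Finset.sum_range, Fintype.sum_prod_type]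
  · refine Finset.sum_congr rfl fun k _ => ?_
    rw [hcoef, Finset.sum_eq_single k, if_pos rfl, Fintype.sum_bool]
    · have h1 : (ω (k, true) - ω (k, false) * Complex.I : ℂ) =
          ((ω (k, true) : ℝ) : ℂ) + ((-ω (k, false) : ℝ) : ℂ) * Complex.I := by push_cast; ring
      have h2 : (√(2 * p k) / 2 : ℂ) = ((√(2 * p k) / 2 : ℝ) : ℂ) := by push_cast; rfl
      rw [h1, h2, norm_mul, mul_pow, Complex.sq_norm (_ + _), Complex.normSq_add_mul_I,
        Complex.norm_real, Real.norm_eq_abs, sq_abs, div_pow,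
        Real.sq_sqrt (mul_nonneg (by norm_num) (hp _))]
      ring
    · intro b _ hb
      rw [if_neg]
      exact fun h => hb (Fin.ext h.symm)
    · simp
  · intro m hm
    rw [hcoef, Finset.sum_eq_zero]
    · simp
    · intro k _
      rw [if_neg]
      intro h
      apply hm
      rw [h]; simp

end RandomTrigonometricPolynomial

lemma abs_exp_neg_sub_exp_neg_le {a b : ℝ} (ha : 0 ≤ a) (hb : 0 ≤ b) :
    |Real.exp (-a) - Real.exp (-b)| ≤ |a - b| := by
  wlog h : a ≤ b generalizing a b
  · rw [abs_sub_comm, abs_sub_comm a]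
    exact this hb ha (le_of_not_ge h)
  have h1 : Real.exp (-b) ≤ Real.exp (-a) := Real.exp_le_exp.2 (by linarith)
  rw [abs_of_nonneg (by linarith), abs_of_nonpos (by linarith)]
  have h2 : Real.exp (-b) = Real.exp (-a) * Real.exp (-(b - a)) := by
    rw [← Real.exp_add]; congr 1; ring
  have h3 : Real.exp (-a) ≤ 1 := Real.exp_le_one_iff.2 (by linarith)
  have h4 := Real.add_one_le_exp (-(b - a))
  have h5 := Real.exp_pos (-a)
  rw [h2]
  nlinarith

/-! ### Linearization of quadratic statistics. -/

section HubbardStratonovich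

variable {Q : ∀ N, Measure (Fin N → ℝ)} [∀ N, IsProbabilityMeasure (Q N)]

/-- For fixed `τ` the exponent is a linear form in the Gaussian vector, and its characteristic
function is the exponential of the quadratic statistic. Fubini lets the average over `τ` be taken
first, where the statistic is linear. -/
lemma integral_exp_neg_sum_powerSum (N : ℕ) {p : ℕ → ℝ} (hp : ∀ k, 0 ≤ p k) (M : ℕ) (s : ℝ) :
    Integrable (fun z : (Fin M × Bool → ℝ) × (Fin N → ℝ) =>
      Complex.exp (Complex.I * ((s * ∑ j, ∑ i, z.1 i * trigBasis p i (z.2 j) : ℝ) : ℂ)))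
      ((stdGaussianPi (Fin M × Bool)).prod (Q N)) ∧
    ∫ ω, ∫ τ, Complex.exp (Complex.I * ((s * ∑ j, ∑ i, ω i * trigBasis p i (τ j) : ℝ) : ℂ)) ∂(Q N)
      ∂(stdGaussianPi (Fin M × Bool)) =
    ((∫ τ, Real.exp (-(s ^ 2 / 2 * ∑ k : Fin M, 2 * p k * ‖powerSum ((k : ℤ) + 1) τ‖ ^ 2))
      ∂(Q N) : ℝ) : ℂ) := by
  have hint : Integrable (fun z : (Fin M × Bool → ℝ) × (Fin N → ℝ) =>
      Complex.exp (Complex.I * ((s * ∑ j, ∑ i, z.1 i * trigBasis p i (z.2 j) : ℝ) : ℂ)))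
      ((stdGaussianPi (Fin M × Bool)).prod (Q N)) := by
    refine (BoundedMeasurable.cexp_I_mul ?_).integrable
    refine (Finset.measurable_fun_sum _ fun j _ => Finset.measurable_fun_sum _ fun i _ => ?_).const_mul s
    exact ((measurable_pi_apply i).comp measurable_fst).mul
      ((boundedMeasurable_trigBasis p i).1.comp ((measurable_pi_apply j).comp measurable_snd))
  refine ⟨hint, ?_⟩
  rw [integral_integral_swap hint, ← integral_complex_ofReal]
  congr 1; ext τ
  have h := integral_exp_I_mul_stdGaussianPi (ι := Fin M × Bool)
    fun i => s * ∑ j, trigBasis p i (τ j)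
  have e1 : ∀ ω : Fin M × Bool → ℝ, ∑ i, ω i * (s * ∑ j, trigBasis p i (τ j)) =
      s * ∑ j, ∑ i, ω i * trigBasis p i (τ j) := by
    intro ω
    rw [Finset.sum_comm, Finset.mul_sum]
    refine Finset.sum_congr rfl fun i _ => ?_
    rw [Finset.mul_sum, Finset.mul_sum, Finset.mul_sum]
    exact Finset.sum_congr rfl fun j _ => by ring
  simp_rw [e1] at h
  rw [h]
  simp_rw [mul_pow, ← Finset.mul_sum, sum_sq_sum_trigBasis hp]
  congr 2
  ring

/-- Four errors: truncating the frequencies of the statistic and of the limiting variance (`2u/N`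
each), the linear central limit theorem averaged over the Gaussian polynomial, and the concentration
of the random variance. The choice `s = √(2u)/√N` gives `s²/2 = u/N`. -/
lemma abs_integral_exp_sub_le {N : ℕ} (hN : 1 ≤ N) {q : ℕ → ℝ} (hq0 : ∀ k, 0 ≤ q k)
    (hqN : ∀ k, q k ≤ N) {p : ℕ → ℝ} (hp0 : ∀ k, 0 ≤ p k) (hps : Summable p) {C : ℝ}
    (hpC : ∀ k, p k ≤ C / N) (hsum : ∑' k, p k ≤ C) {u ε : ℝ} (hu : 0 ≤ u)
    (hε : ∀ g : ℝ → ℝ, BoundedMeasurable g → ∫ x, g x ∂uniformAngle = 0 →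
      ‖∫ θ, Complex.exp (Complex.I * ((√(2 * u) / √N * ∑ j, g (θ j) : ℝ) : ℂ)) ∂(Q N) -
        ((Real.exp (-(√(2 * u) ^ 2 / (2 * N) * fluctuationVariance q g)) : ℝ) : ℂ)‖ ≤
        ε * (1 + ∫ x, g x ^ 4 ∂uniformAngle)) :
    |∫ τ, Real.exp (-(u / N * ∑' k : ℕ, 2 * p k * ‖powerSum ((k : ℤ) + 1) τ‖ ^ 2)) ∂(Q N) -
      Real.exp (-(u * ((∑' k, 2 * p k * q (k + 1)) / N)))| ≤
      4 * u / N + ε * (1 + 48 * Real.exp C) +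
        u * √(Var[fun x : ℝ => x ^ 2; gaussianReal 0 1] * (2 * C ^ 2 / N)) := by
  have hN1 : (1 : ℝ) ≤ N := by exact_mod_cast hN
  have hN0 : (0 : ℝ) < N := by linarith
  have hC0 : 0 ≤ C := (tsum_nonneg hp0).trans hsum
  -- The tail is this small because a squared power sum may be as large as `N²`.
  obtain ⟨M, hM⟩ : ∃ M : ℕ, ∑' k, p (k + M) ≤ 1 / (N : ℝ) ^ 2 := by
    have h := tendsto_sum_nat_add p
    have h1 : (0 : ℝ) < 1 / (N : ℝ) ^ 2 := by positivity
    exact ((h.eventually (gt_mem_nhds h1)).exists).imp fun M hM => hM.le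
  set V : (Fin N → ℝ) → ℝ := fun τ => ∑' k : ℕ, 2 * p k * ‖powerSum ((k : ℤ) + 1) τ‖ ^ 2 with hV
  set VM : (Fin N → ℝ) → ℝ := fun τ =>
    ∑ k : Fin M, 2 * p k * ‖powerSum ((k : ℤ) + 1) τ‖ ^ 2 with hVM
  have hterm : ∀ (k : ℕ) (τ : Fin N → ℝ), 2 * p k * ‖powerSum ((k : ℤ) + 1) τ‖ ^ 2 ≤
      p k * (2 * (N : ℝ) ^ 2) := by
    intro k τ
    have h1 := norm_powerSum_le ((k : ℤ) + 1) τ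
    have h2 : ‖powerSum ((k : ℤ) + 1) τ‖ ^ 2 ≤ (N : ℝ) ^ 2 := pow_le_pow_left₀ (norm_nonneg _) h1 2
    have h3 := hp0 k
    nlinarith
  have hterm0 : ∀ (k : ℕ) (τ : Fin N → ℝ), 0 ≤ 2 * p k * ‖powerSum ((k : ℤ) + 1) τ‖ ^ 2 :=
    fun k τ => mul_nonneg (mul_nonneg (by norm_num) (hp0 k)) (by positivity)
  have hVsum : ∀ τ : Fin N → ℝ, Summable fun k : ℕ => 2 * p k * ‖powerSum ((k : ℤ) + 1) τ‖ ^ 2 :=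
    fun τ => Summable.of_nonneg_of_le (fun k => hterm0 k τ) (fun k => hterm k τ) (hps.mul_right _)
  have hVnn : ∀ τ, 0 ≤ V τ := fun τ => tsum_nonneg fun k => hterm0 k τ
  have hVMnn : ∀ τ, 0 ≤ VM τ := fun τ => Finset.sum_nonneg fun k _ => hterm0 k τ
  have hps' : Summable fun k => p (k + M) := (summable_nat_add_iff M).2 hps
  have hVdiff : ∀ τ, |V τ - VM τ| ≤ 2 := by
    intro τ
    have h1 := (hVsum τ).sum_add_tsum_nat_add M
    rw [Finset.sum_range] at h1
    have h2 : V τ - VM τ = ∑' k : ℕ, 2 * p (k + M) * ‖powerSum (((k + M : ℕ) : ℤ) + 1) τ‖ ^ 2 := by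
      rw [hV, hVM]; linarith
    rw [h2, abs_of_nonneg (tsum_nonneg fun k => hterm0 (k + M) τ)]
    calc _ ≤ ∑' k, p (k + M) * (2 * (N : ℝ) ^ 2) :=
          ((summable_nat_add_iff M).2 (hVsum τ)).tsum_le_tsum (fun k => hterm (k + M) τ)
            (hps'.mul_right _)
      _ = (∑' k, p (k + M)) * (2 * (N : ℝ) ^ 2) := tsum_mul_right
      _ ≤ 1 / (N : ℝ) ^ 2 * (2 * (N : ℝ) ^ 2) := by gcongr
      _ = 2 := by field_simp
  have hVmeas : Measurable V := by
    refine Measurable.tsum fun k => ?_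
    exact (((measurable_powerSum _).norm).pow_const 2).const_mul _
  have hVMmeas : Measurable VM := by
    refine Finset.measurable_fun_sum _ fun k _ => ?_
    exact (((measurable_powerSum _).norm).pow_const 2).const_mul _
  have hbm : ∀ W : (Fin N → ℝ) → ℝ, Measurable W → (∀ τ, 0 ≤ W τ) →
      Integrable (fun τ => Real.exp (-(u / N * W τ))) (Q N) := by
    intro W hW hW0
    refine BoundedMeasurable.integrable ⟨by fun_prop, 1, fun τ => ?_⟩
    rw [Real.norm_of_nonneg (Real.exp_pos _).le]
    exact Real.exp_le_one_iff.2 (neg_nonpos.2 (mul_nonneg (by positivity) (hW0 τ)))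
  -- truncation of the quadratic statistic
  have hA : |∫ τ, Real.exp (-(u / N * V τ)) ∂(Q N) - ∫ τ, Real.exp (-(u / N * VM τ)) ∂(Q N)| ≤
      2 * u / N := by
    rw [← integral_sub (hbm V hVmeas hVnn) (hbm VM hVMmeas hVMnn)]
    have : ∀ τ, ‖Real.exp (-(u / N * V τ)) - Real.exp (-(u / N * VM τ))‖ ≤ 2 * u / N := by
      intro τ
      refine (abs_exp_neg_sub_exp_neg_le (mul_nonneg (by positivity) (hVnn τ))
        (mul_nonneg (by positivity) (hVMnn τ))).trans ?_
      rw [← mul_sub, abs_mul, abs_of_nonneg (show 0 ≤ u / N by positivity)]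
      calc _ ≤ u / N * 2 := by gcongr; exact hVdiff τ
        _ = _ := by ring
    simpa using norm_integral_le_of_norm_le_const (μ := Q N) (.of_forall this)
  set γ := stdGaussianPi (Fin M × Bool) with hγ
  set a : Fin M × Bool → ℝ := fun i => p i.1 * q (i.1 + 1) / N with ha
  have ha0 : ∀ i, 0 ≤ a i := fun i =>
    div_nonneg (mul_nonneg (hp0 _) (hq0 _)) hN0.le
  set X : (Fin M × Bool → ℝ) → ℝ := fun ω => ∑ i, a i * ω i ^ 2 with hX
  have hXnn : ∀ ω, 0 ≤ X ω := fun ω =>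
    Finset.sum_nonneg fun i _ => mul_nonneg (ha0 i) (sq_nonneg _)
  have hXint : Integrable (fun ω => Real.exp (-(u * X ω))) γ := by
    refine BoundedMeasurable.integrable ⟨by fun_prop, 1, fun τ => ?_⟩
    rw [Real.norm_of_nonneg (Real.exp_pos _).le]
    exact Real.exp_le_one_iff.2 (neg_nonpos.2 (mul_nonneg hu (hXnn τ)))
  -- linearization
  have hB : |∫ τ, Real.exp (-(u / N * VM τ)) ∂(Q N) - ∫ ω, Real.exp (-(u * X ω)) ∂γ| ≤
      ε * (1 + 48 * Real.exp C) := by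
    obtain ⟨hint, hHS⟩ := integral_exp_neg_sum_powerSum (Q := Q) N hp0 M (√(2 * u) / √N)
    have hs : (√(2 * u) / √(N : ℝ)) ^ 2 / 2 = u / N := by
      rw [div_pow, Real.sq_sqrt (by positivity), Real.sq_sqrt (by positivity)]; field_simp
    rw [hs] at hHS
    obtain ⟨h4i, h4⟩ := integral_integral_gaussian_pow_four_le (ι := Fin M × Bool)
      (fun i => trigBasis p i) (fun i => (boundedMeasurable_trigBasis p i).1)
      (∑ k : Fin M, 2 * p k) (sum_sq_trigBasis hp0 M)
    have hW : (∑ k : Fin M, 2 * p k) / 2 ≤ C := by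
      rw [← Finset.mul_sum, mul_div_cancel_left₀ _ (by norm_num), ← Finset.sum_range (fun k => p k)]
      exact (hps.sum_le_tsum _ fun k _ => hp0 k).trans hsum
    have hΦ : Integrable (fun ω => ∫ τ, Complex.exp (Complex.I *
        ((√(2 * u) / √N * ∑ j, ∑ i, ω i * trigBasis p i (τ j) : ℝ) : ℂ)) ∂(Q N)) γ :=
      hint.integral_prod_left
    -- The test function `g = 0` reduces the bound to `0 ≤ ε`.
    have hε0 : 0 ≤ ε := by
      have h := hε (fun _ => 0) (boundedMeasurable_const 0) (by simp)
      simp only [ne_eq, OfNat.ofNat_ne_zero, not_false_eq_true, zero_pow, integral_zero, add_zero,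
        mul_one] at h
      exact (norm_nonneg _).trans h
    have hpt : ∀ ω : Fin M × Bool → ℝ,
        ‖∫ τ, Complex.exp (Complex.I *
          ((√(2 * u) / √N * ∑ j, ∑ i, ω i * trigBasis p i (τ j) : ℝ) : ℂ)) ∂(Q N) -
          ((Real.exp (-(u * X ω)) : ℝ) : ℂ)‖ ≤
        ε * (1 + ∫ x, (∑ i, ω i * trigBasis p i x) ^ 4 ∂uniformAngle) := by
      intro ω
      have h := hε _ (boundedMeasurable_sum_trigBasis p ω) (integral_sum_trigBasis p ω)
      rw [fluctuationVariance_sum_trigBasis hp0] at h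
      have e : √(2 * u) ^ 2 / (2 * N) * ∑ i : Fin M × Bool, p i.1 * q (i.1 + 1) * ω i ^ 2 =
          u * X ω := by
        rw [Real.sq_sqrt (by positivity), hX, Finset.mul_sum, Finset.mul_sum]
        refine Finset.sum_congr rfl fun i _ => ?_
        rw [ha]; field_simp
      rw [e] at h
      exact h
    have e1 : ((∫ τ, Real.exp (-(u / N * VM τ)) ∂(Q N) - ∫ ω, Real.exp (-(u * X ω)) ∂γ : ℝ) : ℂ) =
        ∫ ω, (∫ τ, Complex.exp (Complex.I *
          ((√(2 * u) / √N * ∑ j, ∑ i, ω i * trigBasis p i (τ j) : ℝ) : ℂ)) ∂(Q N) -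
          ((Real.exp (-(u * X ω)) : ℝ) : ℂ)) ∂γ := by
      have hXc : Integrable (fun ω => ((Real.exp (-(u * X ω)) : ℝ) : ℂ)) γ := hXint.ofReal
      rw [integral_sub hΦ hXc, hHS, integral_complex_ofReal]
      push_cast; rfl
    rw [← Real.norm_eq_abs, ← Complex.norm_real, e1]
    calc _ ≤ ∫ ω, ε * (1 + ∫ x, (∑ i, ω i * trigBasis p i x) ^ 4 ∂uniformAngle) ∂γ :=
          norm_integral_le_of_norm_le (((integrable_const 1).add h4i).const_mul ε)
            (.of_forall hpt)
      _ = ε * (1 + ∫ ω, ∫ x, (∑ i, ω i * trigBasis p i x) ^ 4 ∂uniformAngle ∂γ) := by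
          rw [integral_const_mul, integral_add (integrable_const 1) h4i, integral_const,
            probReal_univ, one_smul]
      _ ≤ _ := by
          refine mul_le_mul_of_nonneg_left ?_ hε0
          have := Real.exp_le_exp.2 hW
          linarith
  -- concentration of the random variance
  have hasum : ∑ i, a i = (∑ k ∈ Finset.range M, 2 * p k * q (k + 1)) / N := by
    rw [Finset.sum_range, Fintype.sum_prod_type, Finset.sum_div]
    refine Finset.sum_congr rfl fun k _ => ?_
    rw [ha, Fintype.sum_bool]; ring
  -- No single weight dominates: each is `O(1/N)` and their total is bounded. This is what makes the
  -- chi-square sum concentrate.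
  have hasq : ∑ i, a i ^ 2 ≤ 2 * C ^ 2 / N := by
    have h1 : ∀ i : Fin M × Bool, a i ^ 2 ≤ C / N * p i.1 := by
      intro i
      have h2 : a i ≤ p i.1 := by
        rw [ha, div_le_iff₀ hN0]
        exact mul_le_mul_of_nonneg_left (hqN _) (hp0 _)
      calc a i ^ 2 ≤ p i.1 ^ 2 := pow_le_pow_left₀ (ha0 i) h2 2
        _ = p i.1 * p i.1 := sq _
        _ ≤ _ := mul_le_mul_of_nonneg_right (hpC _) (hp0 _)
    calc ∑ i, a i ^ 2 ≤ ∑ i : Fin M × Bool, C / N * p i.1 := Finset.sum_le_sum fun i _ => h1 i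
      _ = C / N * (2 * ∑ k ∈ Finset.range M, p k) := by
        rw [← Finset.mul_sum, Fintype.sum_prod_type, Finset.sum_range]
        congr 1
        rw [Finset.mul_sum]
        refine Finset.sum_congr rfl fun k _ => ?_
        rw [Fintype.sum_bool]; ring
      _ ≤ C / N * (2 * C) := by
        gcongr
        exact (hps.sum_le_tsum _ fun k _ => hp0 k).trans hsum
      _ = _ := by ring
  have hCc : |∫ ω, Real.exp (-(u * X ω)) ∂γ - Real.exp (-(u * ∑ i, a i))| ≤
      u * √(Var[fun x : ℝ => x ^ 2; gaussianReal 0 1] * (2 * C ^ 2 / N)) := by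
    have e1 : Real.exp (-(u * ∑ i, a i)) = ∫ _ω, Real.exp (-(u * ∑ i, a i)) ∂γ := by simp
    rw [e1, ← integral_sub hXint (integrable_const _)]
    have habs : Integrable (fun ω => u * |X ω - ∑ i, a i|) γ :=
      (((integrable_sum_sq_stdGaussianPi a).sub (integrable_const _)).abs).const_mul u
    calc _ ≤ ∫ ω, u * |X ω - ∑ i, a i| ∂γ := by
          rw [← Real.norm_eq_abs]
          refine norm_integral_le_of_norm_le habs (.of_forall fun ω => ?_)
          refine (abs_exp_neg_sub_exp_neg_le (mul_nonneg hu (hXnn ω))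
            (mul_nonneg hu (Finset.sum_nonneg fun i _ => ha0 i))).trans (le_of_eq ?_)
          rw [← mul_sub, abs_mul, abs_of_nonneg hu]
      _ = u * ∫ ω, |X ω - ∑ i, a i| ∂γ := integral_const_mul _ _
      _ ≤ _ := by
          refine mul_le_mul_of_nonneg_left ((integral_abs_sum_sq_sub_le a).trans
            (Real.sqrt_le_sqrt ?_)) hu
          exact mul_le_mul_of_nonneg_left hasq (variance_nonneg _ _)
  have hqterm : ∀ k, 2 * p k * q (k + 1) ≤ p k * (2 * N) := fun k => by
    have := mul_le_mul_of_nonneg_left (hqN (k + 1)) (hp0 k)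
    linarith
  have hqterm0 : ∀ k, 0 ≤ 2 * p k * q (k + 1) := fun k =>
    mul_nonneg (mul_nonneg (by norm_num) (hp0 k)) (hq0 _)
  have hpq : Summable fun k => 2 * p k * q (k + 1) :=
    Summable.of_nonneg_of_le hqterm0 hqterm (hps.mul_right _)
  have hD : |Real.exp (-(u * ∑ i, a i)) - Real.exp (-(u * ((∑' k, 2 * p k * q (k + 1)) / N)))| ≤
      2 * u / N := by
    refine (abs_exp_neg_sub_exp_neg_le (mul_nonneg hu (Finset.sum_nonneg fun i _ => ha0 i))
      (mul_nonneg hu (div_nonneg (tsum_nonneg hqterm0) hN0.le))).trans ?_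
    rw [← mul_sub, abs_mul, abs_of_nonneg hu, hasum, ← sub_div, ← hpq.sum_add_tsum_nat_add M,
      sub_add_cancel_left, abs_div, abs_neg, abs_of_nonneg (tsum_nonneg fun k => hqterm0 (k + M)),
      abs_of_pos hN0]
    have h1 : ∑' k, 2 * p (k + M) * q (k + M + 1) ≤ 2 := by
      calc _ ≤ ∑' k, p (k + M) * (2 * N) :=
            ((summable_nat_add_iff M).2 hpq).tsum_le_tsum (fun k => hqterm (k + M))
              (hps'.mul_right _)
        _ = (∑' k, p (k + M)) * (2 * N) := tsum_mul_right
        _ ≤ 1 / (N : ℝ) ^ 2 * (2 * N) := by gcongr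
        _ = 2 / N := by field_simp
        _ ≤ 2 := div_le_self (by norm_num) hN1
    calc _ ≤ u * (2 / N) := by gcongr
      _ = _ := by ring
  have htri : ∀ w x y z v : ℝ, |w - v| ≤ |w - x| + |x - y| + |y - z| + |z - v| := fun w x y z v => by
    linarith [abs_sub_le w x v, abs_sub_le x y v, abs_sub_le y z v]
  refine (htri _ _ _ _ _).trans ((add_le_add (add_le_add (add_le_add hA hB) hCc) hD).trans
    (le_of_eq ?_))
  ring

/-- Quadratic statistics of a point process satisfying the linear central limit theorem have
deterministic limits. -/
theorem HasLinearGaussianLimit.tendsto_integral_exp {q : ℕ → ℕ → ℝ}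
    (hQ : HasLinearGaussianLimit Q q) (hq0 : ∀ N k, 0 ≤ q N k) (hqN : ∀ N k, q N k ≤ N)
    {p : ℕ → ℕ → ℝ} (hp0 : ∀ N k, 0 ≤ p N k) (hps : ∀ N, Summable (p N)) {C : ℝ}
    (hpC : ∀ᶠ N : ℕ in atTop, ∀ k, p N k ≤ C / N) (hsum : ∀ᶠ N : ℕ in atTop, ∑' k, p N k ≤ C)
    {σ2 : ℝ} (hσ : Tendsto (fun N : ℕ => (∑' k, 2 * p N k * q N (k + 1)) / N) atTop (𝓝 σ2))
    {u : ℝ} (hu : 0 ≤ u) :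
    Tendsto (fun N : ℕ => ∫ τ, Real.exp (-(u / N *
      ∑' k : ℕ, 2 * p N k * ‖powerSum ((k : ℤ) + 1) τ‖ ^ 2)) ∂(Q N)) atTop
      (𝓝 (Real.exp (-(u * σ2)))) := by
  obtain ⟨ε, hε0, hε⟩ := hQ (√(2 * u))
  have h1 : Tendsto (fun N : ℕ => Real.exp (-(u * ((∑' k, 2 * p N k * q N (k + 1)) / N)))) atTop
      (𝓝 (Real.exp (-(u * σ2)))) :=
    (Real.continuous_exp.tendsto _).comp (hσ.const_mul u).neg
  have hinv : Tendsto (fun N : ℕ => (N : ℝ)⁻¹) atTop (𝓝 0) :=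
    tendsto_inv_atTop_zero.comp tendsto_natCast_atTop_atTop
  have hbound : Tendsto (fun N : ℕ => 4 * u / N + ε N * (1 + 48 * Real.exp C) +
        u * √(Var[fun x : ℝ => x ^ 2; gaussianReal 0 1] * (2 * C ^ 2 / N))) atTop (𝓝 0) := by
    have a1 : Tendsto (fun N : ℕ => 4 * u / (N : ℝ)) atTop (𝓝 0) := by
      simpa [div_eq_mul_inv] using hinv.const_mul (4 * u)
    have a2 := hε0.mul_const (1 + 48 * Real.exp C)
    have a3 : Tendsto (fun N : ℕ =>
        u * √(Var[fun x : ℝ => x ^ 2; gaussianReal 0 1] * (2 * C ^ 2 / N))) atTop (𝓝 0) := by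
      have b1 : Tendsto (fun N : ℕ =>
          Var[fun x : ℝ => x ^ 2; gaussianReal 0 1] * (2 * C ^ 2 / N)) atTop (𝓝 0) := by
        have b2 := hinv.const_mul (Var[fun x : ℝ => x ^ 2; gaussianReal 0 1] * (2 * C ^ 2))
        rw [mul_zero] at b2
        exact b2.congr fun N => by rw [div_eq_mul_inv]; ring
      simpa using ((Real.continuous_sqrt.tendsto _).comp b1).const_mul u
    simpa using (a1.add a2).add a3
  have h2 : Tendsto (fun N : ℕ => ∫ τ, Real.exp (-(u / N *
      ∑' k : ℕ, 2 * p N k * ‖powerSum ((k : ℤ) + 1) τ‖ ^ 2)) ∂(Q N) -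
      Real.exp (-(u * ((∑' k, 2 * p N k * q N (k + 1)) / N)))) atTop (𝓝 0) := by
    refine squeeze_zero_norm' ?_ hbound
    filter_upwards [hpC, hsum, eventually_ge_atTop 1] with N h3 h4 hN
    exact abs_integral_exp_sub_le hN (hq0 N) (hqN N) (hp0 N) (hps N) h3 h4 hu (hε N hN)
  simpa using h2.add h1

end HubbardStratonovich

/-! ### The periodized test function and its Fourier coefficients. -/

section PeriodicScale

lemma integral_uniformAngle {E : Type*} [NormedAddCommGroup E] [NormedSpace ℝ E] (F : ℝ → E) :
    ∫ x, F x ∂uniformAngle = (1 / (2 * Real.pi)) • ∫ x in (0 : ℝ)..(2 * Real.pi), F x := by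
  have h2 : (0 : ℝ) < 2 * Real.pi := Real.two_pi_pos
  rw [uniformAngle, integral_smul_measure, ENNReal.toReal_ofReal (by positivity),
    intervalIntegral.integral_of_le h2.le, integral_Ico_eq_integral_Ioc]

lemma Function.Periodic.integral_uniformAngle_sub_left {E : Type*} [NormedAddCommGroup E]
    [NormedSpace ℝ E] {F : ℝ → E} (hF : Function.Periodic F (2 * Real.pi)) (a : ℝ) :
    ∫ x, F (a - x) ∂uniformAngle = (1 / (2 * Real.pi)) • ∫ x in (-Real.pi)..Real.pi, F x := by
  have h := hF.intervalIntegral_add_eq (a - 2 * Real.pi) (-Real.pi)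
  rw [integral_uniformAngle, intervalIntegral.integral_comp_sub_left, sub_zero]
  rw [sub_add_cancel, show -Real.pi + 2 * Real.pi = Real.pi by ring] at h
  rw [h]

lemma Function.Periodic.integral_uniformAngle_sub_right {E : Type*} [NormedAddCommGroup E]
    [NormedSpace ℝ E] {F : ℝ → E} (hF : Function.Periodic F (2 * Real.pi)) (a : ℝ) :
    ∫ x, F (x - a) ∂uniformAngle = (1 / (2 * Real.pi)) • ∫ x in (-Real.pi)..Real.pi, F x := by
  have h := hF.intervalIntegral_add_eq (-a) (-Real.pi)
  rw [integral_uniformAngle, intervalIntegral.integral_comp_sub_right, zero_sub]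
  rw [show -Real.pi + 2 * Real.pi = Real.pi by ring, neg_add_eq_sub] at h
  rw [h]

variable {f : ℝ → ℝ}

lemma periodic_periodicScale (f : ℝ → ℝ) (L : ℝ) :
    Function.Periodic (periodicScale f L) (2 * Real.pi) := by
  intro x
  rw [periodicScale, toIcoMod_add_right, periodicScale]

lemma measurable_periodicScale (hf : Measurable f) (L : ℝ) : Measurable (periodicScale f L) := by
  have h : periodicScale f L = fun x =>
      f (L * (-Real.pi + Int.fract ((x - -Real.pi) / (2 * Real.pi)) * (2 * Real.pi))) := by
    ext x
    rw [periodicScale, toIcoMod_eq_add_fract_mul]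
  rw [h]
  fun_prop

lemma BoundedMeasurable.periodicScale (hf : BoundedMeasurable f) (L : ℝ) :
    BoundedMeasurable (periodicScale f L) := by
  obtain ⟨C, hC⟩ := hf.2
  exact ⟨measurable_periodicScale hf.1 L, C, fun x => hC _⟩

lemma BoundedMeasurable.comp_measurable {α β E : Type*} [MeasurableSpace α] [MeasurableSpace β]
    [NormedAddCommGroup E] [MeasurableSpace E] {φ : α → E} (h : BoundedMeasurable φ) {ψ : β → α}
    (hψ : Measurable ψ) : BoundedMeasurable fun x => φ (ψ x) := by
  obtain ⟨C, hC⟩ := h.2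
  exact ⟨h.1.comp hψ, C, fun x => hC _⟩

/-- Integrals of the periodization over a period. -/
lemma integral_periodicScale_mul {N : ℕ} (hN : 1 ≤ N)
    (hsupp : Function.support f ⊆ Set.Icc (-(Real.pi * N)) (Real.pi * N)) (w : ℝ → ℂ) :
    ∫ y in (-Real.pi)..Real.pi, (periodicScale f N y : ℂ) * w (N * y) =
      (1 / N : ℝ) • ∫ x, (f x : ℂ) * w x := by
  have hN0 : (0 : ℝ) < N := by exact_mod_cast hN
  have hpi := Real.pi_pos
  have h1 : ∫ y in (-Real.pi)..Real.pi, (periodicScale f N y : ℂ) * w (N * y) =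
      ∫ y in (-Real.pi)..Real.pi, (fun x => (f x : ℂ) * w x) (N * y) := by
    refine intervalIntegral.integral_congr_Ioo_of_le (by linarith) fun y hy => ?_
    have : toIcoMod Real.two_pi_pos (-Real.pi) y = y := by
      rw [toIcoMod_eq_self]
      exact ⟨hy.1.le, by linarith [hy.2]⟩
    simp only [periodicScale, this]
  rw [h1, intervalIntegral.integral_comp_mul_left (fun x => (f x : ℂ) * w x) hN0.ne', one_div]
  congr 1
  rw [intervalIntegral.integral_of_le (by nlinarith), ← integral_Icc_eq_integral_Ioc]
  refine setIntegral_eq_integral_of_forall_compl_eq_zero fun x hx => ?_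
  have : f x = 0 := by
    by_contra hne
    apply hx
    have := hsupp hne
    rw [mul_neg, mul_comm (N : ℝ)]
    exact this
  simp [this]

lemma integral_periodicScale_sub {N : ℕ} (hN : 1 ≤ N)
    (hsupp : Function.support f ⊆ Set.Icc (-(Real.pi * N)) (Real.pi * N)) (a : ℝ) :
    ∫ x, periodicScale f N (a - x) ∂uniformAngle = 1 / (2 * Real.pi * N) * ∫ x, f x ∧
    ∫ x, periodicScale f N (x - a) ∂uniformAngle = 1 / (2 * Real.pi * N) * ∫ x, f x := by
  have h := integral_periodicScale_mul hN hsupp fun _ => 1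
  simp only [mul_one] at h
  rw [intervalIntegral.integral_ofReal, integral_complex_ofReal, Complex.real_smul] at h
  have h' : ∫ y in (-Real.pi)..Real.pi, periodicScale f N y = 1 / N * ∫ x, f x := by
    exact_mod_cast h
  have hp := periodic_periodicScale f N
  rw [hp.integral_uniformAngle_sub_left, hp.integral_uniformAngle_sub_right, h', smul_eq_mul]
  have hN0 : (N : ℝ) ≠ 0 := by positivity
  have hpi := Real.pi_ne_zero
  constructor <;> field_simp

/-- Translation gives the phase, dilation by `N` gives the frequency `m/N` and a factor `1/N`, and
the reflection `x ↦ a - x` flips the sign. The support condition lets the integral over one period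
be taken over the whole line. -/
lemma angleCoeff_periodicScale {N : ℕ} (hN : 1 ≤ N)
    (hsupp : Function.support f ⊆ Set.Icc (-(Real.pi * N)) (Real.pi * N)) (a : ℝ) (m : ℤ) :
    angleCoeff (fun x => (periodicScale f N (a - x) : ℂ)) m =
      Complex.exp (-(m * a * Complex.I)) *
        (fourierHat f (-(m / N)) / ((√(2 * Real.pi) * N : ℝ) : ℂ)) := by
  have hN0 : (N : ℝ) ≠ 0 := by positivity
  have hNc : (N : ℂ) ≠ 0 := by exact_mod_cast hN0
  set F : ℝ → ℂ := fun y => (periodicScale f N y : ℂ) * Complex.exp (m * y * Complex.I) with hF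
  have hFp : Function.Periodic F (2 * Real.pi) := by
    intro y
    simp only [hF]
    rw [periodic_periodicScale f N y]
    congr 1
    have : (m * ((y + 2 * Real.pi : ℝ) : ℂ) * Complex.I : ℂ) =
        m * y * Complex.I + m * (2 * Real.pi * Complex.I) := by push_cast; ring
    rw [this, Complex.exp_periodic.int_mul m]
  have h1 : angleCoeff (fun x => (periodicScale f N (a - x) : ℂ)) m =
      Complex.exp (-(m * a * Complex.I)) * ∫ x, F (a - x) ∂uniformAngle := by
    rw [angleCoeff, ← integral_const_mul]
    congr 1; ext x
    simp only [hF]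
    rw [mul_left_comm, ← Complex.exp_add]
    congr 2
    push_cast; ring
  have h2 := integral_periodicScale_mul hN hsupp fun x => Complex.exp ((m / N : ℝ) * x * Complex.I)
  have h3 : ∀ y : ℝ, (periodicScale f N y : ℂ) *
      Complex.exp ((m / N : ℝ) * ((N * y : ℝ) : ℂ) * Complex.I) = F y := by
    intro y
    simp only [hF]
    congr 2
    push_cast
    field_simp
  simp_rw [h3] at h2
  rw [h1, hFp.integral_uniformAngle_sub_left, h2, fourierHat]
  congr 1
  have h4 : ∀ x : ℝ, (f x : ℂ) * Complex.exp ((m / N : ℝ) * x * Complex.I) =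
      (f x : ℂ) * Complex.exp (-Complex.I * ((-(m / N) : ℝ) : ℂ) * x) := by
    intro x
    congr 2
    push_cast; ring
  simp_rw [h4]
  have h5 : ((√(2 * Real.pi) : ℝ) : ℂ) ^ 2 = 2 * Real.pi := by
    rw [← Complex.ofReal_pow, Real.sq_sqrt Real.two_pi_pos.le]; push_cast; rfl
  have h6 : ((√(2 * Real.pi) : ℝ) : ℂ) ≠ 0 := by
    exact_mod_cast (Real.sqrt_pos.2 Real.two_pi_pos).ne'
  have hpi : (Real.pi : ℂ) ≠ 0 := by exact_mod_cast Real.pi_ne_zero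
  rw [Complex.real_smul, Complex.real_smul]
  push_cast
  rw [← h5]
  field_simp

lemma norm_fourierHat_neg (f : ℝ → ℝ) (t : ℝ) : ‖fourierHat f (-t)‖ = ‖fourierHat f t‖ := by
  have h : fourierHat f (-t) = (starRingEnd ℂ) (fourierHat f t) := by
    rw [fourierHat, fourierHat, map_mul, ← integral_conj]
    congr 1
    · simp
    · congr 1; ext x
      rw [map_mul, Complex.conj_ofReal, ← Complex.exp_conj]
      simp
  rw [h, RCLike.norm_conj]

end PeriodicScale

/-! ### The bipartite statistic as a linear statistic given `τ`. -/

section ConditionalLinearStatistic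

/-- The centered function of `x` whose sum over the points `θ_j` gives the fluctuation of the
bipartite statistic. -/
noncomputable def bipartiteTest (f : ℝ → ℝ) {N : ℕ} (τ : Fin N → ℝ) (x : ℝ) : ℝ :=
  ∑ i, periodicScale f N (τ i - x) - 1 / (2 * Real.pi) * ∫ y, f y

variable {f : ℝ → ℝ} {N : ℕ}

lemma boundedMeasurable_bipartiteTest (hf : BoundedMeasurable f) (τ : Fin N → ℝ) :
    BoundedMeasurable (bipartiteTest f τ) :=
  (BoundedMeasurable.finsetSum _ fun _ =>
    (hf.periodicScale N).comp_measurable (measurable_const.sub measurable_id)).sub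
    (boundedMeasurable_const _)

lemma boundedMeasurable_bipartiteTest_uncurry (hf : BoundedMeasurable f) :
    BoundedMeasurable fun z : (Fin N → ℝ) × ℝ => bipartiteTest f z.1 z.2 :=
  (BoundedMeasurable.finsetSum _ fun i =>
    (hf.periodicScale N).comp_measurable
      (((measurable_pi_apply i).comp measurable_fst).sub measurable_snd)).sub
    (boundedMeasurable_const _)

lemma boundedMeasurable_localBipartite (hf : BoundedMeasurable f) :
    BoundedMeasurable fun z : (Fin N → ℝ) × (Fin N → ℝ) => localBipartite f z.1 z.2 :=
  BoundedMeasurable.finsetSum _ fun i => BoundedMeasurable.finsetSum _ fun j =>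
    (hf.periodicScale N).comp_measurable
      (((measurable_pi_apply i).comp measurable_fst).sub
        ((measurable_pi_apply j).comp measurable_snd))

lemma localBipartite_eq (f : ℝ → ℝ) (τ θ : Fin N → ℝ) :
    localBipartite f τ θ - N / (2 * Real.pi) * ∫ y, f y = ∑ j, bipartiteTest f τ (θ j) := by
  simp only [bipartiteTest, localBipartite, Finset.sum_sub_distrib, Finset.sum_const,
    Finset.card_univ, Fintype.card_fin, nsmul_eq_mul]
  rw [Finset.sum_comm]
  ring

variable (hN : 1 ≤ N) (hsupp : Function.support f ⊆ Set.Icc (-(Real.pi * N)) (Real.pi * N))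

include hN hsupp in
lemma integral_bipartiteTest (hf : BoundedMeasurable f) (τ : Fin N → ℝ) :
    ∫ x, bipartiteTest f τ x ∂uniformAngle = 0 := by
  have hb : ∀ i, BoundedMeasurable fun x => periodicScale f N (τ i - x) := fun i =>
    (hf.periodicScale N).comp_measurable (measurable_const.sub measurable_id)
  simp only [bipartiteTest]
  rw [integral_sub (BoundedMeasurable.finsetSum _ hb).integrable (integrable_const _),
    integral_finsetSum _ fun i _ => (hb i).integrable]
  simp_rw [fun i => (integral_periodicScale_sub hN hsupp (τ i)).1]
  simp only [Finset.sum_const, Finset.card_univ, Fintype.card_fin, nsmul_eq_mul, integral_const,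
    probReal_univ, smul_eq_mul]
  have hN0 : (N : ℝ) ≠ 0 := by positivity
  have hpi := Real.pi_ne_zero
  field_simp
  ring

include hN hsupp in
-- The translation phases sum to the conjugate power sum of `τ`, and the constant does not affect
-- nonzero frequencies. So the conditional variance is a quadratic statistic of `τ`.
lemma norm_sq_angleCoeff_bipartiteTest (hf : BoundedMeasurable f) (τ : Fin N → ℝ) (k : ℕ) :
    ‖angleCoeff (fun x => (bipartiteTest f τ x : ℂ)) ((k : ℤ) + 1)‖ ^ 2 =
      ‖fourierHat f (((k : ℝ) + 1) / N)‖ ^ 2 / (2 * Real.pi * (N : ℝ) ^ 2) *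
        ‖powerSum ((k : ℤ) + 1) τ‖ ^ 2 := by
  have hb : ∀ i, BoundedMeasurable fun x => (periodicScale f N (τ i - x) : ℂ) := fun i =>
    ((hf.periodicScale N).comp_measurable (measurable_const.sub measurable_id)).ofReal
  have hk : ¬ ((k : ℤ) + 1 = 0) := by omega
  have h1 : angleCoeff (fun x => (bipartiteTest f τ x : ℂ)) ((k : ℤ) + 1) =
      ∑ i, angleCoeff (fun x => (periodicScale f N (τ i - x) : ℂ)) ((k : ℤ) + 1) := by
    have e : ∀ x, (bipartiteTest f τ x : ℂ) = ∑ i, (periodicScale f N (τ i - x) : ℂ) +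
        ((-(1 / (2 * Real.pi) * ∫ y, f y) : ℝ) : ℂ) * 1 := fun x => by
      simp only [bipartiteTest]; push_cast; ring
    simp_rw [e]
    rw [angleCoeff_add (BoundedMeasurable.finsetSum _ hb) (boundedMeasurable_const _),
      angleCoeff_finsetSum _ hb, angleCoeff_const_mul, angleCoeff_one, if_neg hk, mul_zero, add_zero]
  have h2 : ∑ i, Complex.exp (-((((k : ℤ) + 1 : ℤ)) * τ i * Complex.I)) =
      (starRingEnd ℂ) (powerSum ((k : ℤ) + 1) τ) := by
    rw [powerSum, map_sum]
    refine Finset.sum_congr rfl fun i _ => ?_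
    rw [← Complex.exp_conj]
    simp
  rw [h1]
  simp_rw [angleCoeff_periodicScale hN hsupp]
  rw [← Finset.sum_mul, h2, norm_mul, RCLike.norm_conj, norm_div, norm_fourierHat_neg,
    Complex.norm_real, Real.norm_of_nonneg (by positivity), mul_pow, div_pow, mul_pow,
    Real.sq_sqrt Real.two_pi_pos.le]
  push_cast
  ring

/-- The weights of the conditional variance of the bipartite statistic. -/
noncomputable def bipartiteWeight (f : ℝ → ℝ) (N k : ℕ) : ℝ :=
  ‖fourierHat f (((k : ℝ) + 1) / N)‖ ^ 2 / (2 * Real.pi * (N : ℝ) ^ 2) * min ((k : ℝ) + 1) N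

lemma bipartiteWeight_nonneg (f : ℝ → ℝ) (N k : ℕ) : 0 ≤ bipartiteWeight f N k := by
  unfold bipartiteWeight
  have := Real.pi_pos
  positivity

include hN hsupp in
lemma fluctuationVariance_bipartiteTest (hf : BoundedMeasurable f) (τ : Fin N → ℝ) :
    fluctuationVariance (fun k => min (k : ℝ) N) (bipartiteTest f τ) =
      ∑' k : ℕ, 2 * bipartiteWeight f N k * ‖powerSum ((k : ℤ) + 1) τ‖ ^ 2 := by
  rw [fluctuationVariance]
  refine tsum_congr fun k => ?_
  rw [norm_sq_angleCoeff_bipartiteTest hN hsupp hf, bipartiteWeight]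
  push_cast
  ring

end ConditionalLinearStatistic

lemma BoundedMeasurable.integrable_integral {α β E : Type*} [MeasurableSpace α] [MeasurableSpace β]
    [NormedAddCommGroup E] [NormedSpace ℝ E] [MeasurableSpace E] [BorelSpace E]
    [SecondCountableTopology E] {φ : α × β → E} (h : BoundedMeasurable φ) {μ : Measure α}
    [IsFiniteMeasure μ] {ν : Measure β} [IsFiniteMeasure ν] :
    Integrable (fun a => ∫ b, φ (a, b) ∂ν) μ :=
  (h.integrable (μ := μ.prod ν)).integral_prod_left

/-! ### From conditional to unconditional Gaussian limits. -/

section Annealing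

variable {f : ℝ → ℝ} {Q : ∀ N, Measure (Fin N → ℝ)} [∀ N, IsProbabilityMeasure (Q N)]

/-- The annealed mean of the bipartite statistic. -/
lemma integral_localBipartite_prod {N : ℕ} (hf : BoundedMeasurable f)
    (hsupp : Function.support f ⊆ Set.Icc (-(Real.pi * N)) (Real.pi * N)) :
    ∫ z, localBipartite f z.1 z.2 ∂((Q N).prod (circularUnitaryEnsemble N)) =
      N / (2 * Real.pi) * ∫ x, f x := by
  rcases Nat.eq_zero_or_pos N with rfl | hN
  · simp [localBipartite]
  rw [integral_prod _ (boundedMeasurable_localBipartite hf).integrable]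
  have h : ∀ τ : Fin N → ℝ, ∫ θ, localBipartite f τ θ ∂(circularUnitaryEnsemble N) =
      N / (2 * Real.pi) * ∫ x, f x := by
    intro τ
    have hb := boundedMeasurable_bipartiteTest hf τ
    have e : ∀ θ : Fin N → ℝ, localBipartite f τ θ =
        ∑ j, bipartiteTest f τ (θ j) + N / (2 * Real.pi) * ∫ x, f x := fun θ => by
      rw [← localBipartite_eq]; ring
    simp_rw [e]
    have hj : ∀ j, BoundedMeasurable fun θ : Fin N → ℝ => bipartiteTest f τ (θ j) := fun j =>
      hb.comp_measurable (measurable_pi_apply j)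
    rw [integral_add (BoundedMeasurable.finsetSum _ hj).integrable (integrable_const _),
      integral_finsetSum _ fun j _ => (hj j).integrable]
    have h0 : ∀ j, ∫ θ, bipartiteTest f τ (θ j) ∂(circularUnitaryEnsemble N) = 0 := by
      intro j
      have h1 := integral_eval_circularUnitaryEnsemble N j (fun x => (bipartiteTest f τ x : ℂ))
        hb.ofReal.integrable
      rw [integral_complex_ofReal, integral_complex_ofReal, integral_bipartiteTest hN hsupp hf] at h1
      exact_mod_cast h1
    simp [h0]
  simp_rw [h]
  simp

lemma measurable_sum_bipartiteTest {N : ℕ} (hf : BoundedMeasurable f) :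
    Measurable fun z : (Fin N → ℝ) × (Fin N → ℝ) => ∑ j, bipartiteTest f z.1 (z.2 j) := by
  simp_rw [← localBipartite_eq]
  exact (boundedMeasurable_localBipartite hf).1.sub_const _

/-- Integrate the conditional central limit theorem over `τ`. The main term is the Laplace transform
of the conditional variance at `u = t²/2`, and the bound on the mean fourth moment makes the
integrated error at most `|ε N| (1 + K)`. -/
lemma tendsto_integral_exp_bipartiteTest (hf : BoundedMeasurable f)
    (hsupp : ∀ᶠ N : ℕ in atTop,
      Function.support f ⊆ Set.Icc (-(Real.pi * N)) (Real.pi * N)) {σ2 K : ℝ}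
    (hV : ∀ u : ℝ, 0 ≤ u → Tendsto (fun N : ℕ => ∫ τ : Fin N → ℝ,
      Real.exp (-(u / N * ∑' k : ℕ, 2 * bipartiteWeight f N k * ‖powerSum ((k : ℤ) + 1) τ‖ ^ 2))
        ∂(Q N)) atTop (𝓝 (Real.exp (-(u * σ2)))))
    (hK : ∀ᶠ N : ℕ in atTop,
      ∫ τ, ∫ x, bipartiteTest f τ x ^ 4 ∂uniformAngle ∂(Q N) ≤ K) (t : ℝ) :
    Tendsto (fun N : ℕ => ∫ z : (Fin N → ℝ) × (Fin N → ℝ),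
      Complex.exp (Complex.I * ((t / √N * ∑ j, bipartiteTest f z.1 (z.2 j) : ℝ) : ℂ))
        ∂((Q N).prod (circularUnitaryEnsemble N))) atTop
      (𝓝 ((Real.exp (-(t ^ 2 / 2 * σ2)) : ℝ) : ℂ)) := by
  obtain ⟨ε, hε0, hε⟩ := hasLinearGaussianLimit_circularUnitaryEnsemble t
  have hA := (Complex.continuous_ofReal.tendsto _).comp (hV (t ^ 2 / 2) (by positivity))
  have hεK : Tendsto (fun N => |ε N| * (1 + K)) atTop (𝓝 0) := by
    simpa using (hε0.abs).mul_const (1 + K)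
  refine (tendsto_iff_of_dist ?_).1 hA
  refine squeeze_zero' (Eventually.of_forall fun _ => dist_nonneg) ?_ hεK
  filter_upwards [hsupp, hK, eventually_ge_atTop 1] with N hsupp hK hN
  have hexp : BoundedMeasurable fun z : (Fin N → ℝ) × (Fin N → ℝ) =>
      Complex.exp (Complex.I * ((t / √N * ∑ j, bipartiteTest f z.1 (z.2 j) : ℝ) : ℂ)) := by
    exact BoundedMeasurable.cexp_I_mul ((measurable_sum_bipartiteTest hf).const_mul _)
  have hV0 : ∀ τ : Fin N → ℝ,
      0 ≤ ∑' k : ℕ, 2 * bipartiteWeight f N k * ‖powerSum ((k : ℤ) + 1) τ‖ ^ 2 := fun τ =>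
    tsum_nonneg fun k => by
      have := bipartiteWeight_nonneg f N k
      positivity
  have hG : BoundedMeasurable fun τ : Fin N → ℝ => Real.exp (-(t ^ 2 / 2 / N *
      ∑' k : ℕ, 2 * bipartiteWeight f N k * ‖powerSum ((k : ℤ) + 1) τ‖ ^ 2)) := by
    have hm : Measurable fun τ : Fin N → ℝ =>
        ∑' k : ℕ, 2 * bipartiteWeight f N k * ‖powerSum ((k : ℤ) + 1) τ‖ ^ 2 :=
      Measurable.tsum fun k => (((measurable_powerSum _).norm).pow_const 2).const_mul _
    refine ⟨by fun_prop, 1, fun τ => ?_⟩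
    rw [Real.norm_of_nonneg (Real.exp_pos _).le, Real.exp_le_one_iff, neg_nonpos]
    have := hV0 τ
    positivity
  have h4 : BoundedMeasurable fun z : (Fin N → ℝ) × ℝ => bipartiteTest f z.1 z.2 ^ 4 :=
    (boundedMeasurable_bipartiteTest_uncurry hf).pow 4
  have h4i := h4.integrable_integral (μ := Q N) (ν := uniformAngle)
  rw [Function.comp_apply, dist_comm, dist_eq_norm, integral_prod _ hexp.integrable,
    ← integral_complex_ofReal, ← integral_sub hexp.integrable_integral hG.ofReal.integrable]
  have hpt : ∀ τ : Fin N → ℝ, ‖(∫ θ, Complex.exp (Complex.I *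
        ((t / √N * ∑ j, bipartiteTest f τ (θ j) : ℝ) : ℂ)) ∂(circularUnitaryEnsemble N)) -
      ((Real.exp (-(t ^ 2 / 2 / N * ∑' k : ℕ, 2 * bipartiteWeight f N k *
        ‖powerSum ((k : ℤ) + 1) τ‖ ^ 2)) : ℝ) : ℂ)‖ ≤
      |ε N| * (1 + ∫ x, bipartiteTest f τ x ^ 4 ∂uniformAngle) := by
    intro τ
    have h := hε N hN _ (boundedMeasurable_bipartiteTest hf τ)
      (integral_bipartiteTest hN hsupp hf τ)
    rw [fluctuationVariance_bipartiteTest hN hsupp hf] at h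
    rw [div_div]
    refine h.trans (mul_le_mul_of_nonneg_right (le_abs_self _) ?_)
    have : 0 ≤ ∫ x, bipartiteTest f τ x ^ 4 ∂uniformAngle :=
      integral_nonneg fun x => by positivity
    linarith
  refine (norm_integral_le_of_norm_le (((integrable_const 1).add h4i).const_mul |ε N|)
    (.of_forall hpt)).trans ?_
  rw [integral_const_mul]
  refine mul_le_mul_of_nonneg_left ?_ (abs_nonneg _)
  simp only [Pi.add_apply]
  rw [integral_add (integrable_const _) h4i]
  simpa using hK

/-- The bipartite statistic has a Gaussian limit as soon as the conditional variances converge to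
a constant. -/
theorem hasLocalGaussianLimit_of_conditionalVariance (hf : BoundedMeasurable f)
    (hsupp : ∀ᶠ N : ℕ in atTop,
      Function.support f ⊆ Set.Icc (-(Real.pi * N)) (Real.pi * N)) {σ2 K : ℝ} (hσ2 : 0 ≤ σ2)
    (hV : ∀ u : ℝ, 0 ≤ u → Tendsto (fun N : ℕ => ∫ τ : Fin N → ℝ,
      Real.exp (-(u / N * ∑' k : ℕ, 2 * bipartiteWeight f N k * ‖powerSum ((k : ℤ) + 1) τ‖ ^ 2))
        ∂(Q N)) atTop (𝓝 (Real.exp (-(u * σ2)))))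
    (hK : ∀ᶠ N : ℕ in atTop,
      ∫ τ, ∫ x, bipartiteTest f τ x ^ 4 ∂uniformAngle ∂(Q N) ≤ K)
    {Ω : ℕ → Type*} [∀ N, MeasurableSpace (Ω N)]
    (P : ∀ N, Measure (Ω N)) [∀ N, IsProbabilityMeasure (P N)] {τ θ : ∀ N, Ω N → Fin N → ℝ}
    (hθ : ∀ N, HasLaw (θ N) (circularUnitaryEnsemble N) (P N))
    (hτ : ∀ N, HasLaw (τ N) (Q N) (P N)) (hind : ∀ N, IndepFun (τ N) (θ N) (P N)) :
    HasLocalGaussianLimit f P (fun N ω => localBipartite f (τ N ω) (θ N ω)) σ2 := by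
  have hlaw : ∀ N, HasLaw (fun ω => (τ N ω, θ N ω)) ((Q N).prod (circularUnitaryEnsemble N))
      (P N) := fun N => (hind N).hasLaw_prod (hτ N) (hθ N)
  have hint : ∀ N, Integrable (fun ω => localBipartite f (τ N ω) (θ N ω)) (P N) := by
    intro N
    have hb := (boundedMeasurable_localBipartite (N := N) hf).integrable
      (μ := (Q N).prod (circularUnitaryEnsemble N))
    rw [← (hlaw N).map_eq] at hb
    exact hb.comp_aemeasurable (hlaw N).aemeasurable
  have hmean : ∀ N : ℕ, Function.support f ⊆ Set.Icc (-(Real.pi * N)) (Real.pi * N) →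
      ∫ ω, localBipartite f (τ N ω) (θ N ω) ∂(P N) = N / (2 * Real.pi) * ∫ x, f x := by
    intro N hs
    rw [← integral_localBipartite_prod (Q := Q) hf hs]
    exact (hlaw N).integral_comp
      (boundedMeasurable_localBipartite hf).1.aestronglyMeasurable
  refine ⟨hint, hmean, ⟨fun N => ((hint N).aemeasurable.sub_const _).div_const _, by fun_prop, ?_⟩⟩
  -- Lévy's continuity theorem; a zero variance is covered, the limit then being the point mass at
  -- `0`.
  refine ProbabilityMeasure.tendsto_of_tendsto_charFun fun t => ?_
  simp only [ProbabilityMeasure.coe_mk, Measure.map_id, charFun_gaussianReal]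
  have hlim := tendsto_integral_exp_bipartiteTest hf hsupp hV hK t
  have e : ((Real.exp (-(t ^ 2 / 2 * σ2)) : ℝ) : ℂ) =
      Complex.exp (t * (0 : ℝ) * Complex.I - (σ2.toNNReal : ℝ) * t ^ 2 / 2) := by
    rw [Real.coe_toNNReal _ hσ2]
    push_cast
    congr 1
    ring
  rw [e] at hlim
  refine hlim.congr' ?_
  filter_upwards [hsupp] with N hs
  rw [charFun_apply_real, integral_map ((hint N).aemeasurable.sub_const _ |>.div_const _)
    (by fun_prop), hmean N hs]
  have hm : Measurable fun z : (Fin N → ℝ) × (Fin N → ℝ) =>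
      Complex.exp (Complex.I * ((t / √N * ∑ j, bipartiteTest f z.1 (z.2 j) : ℝ) : ℂ)) := by
    exact (BoundedMeasurable.cexp_I_mul ((measurable_sum_bipartiteTest hf).const_mul _)).1
  rw [← (hlaw N).integral_comp hm.aestronglyMeasurable]
  refine integral_congr_ae (.of_forall fun ω => ?_)
  simp only [Function.comp_apply]
  rw [← localBipartite_eq]
  congr 1
  push_cast
  ring

end Annealing

/-- For fixed `x` the test function is a linear statistic of `τ` minus a constant. Its exponential
moment under the Poisson bound stays bounded in `N`: the `N` points balance the `1/N` width of the
scaled bump. -/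
lemma HasPoissonBound.integral_bipartiteTest_pow_four_le {Q : ∀ N, Measure (Fin N → ℝ)}
    [∀ N, IsProbabilityMeasure (Q N)] (hQ : HasPoissonBound Q) {f : ℝ → ℝ}
    (hf : BoundedMeasurable f) {N : ℕ} (hN : 1 ≤ N)
    (hsupp : Function.support f ⊆ Set.Icc (-(Real.pi * N)) (Real.pi * N)) :
    ∫ τ, ∫ x, bipartiteTest f τ x ^ 4 ∂uniformAngle ∂(Q N) ≤
      8 * (24 * Real.exp (1 / (2 * Real.pi) * ∫ y, (Real.exp |f y| - 1)) +
        (1 / (2 * Real.pi) * ∫ y, f y) ^ 4) := by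
  set c : ℝ := 1 / (2 * Real.pi) * ∫ y, f y with hc
  have hN0 : (N : ℝ) ≠ 0 := by positivity
  have h4 : BoundedMeasurable fun z : (Fin N → ℝ) × ℝ => bipartiteTest f z.1 z.2 ^ 4 :=
    (boundedMeasurable_bipartiteTest_uncurry hf).pow 4
  rw [integral_integral_swap (f := fun τ x => bipartiteTest f τ x ^ 4) h4.integrable]
  have hinner : ∀ x, ∫ τ, bipartiteTest f τ x ^ 4 ∂(Q N) ≤
      8 * (24 * Real.exp (1 / (2 * Real.pi) * ∫ y, (Real.exp |f y| - 1)) + c ^ 4) := by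
    intro x
    have hφ : BoundedMeasurable fun y => |periodicScale f N (y - x)| :=
      ((hf.periodicScale N).comp_measurable (measurable_id.sub_const x)).norm
    have hS : BoundedMeasurable fun τ : Fin N → ℝ => ∑ i, |periodicScale f N (τ i - x)| :=
      BoundedMeasurable.finsetSum _ fun i => hφ.comp_measurable (measurable_pi_apply i)
    have h1 : ∀ τ : Fin N → ℝ, bipartiteTest f τ x ^ 4 ≤
        8 * ((∑ i, |periodicScale f N (τ i - x)|) ^ 4 + c ^ 4) := by
      intro τ
      have ha : |∑ i, periodicScale f N (τ i - x)| ≤ ∑ i, |periodicScale f N (τ i - x)| :=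
        Finset.abs_sum_le_sum_abs _ _
      have hb := pow_le_pow_left₀ (abs_nonneg _) ha 4
      rw [(by decide : Even 4).pow_abs] at hb
      have hd : bipartiteTest f τ x = ∑ i, periodicScale f N (τ i - x) - c := rfl
      rw [hd]
      set a := ∑ i, periodicScale f N (τ i - x)
      have : (a - c) ^ 4 ≤ 8 * (a ^ 4 + c ^ 4) := by
        have e1 : (a - c) ^ 2 ≤ 2 * (a ^ 2 + c ^ 2) := by nlinarith [sq_nonneg (a + c)]
        have e2 : ((a - c) ^ 2) ^ 2 ≤ (2 * (a ^ 2 + c ^ 2)) ^ 2 :=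
          pow_le_pow_left₀ (sq_nonneg _) e1 2
        nlinarith [sq_nonneg (a ^ 2 - c ^ 2)]
      linarith
    have h2 := hQ.integral_sum_pow_four_le N hφ fun y => abs_nonneg _
    have h3 : ∫ y, (Real.exp |periodicScale f N (y - x)| - 1) ∂uniformAngle =
        1 / (2 * Real.pi * N) * ∫ y, (Real.exp |f y| - 1) := by
      -- Periodization commutes with `y ↦ e^{|y|} - 1`, which vanishes at `0` and so does not
      -- enlarge the support.
      refine (integral_periodicScale_sub (f := fun y => Real.exp |f y| - 1) hN ?_ x).2
      refine Set.Subset.trans (fun y hy => ?_) hsupp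
      rw [Function.mem_support] at hy ⊢
      contrapose! hy
      simp [hy]
    rw [h3] at h2
    have e : (N : ℝ) * (1 / (2 * Real.pi * N) * ∫ y, (Real.exp |f y| - 1)) =
        1 / (2 * Real.pi) * ∫ y, (Real.exp |f y| - 1) := by
      have := Real.pi_ne_zero
      field_simp
    rw [e] at h2
    have hbx : BoundedMeasurable fun τ : Fin N → ℝ => bipartiteTest f τ x ^ 4 :=
      BoundedMeasurable.comp_measurable (φ := fun z : (Fin N → ℝ) × ℝ => bipartiteTest f z.1 z.2 ^ 4)
        (ψ := fun τ => (τ, x)) h4 (measurable_id.prodMk measurable_const)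
    refine (integral_mono hbx.integrable
      ((((hS.pow 4).integrable).add (integrable_const _)).const_mul 8) h1).trans ?_
    rw [integral_const_mul]
    simp only [Pi.add_apply]
    rw [integral_add (hS.pow 4).integrable (integrable_const _)]
    simp only [integral_const, probReal_univ, one_smul]
    linarith
  have hsw : Integrable (fun x => ∫ τ, bipartiteTest f τ x ^ 4 ∂(Q N)) uniformAngle :=
    (h4.integrable (μ := (Q N).prod uniformAngle)).integral_prod_right
  refine (integral_mono hsw (integrable_const _) hinner).trans ?_
  simp

/-! ### Riemann sums on the half-line. -/

section RiemannSum

/-- The scaled sums of a quickly decaying function over the positive points of a lattice. -/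
lemma hasSum_lattice {G : ℝ → ℝ} (hG : Measurable G) {C : ℝ} (hC : ∀ x, |G x| ≤ C * (1 + x ^ 2)⁻¹)
    {N : ℕ} (hN : 1 ≤ N) :
    IntegrableOn (fun x => G ((⌈(N : ℝ) * x⌉₊ : ℝ) / N)) (Set.Ioi 0) ∧
    (∀ x ∈ Set.Ioi (0 : ℝ), |G ((⌈(N : ℝ) * x⌉₊ : ℝ) / N)| ≤ C * (1 + x ^ 2)⁻¹) ∧
    HasSum (fun k : ℕ => 1 / N * G (((k : ℝ) + 1) / N))
      (∫ x in Set.Ioi (0 : ℝ), G ((⌈(N : ℝ) * x⌉₊ : ℝ) / N)) := by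
  have hN0 : (0 : ℝ) < N := by exact_mod_cast hN
  have hC0 : 0 ≤ C := by simpa using (abs_nonneg _).trans (hC 0)
  have hbound : ∀ x ∈ Set.Ioi (0 : ℝ), |G ((⌈(N : ℝ) * x⌉₊ : ℝ) / N)| ≤ C * (1 + x ^ 2)⁻¹ := by
    intro x hx
    have hx0 : (0 : ℝ) < x := hx
    refine (hC _).trans (mul_le_mul_of_nonneg_left ?_ hC0)
    -- Sampling at right endpoints only moves the argument outwards, so the majorant at `x` itself
    -- serves for every `N`; dominated convergence rests on this.
    have h1 : x ≤ (⌈(N : ℝ) * x⌉₊ : ℝ) / N := by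
      rw [le_div_iff₀ hN0, mul_comm]
      exact Nat.le_ceil _
    gcongr
  have hmeas : Measurable fun x : ℝ => G ((⌈(N : ℝ) * x⌉₊ : ℝ) / N) := by
    refine hG.comp (Measurable.div_const ?_ _)
    exact (measurable_from_nat (f := fun n : ℕ => (n : ℝ))).comp
      (Nat.measurable_ceil.comp (measurable_id.const_mul _))
  have hint : IntegrableOn (fun x => G ((⌈(N : ℝ) * x⌉₊ : ℝ) / N)) (Set.Ioi 0) := by
    refine Integrable.mono' ((integrable_inv_one_add_sq.const_mul C).integrableOn (s := Set.Ioi 0))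
      hmeas.aestronglyMeasurable ?_
    exact (ae_restrict_iff' measurableSet_Ioi).2 (.of_forall hbound)
  refine ⟨hint, hbound, ?_⟩
  have hceil : ∀ (k : ℕ) (x : ℝ), x ∈ Set.Ioc ((k : ℝ) / N) (((k : ℝ) + 1) / N) ↔
      ⌈(N : ℝ) * x⌉₊ = k + 1 := by
    intro k x
    rw [Nat.ceil_eq_iff (by omega), Set.mem_Ioc, div_lt_iff₀ hN0, le_div_iff₀ hN0, mul_comm x]
    push_cast
    simp
  have hU : ⋃ k : ℕ, Set.Ioc ((k : ℝ) / N) (((k : ℝ) + 1) / N) = Set.Ioi (0 : ℝ) := by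
    ext x
    simp only [Set.mem_iUnion, hceil, Set.mem_Ioi]
    constructor
    · rintro ⟨k, hk⟩
      have : 0 < ⌈(N : ℝ) * x⌉₊ := by omega
      rw [Nat.ceil_pos] at this
      exact (mul_pos_iff_of_pos_left hN0).1 this
    · intro hx
      have : 0 < ⌈(N : ℝ) * x⌉₊ := Nat.ceil_pos.2 (by positivity)
      exact ⟨⌈(N : ℝ) * x⌉₊ - 1, by omega⟩
  have h := hasSum_integral_iUnion (μ := volume)
    (s := fun k : ℕ => Set.Ioc ((k : ℝ) / N) (((k : ℝ) + 1) / N))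
    (f := fun x => G ((⌈(N : ℝ) * x⌉₊ : ℝ) / N)) (fun k => measurableSet_Ioc)
    (fun i j hij => Set.disjoint_left.2 fun x hi hj => hij (by
      rw [hceil] at hi hj
      omega)) (by rwa [hU])
  rw [hU] at h
  suffices hk : (fun k : ℕ => 1 / N * G (((k : ℝ) + 1) / N)) = fun k : ℕ =>
      ∫ x in Set.Ioc ((k : ℝ) / N) (((k : ℝ) + 1) / N), G ((⌈(N : ℝ) * x⌉₊ : ℝ) / N) by rwa [hk]
  ext k
  rw [setIntegral_congr_fun (g := fun _ => G (((k : ℝ) + 1) / N)) measurableSet_Ioc fun x hx => by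
    simp only
    rw [(hceil k x).1 hx]
    push_cast
    rfl]
  rw [setIntegral_const, Real.volume_real_Ioc_of_le (by gcongr; linarith), smul_eq_mul]
  congr 1
  ring

lemma tendsto_tsum_lattice {G : ℝ → ℝ} (hG : Continuous G) {C : ℝ}
    (hC : ∀ x, |G x| ≤ C * (1 + x ^ 2)⁻¹) :
    Tendsto (fun N : ℕ => ∑' k : ℕ, 1 / N * G (((k : ℝ) + 1) / N)) atTop
      (𝓝 (∫ x in Set.Ioi (0 : ℝ), G x)) := by
  have h : Tendsto (fun N : ℕ => ∫ x in Set.Ioi (0 : ℝ), G ((⌈(N : ℝ) * x⌉₊ : ℝ) / N)) atTop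
      (𝓝 (∫ x in Set.Ioi (0 : ℝ), G x)) := by
    refine tendsto_integral_filter_of_dominated_convergence (fun x => C * (1 + x ^ 2)⁻¹) ?_ ?_
      (integrable_inv_one_add_sq.const_mul C).integrableOn ?_
    · filter_upwards [eventually_ge_atTop 1] with N hN
      exact (hasSum_lattice hG.measurable hC hN).1.aestronglyMeasurable
    · filter_upwards [eventually_ge_atTop 1] with N hN
      exact (ae_restrict_iff' measurableSet_Ioi).2
        (.of_forall (hasSum_lattice hG.measurable hC hN).2.1)
    · refine (ae_restrict_iff' measurableSet_Ioi).2 (.of_forall fun x hx => ?_)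
      refine (hG.tendsto x).comp ?_
      have := (tendsto_nat_ceil_mul_div_atTop (R := ℝ) (a := x) (le_of_lt hx)).comp
        (tendsto_natCast_atTop_atTop (R := ℝ))
      simpa [Function.comp_def, mul_comm] using this
  refine h.congr' ?_
  filter_upwards [eventually_ge_atTop 1] with N hN
  exact (hasSum_lattice hG.measurable hC hN).2.2.tsum_eq.symm

end RiemannSum

/-! ### Decay of the Fourier transform. -/

section FourierDecay

/-- Rescaling by `2π` matches the two Fourier normalizations, so Schwartz regularity and decay
become available for `fourierHat`. -/
lemma exists_schwartzMap_fourierHat {f : ℝ → ℝ}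
    (hf : ContDiff ℝ ((⊤ : ℕ∞) : WithTop ℕ∞) f) (hs : HasCompactSupport f) :
    ∃ g : SchwartzMap ℝ ℂ, ∀ t, ‖fourierHat f t‖ = ‖g (t / (2 * Real.pi))‖ / √(2 * Real.pi) := by
  have h1 : HasCompactSupport fun x => (f x : ℂ) := hs.comp_left (g := fun y : ℝ => (y : ℂ)) (by simp)
  have h2 : ContDiff ℝ ((⊤ : ℕ∞) : WithTop ℕ∞) fun x => (f x : ℂ) :=
    Complex.ofRealCLM.contDiff.comp hf
  refine ⟨FourierTransform.fourier (h1.toSchwartzMap h2), fun t => ?_⟩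
  rw [SchwartzMap.fourier_coe, Real.fourier_real_eq_integral_exp_smul, fourierHat, norm_mul]
  have hpi := Real.pi_ne_zero
  have e : ∀ x : ℝ, Complex.exp (((-2 * Real.pi * x * (t / (2 * Real.pi)) : ℝ) : ℂ) * Complex.I) •
      (h1.toSchwartzMap h2) x = (f x : ℂ) * Complex.exp (-Complex.I * (t : ℂ) * (x : ℂ)) := by
    intro x
    rw [smul_eq_mul, mul_comm]
    congr 2
    have : -2 * Real.pi * x * (t / (2 * Real.pi)) = -(t * x) := by field_simp
    rw [this]
    push_cast
    ring
  simp_rw [e]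
  rw [norm_div, norm_one, Complex.norm_real, Real.norm_of_nonneg (by positivity)]
  ring

/-- The Fourier transform of a test function is continuous and decays. -/
lemma continuous_and_decay_fourierHat {f : ℝ → ℝ}
    (hf : ContDiff ℝ ((⊤ : ℕ∞) : WithTop ℕ∞) f) (hs : HasCompactSupport f) :
    Continuous (fun t => ‖fourierHat f t‖) ∧
      ∃ C, ∀ t, ‖fourierHat f t‖ ^ 2 ≤ C * (1 + t ^ 2)⁻¹ := by
  obtain ⟨g, hg⟩ := exists_schwartzMap_fourierHat hf hs
  constructor
  · simp_rw [hg]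
    exact (g.continuous.comp (by fun_prop)).norm.div_const _
  obtain ⟨A, -, hA⟩ := g.decay 0 0
  obtain ⟨B, -, hB⟩ := g.decay 1 0
  simp only [pow_zero, one_mul, norm_iteratedFDeriv_zero, pow_one] at hA hB
  refine ⟨(A / √(2 * Real.pi)) ^ 2 + (2 * Real.pi * B / √(2 * Real.pi)) ^ 2, fun t => ?_⟩
  have hs0 : 0 < √(2 * Real.pi) := Real.sqrt_pos.2 Real.two_pi_pos
  rw [← div_eq_mul_inv, le_div_iff₀ (by positivity)]
  have h1 : ‖fourierHat f t‖ ≤ A / √(2 * Real.pi) := by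
    rw [hg]
    gcongr
    exact hA _
  have h2 : |t| * ‖fourierHat f t‖ ≤ 2 * Real.pi * B / √(2 * Real.pi) := by
    rw [hg, ← mul_div_assoc]
    refine div_le_div_of_nonneg_right ?_ hs0.le
    have := hB (t / (2 * Real.pi))
    rw [norm_div, Real.norm_of_nonneg Real.two_pi_pos.le, Real.norm_eq_abs, div_mul_eq_mul_div,
      div_le_iff₀ Real.two_pi_pos] at this
    linarith
  have h3 := pow_le_pow_left₀ (norm_nonneg _) h1 2
  have h4 := pow_le_pow_left₀ (by positivity) h2 2
  rw [mul_pow, sq_abs] at h4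
  linarith

end FourierDecay

/-! ### Limits of the conditional variances. -/

section Limits

variable {f : ℝ → ℝ} {C : ℝ}

lemma abs_sq_mul_le {a b v : ℝ} (h : a ^ 2 ≤ b) (hv0 : 0 ≤ v) (hv1 : v ≤ 1) :
    |a ^ 2 * v| ≤ b := by
  rw [abs_of_nonneg (by positivity)]
  nlinarith [sq_nonneg a]

lemma integrable_sq_fourierHat_mul (hc : Continuous fun t => ‖fourierHat f t‖)
    (hC : ∀ t, ‖fourierHat f t‖ ^ 2 ≤ C * (1 + t ^ 2)⁻¹) {v : ℝ → ℝ} (hv : Continuous v)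
    (hv0 : ∀ t, 0 ≤ v t) (hv1 : ∀ t, v t ≤ 1) :
    Integrable fun t => ‖fourierHat f t‖ ^ 2 * v t :=
  (integrable_inv_one_add_sq.const_mul C).mono' ((hc.pow 2).mul hv).aestronglyMeasurable
    (.of_forall fun t => abs_sq_mul_le (hC t) (hv0 t) (hv1 t))

lemma integral_sq_fourierHat_mul (f v : ℝ → ℝ) (hv : ∀ t, v |t| = v t) :
    ∫ t, ‖fourierHat f t‖ ^ 2 * v t = 2 * ∫ t in Set.Ioi (0 : ℝ), ‖fourierHat f t‖ ^ 2 * v t := by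
  rw [← integral_comp_abs (f := fun t => ‖fourierHat f t‖ ^ 2 * v t)]
  congr 1; ext t
  rw [hv]
  rcases abs_choice t with h | h <;> rw [h]
  rw [norm_fourierHat_neg]

/-- Displays the weight as one term of a Riemann sum of mesh `1/N`, since `min(k,N) = N min(k/N,
1)`. -/
lemma bipartiteWeight_eq (f : ℝ → ℝ) {N : ℕ} (hN : 1 ≤ N) (k : ℕ) :
    bipartiteWeight f N k = 1 / (2 * Real.pi) *
      (1 / N * (‖fourierHat f (((k : ℝ) + 1) / N)‖ ^ 2 * min |((k : ℝ) + 1) / N| 1)) := by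
  have hN0 : (0 : ℝ) < N := by exact_mod_cast hN
  have h : min ((k : ℝ) + 1) N = N * min |((k : ℝ) + 1) / N| 1 := by
    rw [abs_of_nonneg (by positivity), mul_min_of_nonneg _ _ hN0.le, mul_div_cancel₀ _ hN0.ne',
      mul_one]
  rw [bipartiteWeight, h]
  have := Real.pi_ne_zero
  field_simp

/-- Convergence of the conditional variance of the bipartite statistic. -/
theorem HasLinearGaussianLimit.tendsto_integral_exp_bipartiteWeight
    {Q : ∀ N, Measure (Fin N → ℝ)} [∀ N, IsProbabilityMeasure (Q N)] {q : ℕ → ℕ → ℝ}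
    (hQ : HasLinearGaussianLimit Q q) (hq0 : ∀ N k, 0 ≤ q N k) (hqN : ∀ N k, q N k ≤ N)
    (hc : Continuous fun t => ‖fourierHat f t‖)
    (hC : ∀ t, ‖fourierHat f t‖ ^ 2 ≤ C * (1 + t ^ 2)⁻¹) {w : ℝ → ℝ} (hw : Continuous w)
    (hw0 : ∀ t, 0 ≤ w t) (hw1 : ∀ t, w t ≤ 1) (hwabs : ∀ t, w |t| = w t)
    (hqw : ∀ N : ℕ, 1 ≤ N → ∀ k, q N (k + 1) = N * w (((k : ℝ) + 1) / N)) {u : ℝ} (hu : 0 ≤ u) :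
    Tendsto (fun N : ℕ => ∫ τ : Fin N → ℝ,
      Real.exp (-(u / N * ∑' k : ℕ, 2 * bipartiteWeight f N k * ‖powerSum ((k : ℤ) + 1) τ‖ ^ 2))
        ∂(Q N)) atTop
      (𝓝 (Real.exp (-(u * (1 / (2 * Real.pi) *
        ∫ t, ‖fourierHat f t‖ ^ 2 * (min |t| 1 * w t)))))) := by
  have hpi := Real.pi_pos
  have hm0 : ∀ t : ℝ, 0 ≤ min |t| 1 := fun t => by positivity
  have hm1 : ∀ t : ℝ, min |t| 1 ≤ 1 := fun t => min_le_right _ _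
  have hG1c : Continuous fun t => ‖fourierHat f t‖ ^ 2 * min |t| 1 := by fun_prop
  have hG2c : Continuous fun t => ‖fourierHat f t‖ ^ 2 * (min |t| 1 * w t) := by fun_prop
  have hG1 : ∀ t, |‖fourierHat f t‖ ^ 2 * min |t| 1| ≤ C * (1 + t ^ 2)⁻¹ := fun t =>
    abs_sq_mul_le (hC t) (hm0 t) (hm1 t)
  have hG2 : ∀ t, |‖fourierHat f t‖ ^ 2 * (min |t| 1 * w t)| ≤ C * (1 + t ^ 2)⁻¹ := fun t =>
    abs_sq_mul_le (hC t) (mul_nonneg (hm0 t) (hw0 t))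
      (mul_le_one₀ (hm1 t) (hw0 t) (hw1 t))
  have hlim1 := (tendsto_tsum_lattice hG1c hG1).const_mul (1 / (2 * Real.pi))
  have hlim2 := (tendsto_tsum_lattice hG2c hG2).const_mul (1 / Real.pi)
  set L := 1 / (2 * Real.pi) * ∫ x in Set.Ioi (0 : ℝ), ‖fourierHat f x‖ ^ 2 * min |x| 1
  -- `C` controls each weight by `C/N`; the total mass tends to `L`, so it is eventually below `L +
  -- 1`.
  refine hQ.tendsto_integral_exp (p := bipartiteWeight f) (C := max C (L + 1)) hq0 hqN
    (bipartiteWeight_nonneg f) ?_ ?_ ?_ ?_ hu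
  · intro N
    rcases Nat.eq_zero_or_pos N with rfl | hN
    · exact summable_zero.congr fun k => by simp [bipartiteWeight]
    rw [funext (bipartiteWeight_eq f hN)]
    exact (hasSum_lattice hG1c.measurable hG1 hN).2.2.summable.mul_left _
  · filter_upwards [eventually_ge_atTop 1] with N hN k
    have hN0 : (0 : ℝ) < N := by exact_mod_cast hN
    rw [bipartiteWeight_eq f hN]
    set x := ((k : ℝ) + 1) / N
    have hC0 : 0 ≤ C := by simpa using (abs_nonneg _).trans (hG1 0)
    have h1 : ‖fourierHat f x‖ ^ 2 * min |x| 1 ≤ C := by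
      refine (le_abs_self _).trans ((hG1 x).trans ?_)
      exact mul_le_of_le_one_right hC0 (inv_le_one_of_one_le₀ (by nlinarith [sq_nonneg x]))
    have h2 : 1 / (2 * Real.pi) ≤ 1 := by
      rw [div_le_one (by positivity)]
      nlinarith [Real.pi_gt_three]
    calc 1 / (2 * Real.pi) * (1 / N * (‖fourierHat f x‖ ^ 2 * min |x| 1)) ≤ 1 * (1 / N * C) := by
          gcongr
      _ = C / N := by ring
      _ ≤ max C (L + 1) / N := by gcongr; exact le_max_left _ _
  · filter_upwards [eventually_ge_atTop 1, hlim1.eventually_le_const (lt_add_one L)] with N hN h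
    simp_rw [bipartiteWeight_eq f hN]
    rw [tsum_mul_left]
    exact h.trans (le_max_right _ _)
  · have e : 1 / (2 * Real.pi) * ∫ t, ‖fourierHat f t‖ ^ 2 * (min |t| 1 * w t) =
        1 / Real.pi * ∫ t in Set.Ioi (0 : ℝ), ‖fourierHat f t‖ ^ 2 * (min |t| 1 * w t) := by
      rw [integral_sq_fourierHat_mul f (fun t => min |t| 1 * w t) fun t => by
        rw [abs_abs, hwabs]]
      field_simp
    rw [e]
    refine hlim2.congr' ?_
    filter_upwards [eventually_ge_atTop 1] with N hN
    have hN0 : (0 : ℝ) < N := by exact_mod_cast hN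
    rw [← tsum_mul_left, ← tsum_div_const]
    refine tsum_congr fun k => ?_
    rw [bipartiteWeight_eq f hN, hqw N hN]
    field_simp

end Limits

/-! ### Equally spaced points. -/

/-- The angles of the equally spaced points `2πi/N`, `i = 1, …, N`. -/
noncomputable def latticeAngles (N : ℕ) (i : Fin N) : ℝ :=
  2 * Real.pi * ((i : ℕ) + 1 : ℝ) / (N : ℝ)

section Lattice

variable {N : ℕ} {f : ℝ → ℝ}

/-- A geometric sum of powers of an `N`-th root of unity. -/
lemma powerSum_latticeAngles (hN : 1 ≤ N) (k : ℕ) :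
    powerSum (k : ℤ) (latticeAngles N) = if N ∣ k then (N : ℂ) else 0 := by
  have hN0 : N ≠ 0 := by omega
  have hζ := Complex.isPrimitiveRoot_exp N hN0
  set ζ := Complex.exp (2 * Real.pi * Complex.I / N)
  have h1 : powerSum (k : ℤ) (latticeAngles N) = ζ ^ k * ∑ j ∈ Finset.range N, (ζ ^ k) ^ j := by
    rw [powerSum, ← Fin.sum_univ_eq_sum_range (fun j => (ζ ^ k) ^ j), Finset.mul_sum]
    refine Finset.sum_congr rfl fun j _ => ?_
    rw [← pow_succ', ← pow_mul, ← Complex.exp_nat_mul, latticeAngles]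
    congr 1
    push_cast
    ring
  rw [h1]
  split_ifs with h
  · rw [(hζ.pow_eq_one_iff_dvd k).2 h]
    simp
  · have h2 : ζ ^ k ≠ 1 := fun h3 => h ((hζ.pow_eq_one_iff_dvd k).1 h3)
    rw [geom_sum_eq h2, ← pow_mul, mul_comm k, pow_mul, hζ.pow_eq_one, one_pow, sub_self, zero_div,
      mul_zero]

/-- Only the frequencies `N(m+1)` survive. There the squared power sum is `N²`, the minimum in the
weight is `N`, and `f̂` is evaluated at the integer `m+1`. -/
lemma tsum_bipartiteWeight_latticeAngles (hN : 1 ≤ N) (f : ℝ → ℝ) :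
    ∑' k : ℕ, 2 * bipartiteWeight f N k * ‖powerSum ((k : ℤ) + 1) (latticeAngles N)‖ ^ 2 =
      N * (1 / Real.pi * ∑' m : ℕ, ‖fourierHat f ((m : ℝ) + 1)‖ ^ 2) := by
  have hN0 : (0 : ℝ) < N := by exact_mod_cast hN
  have hpi := Real.pi_ne_zero
  have hk : ∀ k : ℕ, powerSum ((k : ℤ) + 1) (latticeAngles N) = if N ∣ k + 1 then (N : ℂ) else 0 :=
    fun k => by rw [← powerSum_latticeAngles hN (k + 1)]; push_cast; rfl
  have hpos : ∀ m : ℕ, N * (m + 1) - 1 + 1 = N * (m + 1) := fun m => by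
    have : 1 ≤ N * (m + 1) := Nat.mul_pos hN m.succ_pos
    omega
  have hinj : Function.Injective fun m : ℕ => N * (m + 1) - 1 := by
    intro a b hab
    simp only at hab
    have h := congrArg (· + 1) hab
    simp only [hpos] at h
    have := Nat.eq_of_mul_eq_mul_left hN h
    omega
  rw [← hinj.tsum_eq, ← tsum_mul_left, ← tsum_mul_left]
  · refine tsum_congr fun m => ?_
    have hcast : ((N * (m + 1) - 1 : ℕ) : ℝ) + 1 = N * ((m : ℝ) + 1) := by
      exact_mod_cast congrArg (Nat.cast : ℕ → ℝ) (hpos m)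
    rw [hk, hpos, if_pos (dvd_mul_right _ _), bipartiteWeight, hcast, mul_div_cancel_left₀ _ hN0.ne',
      min_eq_right (by nlinarith [(Nat.cast_nonneg m : (0 : ℝ) ≤ m)]), Complex.norm_natCast]
    field_simp
  · intro k hks
    rw [Function.mem_support, hk] at hks
    have : N ∣ k + 1 := by
      by_contra h
      simp [h] at hks
    obtain ⟨m, hm⟩ := this
    rcases Nat.eq_zero_or_pos m with rfl | hm0
    · omega
    · refine ⟨m - 1, ?_⟩
      simp only
      rw [Nat.sub_add_cancel hm0]
      omega

/-- At most boundedly many of the equally spaced points lie in an arc of length of order `1/N`. -/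
lemma card_latticeAngles_le (hN : 1 ≤ N) {R : ℝ} (x : ℝ) :
    (Finset.univ.filter fun i : Fin N =>
      |(N : ℝ) * toIcoMod Real.two_pi_pos (-Real.pi) (latticeAngles N i - x)| ≤ R).card ≤
      (Finset.Icc ⌊-R / (2 * Real.pi)⌋ ⌊R / (2 * Real.pi)⌋).card := by
  have hN0 : (0 : ℝ) < N := by exact_mod_cast hN
  have h2pi := Real.two_pi_pos
  refine Finset.card_le_card_of_injOn (fun i => ⌊(N : ℝ) *
    toIcoMod Real.two_pi_pos (-Real.pi) (latticeAngles N i - x) / (2 * Real.pi)⌋) ?_ ?_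
  · intro i hi
    have hi' := (Finset.mem_filter.1 hi).2
    rw [abs_le] at hi'
    rw [Finset.coe_Icc, Set.mem_Icc]
    exact ⟨Int.floor_mono (by gcongr; exact hi'.1), Int.floor_mono (by gcongr; exact hi'.2)⟩
  · intro i _ j _ hij
    have h1 := Int.abs_sub_lt_one_of_floor_eq_floor hij
    -- In units of the spacing `2π/N`, the offsets of two points differ by an integer congruent to
    -- `i - j` modulo `N`. Equal floors force that integer to be `0`, hence `i = j`.
    have key : ∀ l : Fin N, (N : ℝ) *
        toIcoMod Real.two_pi_pos (-Real.pi) (latticeAngles N l - x) / (2 * Real.pi) =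
        ((l : ℕ) + 1 : ℝ) - N * x / (2 * Real.pi) -
          N * toIcoDiv Real.two_pi_pos (-Real.pi) (latticeAngles N l - x) := by
      intro l
      rw [toIcoMod, latticeAngles, zsmul_eq_mul]
      field_simp
    rw [key, key] at h1
    set a := toIcoDiv Real.two_pi_pos (-Real.pi) (latticeAngles N i - x)
    set b := toIcoDiv Real.two_pi_pos (-Real.pi) (latticeAngles N j - x)
    have h2 : |(((i : ℤ) - (j : ℤ) - N * (a - b) : ℤ) : ℝ)| < 1 := by
      refine lt_of_eq_of_lt (congrArg _ ?_) h1
      push_cast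
      ring
    have h3 : ((i : ℤ) - (j : ℤ) - N * (a - b) : ℤ) = 0 := by
      rw [← Int.abs_lt_one_iff]
      exact_mod_cast h2
    have h4 : (i : ℤ) ≡ j [ZMOD N] := by
      rw [Int.modEq_iff_dvd]
      exact ⟨b - a, by linarith⟩
    ext
    have h5 := Int.natCast_modEq_iff.1 h4
    rwa [Nat.ModEq, Nat.mod_eq_of_lt i.2, Nat.mod_eq_of_lt j.2] at h5

lemma exists_abs_bipartiteTest_latticeAngles_le (hf : BoundedMeasurable f)
    (hs : HasCompactSupport f) :
    ∃ D, ∀ N : ℕ, 1 ≤ N → ∀ x, |bipartiteTest f (latticeAngles N) x| ≤ D := by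
  obtain ⟨M, hM⟩ := hf.2
  obtain ⟨R, hR⟩ := hs.isCompact.isBounded.subset_closedBall 0
  have hM0 : 0 ≤ M := (norm_nonneg _).trans (hM 0)
  refine ⟨(Finset.Icc ⌊-R / (2 * Real.pi)⌋ ⌊R / (2 * Real.pi)⌋).card * M +
    |1 / (2 * Real.pi) * ∫ y, f y|, fun N hN x => ?_⟩
  refine (abs_sub _ _).trans (add_le_add_left ?_ _)
  refine (Finset.abs_sum_le_sum_abs _ _).trans ?_
  have h1 : ∑ i, |periodicScale f N (latticeAngles N i - x)| ≤
      ∑ i, if |(N : ℝ) * toIcoMod Real.two_pi_pos (-Real.pi) (latticeAngles N i - x)| ≤ R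
        then M else 0 := by
    refine Finset.sum_le_sum fun i _ => ?_
    split_ifs with h
    · exact hM _
    · have : f ((N : ℝ) * toIcoMod Real.two_pi_pos (-Real.pi) (latticeAngles N i - x)) = 0 := by
        by_contra hne
        have := hR (subset_tsupport f hne)
        rw [mem_closedBall_zero_iff, Real.norm_eq_abs] at this
        exact h this
      rw [periodicScale, this, abs_zero]
  refine h1.trans ?_
  rw [← Finset.sum_filter, Finset.sum_const, nsmul_eq_mul]
  gcongr
  exact card_latticeAngles_le hN x

end Lattice

/-! ### The variance series over nonzero integers. -/

section Series

variable {f : ℝ → ℝ}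

lemma hasSum_sq_fourierHat_ne_zero
    (hs : Summable fun m : ℕ => ‖fourierHat f ((m : ℝ) + 1)‖ ^ 2) :
    HasSum (fun l : {l : ℤ // l ≠ 0} => ‖fourierHat f ((l : ℤ) : ℝ)‖ ^ 2)
      (2 * ∑' m : ℕ, ‖fourierHat f ((m : ℝ) + 1)‖ ^ 2) := by
  set g : ℤ → ℝ := fun l => ‖fourierHat f (l : ℝ)‖ ^ 2
  have h1 : HasSum (fun n : ℕ => Set.indicator {l : ℤ | l ≠ 0} g (n + 1))
      (∑' m : ℕ, ‖fourierHat f ((m : ℝ) + 1)‖ ^ 2) := by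
    convert hs.hasSum using 1
    ext n
    rw [Set.indicator_of_mem (by simp only [Set.mem_ofPred_eq]; omega)]
    simp [g]
  have h2 : HasSum (fun n : ℕ => Set.indicator {l : ℤ | l ≠ 0} g (-(n + 1)))
      (∑' m : ℕ, ‖fourierHat f ((m : ℝ) + 1)‖ ^ 2) := by
    convert hs.hasSum using 1
    ext n
    rw [Set.indicator_of_mem (by simp only [Set.mem_ofPred_eq]; omega)]
    simp only [g]
    push_cast
    rw [norm_fourierHat_neg]
  have h3 := h1.of_add_one_of_neg_add_one h2
  rw [Set.indicator_of_notMem (by simp), add_zero, ← two_mul] at h3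
  exact (hasSum_subtype_iff_indicator (f := g) (s := {l : ℤ | l ≠ 0})).2 h3

end Series

/-! ### The three cases. -/

theorem theorem4p2
    (f : ℝ → ℝ) (hf_smooth : ContDiff ℝ ((⊤ : ℕ∞) : WithTop ℕ∞) f) (hf_supp : HasCompactSupport f)
    (hf_even : Function.Even f)
    {Ω : ℕ → Type*} [∀ N, MeasurableSpace (Ω N)]
    (P : ∀ N, Measure (Ω N)) [∀ N, IsProbabilityMeasure (P N)]
    (θ : ∀ N, Ω N → Fin N → ℝ)
    (hθ : ∀ N, HasLaw (θ N) (circularUnitaryEnsemble N) (P N)) :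
    -- (i) an independent CUE
    (Integrable (fun t : ℝ => ‖fourierHat f t‖ ^ 2 * (min |t| 1) ^ 2) ∧
      ∀ τ : ∀ N, Ω N → Fin N → ℝ,
        (∀ N, HasLaw (τ N) (circularUnitaryEnsemble N) (P N)) →
        (∀ N, IndepFun (τ N) (θ N) (P N)) →
        HasLocalGaussianLimit f P (fun N ω => localBipartite f (τ N ω) (θ N ω))
          (1 / (2 * Real.pi) * ∫ t : ℝ, ‖fourierHat f t‖ ^ 2 * (min |t| 1) ^ 2)) ∧
    -- (ii) i.i.d. uniform points, independent of the CUE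
    (Integrable (fun t : ℝ => ‖fourierHat f t‖ ^ 2 * min |t| 1) ∧
      ∀ τ : ∀ N, Ω N → Fin N → ℝ,
        (∀ N i, HasLaw (fun ω => τ N ω i) uniformAngle (P N)) →
        (∀ N, iIndepFun (fun i ω => τ N ω i) (P N)) →
        (∀ N, IndepFun (τ N) (θ N) (P N)) →
        HasLocalGaussianLimit f P (fun N ω => localBipartite f (τ N ω) (θ N ω))
          (1 / (2 * Real.pi) * ∫ t : ℝ, ‖fourierHat f t‖ ^ 2 * min |t| 1)) ∧
    -- (iii) the deterministic points `2πi/N`, `i = 1, …, N`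
    (Summable (fun l : {l : ℤ // l ≠ 0} => ‖fourierHat f ((l : ℤ) : ℝ)‖ ^ 2) ∧
      HasLocalGaussianLimit f P
        (fun N ω => localBipartite f
          (fun i : Fin N => 2 * Real.pi * ((i : ℕ) + 1 : ℝ) / (N : ℝ)) (θ N ω))
        (1 / (2 * Real.pi) *
          ∑' l : {l : ℤ // l ≠ 0}, ‖fourierHat f ((l : ℤ) : ℝ)‖ ^ 2)) := by
  have hpi := Real.pi_pos
  obtain ⟨hc, C, hC⟩ := continuous_and_decay_fourierHat hf_smooth hf_supp
  have hf : BoundedMeasurable f :=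
    ⟨hf_smooth.continuous.measurable, hf_supp.exists_bound_of_continuous hf_smooth.continuous⟩
  have hsupp : ∀ᶠ N : ℕ in atTop,
      Function.support f ⊆ Set.Icc (-(Real.pi * N)) (Real.pi * N) := by
    obtain ⟨R, hR⟩ := hf_supp.isCompact.isBounded.subset_closedBall 0
    have h : Tendsto (fun N : ℕ => Real.pi * N) atTop atTop :=
      tendsto_natCast_atTop_atTop.const_mul_atTop hpi
    filter_upwards [h.eventually_ge_atTop R] with N hN x hx
    have := hR (subset_tsupport f hx)
    rw [mem_closedBall_zero_iff, Real.norm_eq_abs] at this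
    exact abs_le.1 (this.trans hN)
  have hm0 : ∀ t : ℝ, 0 ≤ min |t| 1 := fun t => by positivity
  have hm1 : ∀ t : ℝ, min |t| 1 ≤ 1 := fun t => min_le_right _ _
  have hdiv : ∀ N : ℕ, 1 ≤ N → ∀ k : ℕ,
      min ((k + 1 : ℕ) : ℝ) N = N * min |((k : ℝ) + 1) / N| 1 := by
    intro N hN k
    have hN0 : (0 : ℝ) < N := by exact_mod_cast hN
    rw [abs_of_nonneg (by positivity), mul_min_of_nonneg _ _ hN0.le, mul_div_cancel₀ _ hN0.ne',
      mul_one]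
    push_cast
    rfl
  obtain ⟨K, moment⟩ : ∃ K, ∀ (Q : ∀ N, Measure (Fin N → ℝ)) [∀ N, IsProbabilityMeasure (Q N)],
      HasPoissonBound Q → ∀ᶠ N : ℕ in atTop,
        ∫ τ, ∫ x, bipartiteTest f τ x ^ 4 ∂uniformAngle ∂(Q N) ≤ K := by
    refine ⟨8 * (24 * Real.exp (1 / (2 * Real.pi) * ∫ y, (Real.exp |f y| - 1)) +
      (1 / (2 * Real.pi) * ∫ y, f y) ^ 4), fun Q _ hQ => ?_⟩
    filter_upwards [hsupp, eventually_ge_atTop 1] with N hs hN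
    exact hQ.integral_bipartiteTest_pow_four_le hf hN hs
  refine ⟨⟨?_, fun τ hτ hind => ?_⟩, ⟨?_, fun τ hτ hτi hind => ?_⟩, ?_⟩
  · exact integrable_sq_fourierHat_mul hc hC (v := fun t => (min |t| 1) ^ 2) (by fun_prop)
      (fun t => sq_nonneg _) fun t => pow_le_one₀ (hm0 t) (hm1 t)
  · refine hasLocalGaussianLimit_of_conditionalVariance hf hsupp
      (mul_nonneg (by positivity) (integral_nonneg fun t => by positivity)) (fun u hu => ?_)
      (moment _ hasPoissonBound_circularUnitaryEnsemble) P hθ hτ hind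
    -- One factor `min(|t|,1)` comes from the variance weights of `θ`, the other from those of `τ`.
    simp_rw [sq (min |_| (1 : ℝ))]
    exact hasLinearGaussianLimit_circularUnitaryEnsemble.tendsto_integral_exp_bipartiteWeight
      (fun N k => le_min k.cast_nonneg N.cast_nonneg) (fun N k => min_le_right _ _) hc hC (w := fun t => min |t| 1)
      (by fun_prop) hm0 hm1 (fun t => by rw [abs_abs]) hdiv hu
  · exact integrable_sq_fourierHat_mul hc hC (v := fun t => min |t| 1) (by fun_prop) hm0 hm1
  · refine hasLocalGaussianLimit_of_conditionalVariance hf hsupp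
      (mul_nonneg (by positivity) (integral_nonneg fun t => mul_nonneg (sq_nonneg _) (hm0 t))) (fun u hu => ?_)
      (moment _ hasPoissonBound_iidUniformAngles) P hθ (fun N => (hτi N).hasLaw_pi (hτ N)) hind
    -- Independent points have the flat weight `w = 1`, so only the factor coming from `θ` remains.
    have h := hasLinearGaussianLimit_iidUniformAngles.tendsto_integral_exp_bipartiteWeight
      (fun N _ => N.cast_nonneg) (fun N k => le_rfl) hc hC (w := fun _ => 1)
      continuous_const (fun _ => zero_le_one) (fun _ => le_rfl) (fun _ => rfl)
      (fun N _ k => (mul_one _).symm) hu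
    simpa only [mul_one] using h
  · have hser : Summable fun m : ℕ => ‖fourierHat f ((m : ℝ) + 1)‖ ^ 2 := by
      -- The Riemann sum of mesh `1`, that is `N = 1`, is the series itself.
      have h := hasSum_lattice (G := fun t => ‖fourierHat f t‖ ^ 2) (hc.pow 2).measurable
        (fun t => (abs_of_nonneg (sq_nonneg _)).trans_le (hC t)) le_rfl
      simpa using h.2.2.summable
    have hsum := hasSum_sq_fourierHat_ne_zero hser
    refine ⟨hsum.summable, ?_⟩
    rw [hsum.tsum_eq]
    obtain ⟨D, hD⟩ := exists_abs_bipartiteTest_latticeAngles_le hf hf_supp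
    -- A deterministic `τ` has a Dirac law and is independent of everything. The Laplace transforms
    -- are constant for `N ≥ 1`, and the sup bound `D` replaces the Poisson moment bound.
    refine hasLocalGaussianLimit_of_conditionalVariance hf hsupp (K := D ^ 4)
      (Q := fun N => Measure.dirac (latticeAngles N))
      (mul_nonneg (by positivity) (mul_nonneg zero_le_two (tsum_nonneg fun m => by positivity)))
      (fun u hu => ?_) ?_ P hθ (τ := fun N _ => latticeAngles N)
      (fun N => hasLaw_dirac_of_ae_eq (.of_forall fun _ => rfl)) fun N => indepFun_const_left _ _
    · refine tendsto_const_nhds.congr' ?_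
      filter_upwards [eventually_ge_atTop 1] with N hN
      have hN0 : (N : ℝ) ≠ 0 := by positivity
      rw [integral_dirac, tsum_bipartiteWeight_latticeAngles hN]
      congr 2
      field_simp
    · filter_upwards [eventually_ge_atTop 1] with N hN
      rw [integral_dirac]
      refine (integral_mono ((boundedMeasurable_bipartiteTest hf _).pow 4).integrable
        (integrable_const (D ^ 4)) fun x => ?_).trans_eq (by simp)
      rw [← (by decide : Even 4).pow_abs]
      exact pow_le_pow_left₀ (abs_nonneg _) (hD N hN x) 4
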